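/- **Conventions.** A *formal sum* over a set $A$ is an element of the free commutative monoid on $A$. An *ordered blueprint* $B$ is a commutative monoid with zero $B^\bullet$ together with a relation $\sum a_i\le\sum b_j$ between finite formal sums of elements of $B^\bullet$ that is reflexive, transitive, additive and multiplicative, for which the formal sum $0$ (one summand) and the empty sum are $\le$ each other, and for which $a\le b$ and $b\le a$ imply $a=b$ for $a,b\in B^\bullet$. We write $\equiv$ for "$\le$ and $\ge$". Morphisms are maps preserving products, $0$, $1$ and the relation. A commutative (semi)ring is an ordered blueprint with $\sum a_i\le\sum b_j$ if and only if the two sums are equal. Let $\mathbb T$ be the semiring $\mathbb R_{\ge0}$ with the usual multiplication and with $\max$ as addition, endowed with the real topology. A *prime $k$-ideal* of $B$ is a subset $\mathfrak p\ni 0$ with $B\mathfrak p\subseteq\mathfrak p$, whose complement is a multiplicative submonoid, and such that $c+\sum a_i\equiv\sum b_j$ with $a_i,b_j\in\mathfrak p$ implies $c\in\mathfrak p$. The *spectrum* $\mathrm{Spec}\,B$ is the set of prime $k$-ideals with the topology generated by the sets $U_h=\{\mathfrak p\mid h\notin\mathfrak p\}$, with the structure sheaf whose sections over $U$ are the functions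 $\mathfrak p\mapsto s(\mathfrak p)\in B_{\mathfrak p}$ that are locally given by fractions, relations being tested in all localizations $B_{\mathfrak p}$. Morphisms between spaces with a sheaf of ordered blueprints are continuous maps with compatible pullbacks of sections that are local (non-units of stalks are sent to non-units). A $T$-scheme is formed as a colimit of spectra of $T$-algebras in this category. For a topological ordered blueprint $T$ and a space $X$ over $T$, let $X(T)$ be the set of $T$-linear morphisms $\mathrm{Spec}\,T\to X$. For $U$ affine, the affine topology on $U(T)$ is generated by the sets $\{\varphi\mid\varphi^\#(a)\in V\}$ with $a\in\Gamma U$ and $V\subseteq T$ open; in general the *fine topology* on $X(T)$ is the finest topology for which $\alpha_T:U(T)\to X(T)$ is continuous for every morphism $\alpha:U\to X$ over $T$ with $U$ affine, where $U(T)$ carries the affine topology. Let $k$ be a field with a nonarchimedean (possibly trivial) valuation $v:k\to\mathbb T$, that is, a multiplicative map with $v(0)=0$, $v(1)=1$ and $v(a+b)\le\max\{v(a),v(b)\}$. For an ordered blue $k$-algebra $B$, the *bend* $\mathrm{Bend}_v(B)$ is the $\mathbb T$-algebra that is the quotient of $B^\bullet\otimes_{k^\bullet}\mathbb T$ by the relations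 of $\mathbb T$ and by the relations $a\otimes1+\sum b_j\otimes1\equiv\sum b_j\otimes1$ for all $a\le\sum b_j$ in $B$. If an ordered blue $k$-scheme $X$ is presented as $\mathrm{colim}\,\mathrm{Spec}\,B_j$, then $\mathrm{Bend}_v(X)=\mathrm{colim}\,\mathrm{Spec}\,\mathrm{Bend}_v(B_j)$. Let $Y$ be a $k$-scheme. An *affine presentation* of $Y$ is a family $\{U_j\}_{j\in J}$ of affine opens covering $Y$, indexed by a preordered set $J$, with $U_i\subseteq U_j$ for $i\le j$, such that for every $x\in Y$ any two indices $i,j$ with $x\in U_i\cap U_j$ are connected by a zigzag of comparable indices $l$ with $x\in U_l$. For an affine open $U$ of $Y$, let $U^{\mathrm{an}}$ be the set of valuations $w:\Gamma U\to\mathbb T$ extending $v$, with the coarsest topology for which all evaluations $w\mapsto w(a)$ are continuous; the Berkovich space is the topological space $Y^{\mathrm{an}}=\mathrm{colim}_j\,U_j^{\mathrm{an}}$. **Theorem.** Let $k$ be a field and $v:k\to\mathbb T$ a nonarchimedean valuation. (1) Let $Y$ be a $k$-scheme with an affine presentation $\{U_j\}$. There is a homeomorphism $\Phi:Y^{\mathrm{an}}\to\mathrm{Bend}_v(Y)(\mathbb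 T)$ for the fine topology on the target, which sends a valuation $w\in U_j^{\mathrm{an}}$ to the composition of $\mathrm{Spec}\,\mathbb T\to\mathrm{Spec}\,\mathrm{Bend}_v(\Gamma U_j)$, given by $a\otimes t\mapsto w(a)\,t$, with the canonical morphism to $\mathrm{Bend}_v(Y)$. (2) Let $\Delta$ be a fan of strongly convex rational polyhedral cones in $\mathbb R^n$ with respect to the lattice $\mathbb Z^n$, let $X(\Delta)=\mathrm{colim}_{\tau\in\Delta}\mathrm{Spec}\,k[\tau^\vee\cap\mathbb Z^n]$ be its toric variety, and let $\iota:Y\to X(\Delta)$ be a closed immersion. Let $A_\tau$ be the multiplicative monoid $\tau^\vee\cap\mathbb Z^n$ with a zero adjoined, let $Y_\tau$ be the inverse image in $Y$ of the chart of $\tau$, and $\pi_\tau:k[\tau^\vee\cap\mathbb Z^n]\to\Gamma Y_\tau$ the induced map. The $Y_\tau$ form an affine presentation of $Y$, which we use for $Y^{\mathrm{an}}$ and $\mathrm{Bend}_v(Y)$. Let $\mathrm{Trop}(X(\Delta))=\mathrm{colim}_\tau\mathrm{Hom}(A_\tau,\mathbb T)$, where the set $\mathrm{Hom}(A_\tau,\mathbb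 T)$ of multiplicative maps preserving $0$ and $1$ has the coarsest topology for which all evaluations are continuous; let $\mathrm{trop}:Y^{\mathrm{an}}\to\mathrm{Trop}(X(\Delta))$ be given by $w\mapsto(w\circ\pi_\tau)|_{A_\tau}$ for $w\in Y_\tau^{\mathrm{an}}$, and let the *Kajiwara–Payne tropicalization* $\mathrm{Trop}^{KP}(Y)$ be the image of $\mathrm{trop}$ with the subspace topology. The *associated blue model* is $Z=\mathrm{colim}_\tau\,\mathrm{Spec}\,B_\tau$, where $B_\tau$ is the ordered blueprint with underlying monoid $\{\pi_\tau(ca)\mid c\in k,\ a\in A_\tau\}\subseteq\Gamma Y_\tau$ and with all relations $\sum a_i\equiv\sum b_j$ for which $\sum a_i=\sum b_j$ in $\Gamma Y_\tau$; the inclusions $B_\tau\subseteq\Gamma Y_\tau$ define $\beta:Y\to Z$. Then $\mathrm{trop}$ and the induced map $\mathrm{Bend}_v(\beta)(\mathbb T):\mathrm{Bend}_v(Y)(\mathbb T)\to\mathrm{Bend}_v(Z)(\mathbb T)$ are continuous, and there is a homeomorphism $\Psi:\mathrm{Trop}^{KP}(Y)\to\mathrm{Bend}_v(Z)(\mathbb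 T)$, for the fine topology on the target, such that $$\Psi\circ\mathrm{trop}=\mathrm{Bend}_v(\beta)(\mathbb T)\circ\Phi,$$ where $\Phi:Y^{\mathrm{an}}\to\mathrm{Bend}_v(Y)(\mathbb T)$ is the homeomorphism of (1). -/

import Mathlib

open CategoryTheory AlgebraicGeometry TopologicalSpace Opposite
open scoped NNReal

universe u v w u₁ u₂ u₃ u₄

namespace BlueTrop

/-! ## Ordered blueprints -/

/-- Product of two formal sums: the product of `∑ aᵢ` and `∑ bⱼ` is `∑ aᵢ bⱼ`. -/
def mulSum {A : Type u} [Mul A] (s t : Multiset A) : Multiset A :=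
  s.bind fun a => t.map fun b => a * b

theorem map_mulSum {A : Type u} {B : Type v} [Mul A] [Mul B] (f : A → B)
    (hf : ∀ a b, f (a * b) = f a * f b) (s t : Multiset A) :
    (mulSum s t).map f = mulSum (s.map f) (t.map f) := by
  simp [mulSum, Multiset.map_bind, Multiset.bind_map, Multiset.map_map, hf]

/-- An ordered blueprint: a commutative monoid with zero `A` together with a subaddition, which is
a relation `∑ aᵢ ≤ ∑ bⱼ` on the finite formal sums of elements of `A`. A finite formal sum of
elements of `A` is an element of the free commutative monoid on `A`, that is, a multiset. -/
structure OBlp where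
  /-- the underlying monoid with zero -/
  carrier : Type u
  [monoid : CommMonoidWithZero carrier]
  /-- `rel s t` means that `∑ s ≤ ∑ t` -/
  rel : Multiset carrier → Multiset carrier → Prop
  rel_refl : ∀ a, rel {a} {a}
  rel_trans : ∀ {s t r}, rel s t → rel t r → rel s r
  rel_add : ∀ {s t s' t'}, rel s t → rel s' t' → rel (s + s') (t + t')
  rel_mul : ∀ {s t s' t'}, rel s t → rel s' t' → rel (mulSum s s') (mulSum t t')
  zero_rel_empty : rel {0} 0
  empty_rel_zero : rel 0 {0}
  rel_antisymm : ∀ {a b}, rel {a} {b} → rel {b} {a} → a = b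

namespace OBlp

attribute [instance] OBlp.monoid

instance : CoeSort OBlp.{u} (Type u) := ⟨OBlp.carrier⟩

/-- A morphism of ordered blueprints. -/
structure Hom (B : OBlp.{u}) (C : OBlp.{v}) extends B.carrier →*₀ C.carrier where
  map_rel : ∀ {s t}, B.rel s t → C.rel (s.map toFun) (t.map toFun)

instance (B : OBlp.{u}) (C : OBlp.{v}) : FunLike (Hom B C) B.carrier C.carrier where
  coe f := f.toFun
  coe_injective f g h := by
    rcases f with ⟨f, hf⟩
    rcases g with ⟨g, hg⟩
    have : f = g := DFunLike.coe_injective h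
    subst this
    rfl

instance (B : OBlp.{u}) (C : OBlp.{v}) : MonoidWithZeroHomClass (Hom B C) B.carrier C.carrier where
  map_mul f := f.map_mul'
  map_one f := f.map_one'
  map_zero f := f.map_zero'

variable {B : OBlp.{u₁}} {C : OBlp.{u₂}} {D : OBlp.{u₃}}

theorem Hom.ext {f g : Hom B C} (h : ∀ a, f a = g a) : f = g := DFunLike.ext f g h

theorem Hom.rel (f : Hom B C) {s t} (h : B.rel s t) : C.rel (s.map f) (t.map f) := f.map_rel h

/-- The identity morphism. -/
def Hom.id (B : OBlp.{u}) : Hom B B where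
  __ := MonoidWithZeroHom.id B.carrier
  map_rel h := by simpa using h

/-- Composition of morphisms: first `f`, then `g`. -/
def Hom.comp (g : Hom C D) (f : Hom B C) : Hom B D where
  __ := g.toMonoidWithZeroHom.comp f.toMonoidWithZeroHom
  map_rel {s t} h := by
    have := g.rel (f.rel h)
    rw [Multiset.map_map, Multiset.map_map] at this
    exact this

@[simp] theorem Hom.id_apply (a : B) : Hom.id B a = a := rfl
@[simp] theorem Hom.comp_apply (g : Hom C D) (f : Hom B C) (a : B) : g.comp f a = g (f a) := rfl

theorem rel_refl_sum (B : OBlp.{u}) (s : Multiset B) : B.rel s s := by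
  induction s using Multiset.induction_on with
  | empty => exact B.rel_trans B.empty_rel_zero B.zero_rel_empty
  | cons a s ih => simpa using B.rel_add (B.rel_refl a) ih

theorem rel_smul {s t : Multiset B} (c : B) (h : B.rel s t) :
    B.rel (s.map (c * ·)) (t.map (c * ·)) := by
  have := B.rel_mul (B.rel_refl c) h
  simpa [mulSum] using this

/-- The full sub-blueprint structure on `A` induced by a jointly injective family of
multiplicative maps `fᵢ : A → Bᵢ`: a relation holds in `A` if and only if all its images hold. -/
def induced (A : Type u) [CommMonoidWithZero A] {I : Type w} (B : I → OBlp.{v})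
    (f : ∀ i, A →*₀ (B i).carrier) (hf : ∀ a b, (∀ i, f i a = f i b) → a = b) : OBlp.{u} where
  carrier := A
  rel s t := ∀ i, (B i).rel (s.map (f i)) (t.map (f i))
  rel_refl a i := rel_refl_sum _ _
  rel_trans h h' i := (B i).rel_trans (h i) (h' i)
  rel_add h h' i := by simpa using (B i).rel_add (h i) (h' i)
  rel_mul h h' i := by
    rw [map_mulSum _ (map_mul (f i)), map_mulSum _ (map_mul (f i))]
    exact (B i).rel_mul (h i) (h' i)
  zero_rel_empty i := by simpa using (B i).zero_rel_empty
  empty_rel_zero i := by simpa using (B i).empty_rel_zero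
  rel_antisymm h h' := hf _ _ fun i => (B i).rel_antisymm (by simpa using h i) (by simpa using h' i)

/-- A commutative (semi)ring as a trivially ordered blueprint: `∑ aᵢ ≤ ∑ bⱼ` if and only if the
two sums are equal. -/
def ofSemiring (R : Type u) [CommSemiring R] : OBlp.{u} where
  carrier := R
  rel s t := s.sum = t.sum
  rel_refl a := rfl
  rel_trans h h' := h.trans h'
  rel_add h h' := by simp [h, h']
  rel_mul {s t s' t'} h h' := by
    have key : ∀ s t : Multiset R, (mulSum s t).sum = s.sum * t.sum := by
      intro s t
      induction s using Multiset.induction_on with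
      | empty => simp [mulSum]
      | cons a s ih =>
        have h1 : mulSum (a ::ₘ s) t = (t.map fun b => a * b) + mulSum s t := by simp [mulSum]
        rw [h1, Multiset.sum_add, ih, Multiset.sum_cons, add_mul]
        congr 1
        exact (map_multiset_sum (AddMonoidHom.mulLeft a) t).symm
    rw [key, key, h, h']
  zero_rel_empty := by simp
  empty_rel_zero := by simp
  rel_antisymm h _ := by simpa using h

/-- A ring homomorphism as a morphism of ordered blueprints. -/
def Hom.ofRingHom {R : Type u} {S : Type v} [CommSemiring R] [CommSemiring S] (f : R →+* S) :
    Hom (ofSemiring R) (ofSemiring S) where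
  toFun := f
  map_zero' := map_zero f
  map_one' := map_one f
  map_mul' := map_mul f
  map_rel {s t} h := by
    have key : ∀ s t : Multiset R, s.sum = t.sum → (s.map f).sum = (t.map f).sum := by
      intro s t h
      rw [← map_multiset_sum, ← map_multiset_sum, h]
    exact key s t h

/-- The tropical numbers `𝕋`: the multiplicative monoid of nonnegative reals with the addition
`a + b = max a b`, whose neutral element is `0`, as a trivially ordered blueprint. -/
def tropical : OBlp.{0} where
  carrier := ℝ≥0
  rel s t := s.sup = t.sup
  rel_refl a := rfl
  rel_trans h h' := h.trans h'
  rel_add h h' := by simp [h, h']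
  rel_mul {s t s' t'} h h' := by
    have key : ∀ s t : Multiset ℝ≥0, (mulSum s t).sup = s.sup * t.sup := by
      intro s t
      have h1 : ∀ a : ℝ≥0, (t.map fun b => a * b).sup = a * t.sup := by
        intro a
        induction t using Multiset.induction_on with
        | empty => simp
        | cons b t ih => simp [ih, mul_max]
      induction s using Multiset.induction_on with
      | empty => simp [mulSum]
      | cons a s ih =>
        have : mulSum (a ::ₘ s) t = (t.map fun b => a * b) + mulSum s t := by simp [mulSum]
        rw [this, Multiset.sup_add, h1, ih]
        simp [max_mul]
    rw [key, key, h, h']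
  zero_rel_empty := by simp
  empty_rel_zero := by simp
  rel_antisymm h _ := by simpa using h

/-- The real topology of the tropical numbers. -/
instance : TopologicalSpace tropical.carrier := inferInstanceAs (TopologicalSpace ℝ≥0)

/-! ### Generated subadditions and proper quotients -/

/-- The smallest relation on formal sums that contains `S` and is reflexive, transitive, additive
and multiplicative and identifies the zero of `A` with the empty sum. -/
inductive Gen {A : Type u} [CommMonoidWithZero A] (S : Multiset A → Multiset A → Prop) :
    Multiset A → Multiset A → Prop
  | of {s t} : S s t → Gen S s t
  | refl (a) : Gen S {a} {a}
  | trans {s t r} : Gen S s t → Gen S t r → Gen S s r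
  | add {s t s' t'} : Gen S s t → Gen S s' t' → Gen S (s + s') (t + t')
  | mul {s t s' t'} : Gen S s t → Gen S s' t' → Gen S (mulSum s s') (mulSum t t')
  | zero_empty : Gen S {0} 0
  | empty_zero : Gen S 0 {0}

section Quotient

variable {A : Type u} [CommMonoidWithZero A] (S : Multiset A → Multiset A → Prop)

/-- The congruence identifying `a` and `b` if `a ≤ b` and `b ≤ a` in the generated relation. -/
def genCon : Con A where
  r a b := Gen S {a} {b} ∧ Gen S {b} {a}
  iseqv :=
    { refl := fun a => ⟨Gen.refl a, Gen.refl a⟩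
      symm := fun h => ⟨h.2, h.1⟩
      trans := fun h h' => ⟨h.1.trans h'.1, h'.2.trans h.2⟩ }
  mul' h h' := by
    have h1 := Gen.mul h.1 h'.1
    have h2 := Gen.mul h.2 h'.2
    exact ⟨by simpa [mulSum] using h1, by simpa [mulSum] using h2⟩

/-- The underlying monoid with zero of the proper quotient. -/
def QuotCarrier : Type u := (genCon S).Quotient

instance : CommMonoidWithZero (QuotCarrier S) where
  __ := (inferInstance : CommMonoid (genCon S).Quotient)
  zero := ((0 : A) : (genCon S).Quotient)
  zero_mul a := by
    obtain ⟨a, rfl⟩ := Quotient.exists_rep a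
    exact congrArg (fun x : A => ((x : A) : (genCon S).Quotient)) (zero_mul a)
  mul_zero a := by
    obtain ⟨a, rfl⟩ := Quotient.exists_rep a
    exact congrArg (fun x : A => ((x : A) : (genCon S).Quotient)) (mul_zero a)

/-- The quotient map. -/
def quotMk : A →*₀ QuotCarrier S where
  toFun a := (a : (genCon S).Quotient)
  map_zero' := rfl
  map_one' := rfl
  map_mul' _ _ := rfl

theorem quotMk_surjective : Function.Surjective (quotMk S) := fun a => Quotient.exists_rep a

theorem quotMk_eq {a b : A} : quotMk S a = quotMk S b ↔ Gen S {a} {b} ∧ Gen S {b} {a} :=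
  (genCon S).eq

theorem gen_of_map_eq {s t : Multiset A} (h : s.map (quotMk S) = t.map (quotMk S)) :
    Gen S s t := by
  have h' := (Multiset.rel_map (p := Eq) (f := quotMk S) (g := quotMk S)).1 (Multiset.rel_eq.2 h)
  induction h' with
  | zero => exact Gen.empty_zero.trans Gen.zero_empty
  | cons hab hr ih =>
    simpa using Gen.add ((quotMk_eq S).1 hab).1 (ih (Multiset.rel_eq.1 ((Multiset.rel_map).2 hr)))

/-- The ordered blueprint `A // ⟨S⟩`: the proper quotient of `A` equipped with the subaddition
generated by `S`. -/
def ofGen : OBlp.{u} where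
  carrier := QuotCarrier S
  rel s t := ∃ s' t' : Multiset A, s'.map (quotMk S) = s ∧ t'.map (quotMk S) = t ∧ Gen S s' t'
  rel_refl a := by
    obtain ⟨a, rfl⟩ := quotMk_surjective S a
    exact ⟨{a}, {a}, by simp, by simp, Gen.refl a⟩
  rel_trans := by
    rintro _ _ _ ⟨s, t, rfl, rfl, h⟩ ⟨t', r, ht, rfl, h'⟩
    exact ⟨s, r, rfl, rfl, (h.trans (gen_of_map_eq S ht.symm)).trans h'⟩
  rel_add := by
    rintro _ _ _ _ ⟨s, t, rfl, rfl, h⟩ ⟨s', t', rfl, rfl, h'⟩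
    exact ⟨s + s', t + t', by simp, by simp, h.add h'⟩
  rel_mul := by
    rintro _ _ _ _ ⟨s, t, rfl, rfl, h⟩ ⟨s', t', rfl, rfl, h'⟩
    exact ⟨mulSum s s', mulSum t t', map_mulSum _ (map_mul _) _ _, map_mulSum _ (map_mul _) _ _,
      h.mul h'⟩
  zero_rel_empty := ⟨{0}, 0, by simp, by simp, Gen.zero_empty⟩
  empty_rel_zero := ⟨0, {0}, by simp, by simp, Gen.empty_zero⟩
  rel_antisymm := by
    rintro a b ⟨s, t, hs, ht, h⟩ ⟨t', s', ht', hs', h'⟩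
    obtain ⟨a', rfl⟩ := quotMk_surjective S a
    obtain ⟨b', rfl⟩ := quotMk_surjective S b
    refine (quotMk_eq S).2 ⟨?_, ?_⟩
    · exact ((gen_of_map_eq S (by simpa using hs.symm)).trans h).trans
        (gen_of_map_eq S (by simpa using ht))
    · exact ((gen_of_map_eq S (by simpa using ht'.symm)).trans h').trans
        (gen_of_map_eq S (by simpa using hs'))

/-- The multiplicative map `A → A // ⟨S⟩`. -/
def ofGenMk : A →*₀ (ofGen S).carrier := quotMk S

theorem ofGenMk_surjective : Function.Surjective (ofGenMk S) := quotMk_surjective S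

theorem ofGen_rel {s t : Multiset A} (h : Gen S s t) :
    (ofGen S).rel (s.map (ofGenMk S)) (t.map (ofGenMk S)) := ⟨s, t, rfl, rfl, h⟩

variable {S}

theorem gen_map {C : OBlp.{v}} (f : A →*₀ C.carrier)
    (hf : ∀ s t, S s t → C.rel (s.map f) (t.map f)) {s t : Multiset A} (h : Gen S s t) :
    C.rel (s.map f) (t.map f) := by
  induction h with
  | of h => exact hf _ _ h
  | refl a => exact C.rel_refl_sum _
  | trans _ _ h h' => exact C.rel_trans h h'
  | add _ _ h h' => simpa using C.rel_add h h'
  | mul _ _ h h' =>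
    rw [map_mulSum _ (map_mul f), map_mulSum _ (map_mul f)]
    exact C.rel_mul h h'
  | zero_empty => simpa using C.zero_rel_empty
  | empty_zero => simpa using C.empty_rel_zero

/-- The universal property of `A // ⟨S⟩`. -/
def ofGenLift {C : OBlp.{v}} (f : A →*₀ C.carrier)
    (hf : ∀ s t, S s t → C.rel (s.map f) (t.map f)) : Hom (ofGen S) C where
  toFun := Quotient.lift (s := (genCon S).toSetoid) f fun a b h => by
    have h1 := gen_map f hf h.1
    have h2 := gen_map f hf h.2
    exact C.rel_antisymm (by simpa using h1) (by simpa using h2)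
  map_zero' := map_zero f
  map_one' := map_one f
  map_mul' a b := by
    obtain ⟨a, rfl⟩ := quotMk_surjective S a
    obtain ⟨b, rfl⟩ := quotMk_surjective S b
    exact map_mul f a b
  map_rel := by
    rintro _ _ ⟨s, t, rfl, rfl, h⟩
    have e : ∀ r : Multiset A, (r.map (quotMk S)).map (Quotient.lift (s := (genCon S).toSetoid) f
        fun a b h => C.rel_antisymm (by simpa using gen_map f hf h.1)
          (by simpa using gen_map f hf h.2)) = r.map f :=
      fun r => Multiset.map_map _ _ _
    have := gen_map f hf h
    rw [← e s, ← e t] at this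
    exact this

@[simp] theorem ofGenLift_mk {C : OBlp.{v}} (f : A →*₀ C.carrier)
    (hf : ∀ s t, S s t → C.rel (s.map f) (t.map f)) (a : A) :
    ofGenLift f hf (ofGenMk S a) = f a := rfl

theorem ofGen_hom_ext {C : OBlp.{v}} {f g : Hom (ofGen S) C}
    (h : ∀ a, f (ofGenMk S a) = g (ofGenMk S a)) : f = g :=
  Hom.ext fun a => by
    obtain ⟨a, rfl⟩ := ofGenMk_surjective S a
    exact h a

end Quotient

/-! ### Localizations -/

section Localization

variable (B : OBlp.{u}) (S : Submonoid B.carrier)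

theorem locMk_eq {a b : B.carrier} {x y : S} (h : (y : B.carrier) * a = x * b) :
    Localization.mk a x = Localization.mk b y := by
  rw [Localization.mk_eq_mk_iff, Localization.r_iff_exists]
  exact ⟨1, by simpa using h⟩

theorem loc_map_eq {a b : Multiset B.carrier} {x y : S}
    (h : a.map (fun c => Localization.mk c x) = b.map (fun c => Localization.mk c y)) :
    ∃ r : S, a.map (fun c => (r * y : B.carrier) * c) = b.map (fun c => (r * x : B.carrier) * c) := by
  have h' := (Multiset.rel_map (p := Eq) (f := fun c => Localization.mk c x)
    (g := fun c => Localization.mk c y)).1 (Multiset.rel_eq.2 h)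
  clear h
  induction h' with
  | zero => exact ⟨1, rfl⟩
  | @cons c d _ _ hab _ ih =>
    obtain ⟨r, hr⟩ := ih
    rw [Localization.mk_eq_mk_iff, Localization.r_iff_exists] at hab
    obtain ⟨q, hq⟩ := hab
    refine ⟨q * r, ?_⟩
    have hr' := congrArg (Multiset.map (fun c => (q : B.carrier) * c)) hr
    simp only [Multiset.map_map, Function.comp_def] at hr'
    simp only [Multiset.map_cons, Submonoid.coe_mul]
    congr 1
    · simp only at hq
      calc (q * r * y : B.carrier) * c = (r : B.carrier) * (q * (y * c)) := by
            simp only [mul_comm, mul_left_comm]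
        _ = (r : B.carrier) * (q * (x * d)) := by rw [hq]
        _ = _ := by simp only [mul_comm, mul_left_comm]
    · simpa only [mul_assoc] using hr'

/-- The localization `S⁻¹B`. Its underlying monoid is the localization of the monoid `B`, and its
subaddition consists of the relations `∑ aᵢ/u ≤ ∑ bⱼ/u` with `u ∈ S` and `∑ aᵢ ≤ ∑ bⱼ` in `B`; this
is the subaddition that is generated by the relations `∑ aᵢ/1 ≤ ∑ bⱼ/1`. -/
def loc : OBlp.{u} where
  carrier := Localization S
  rel s t := ∃ (x : S) (a b : Multiset B.carrier), B.rel a b ∧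
    s = a.map (fun c => Localization.mk c x) ∧ t = b.map (fun c => Localization.mk c x)
  rel_refl a := by
    induction a using Localization.induction_on with
    | H y => exact ⟨y.2, {y.1}, {y.1}, B.rel_refl _, by simp, by simp⟩
  rel_trans := by
    rintro _ _ _ ⟨x, a, b, h, rfl, rfl⟩ ⟨y, c, d, h', hbc, rfl⟩
    obtain ⟨r, hr⟩ := loc_map_eq B S hbc
    refine ⟨r * y * x, a.map (fun c => (r * y : B.carrier) * c),
      d.map (fun c => (r * x : B.carrier) * c), ?_, ?_, ?_⟩
    · exact B.rel_trans (B.rel_smul _ h) (hr ▸ B.rel_smul _ h')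
    · rw [Multiset.map_map]
      refine Multiset.map_congr rfl fun c _ => ?_
      exact locMk_eq B S (by simp only [Submonoid.coe_mul, mul_comm, mul_left_comm])
    · rw [Multiset.map_map]
      refine Multiset.map_congr rfl fun c _ => ?_
      exact locMk_eq B S (by simp only [Submonoid.coe_mul, mul_comm, mul_left_comm])
  rel_add := by
    rintro _ _ _ _ ⟨x, a, b, h, rfl, rfl⟩ ⟨y, c, d, h', rfl, rfl⟩
    have key : ∀ c d : Multiset B.carrier,
        c.map (fun c => Localization.mk c x) + d.map (fun c => Localization.mk c y) =
        (c.map (fun c => (y : B.carrier) * c) + d.map (fun c => (x : B.carrier) * c)).map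
          (fun c => Localization.mk c (x * y)) := by
      intro c d
      rw [Multiset.map_add, Multiset.map_map, Multiset.map_map]
      congr 1
      · refine Multiset.map_congr rfl fun c _ => ?_
        exact locMk_eq B S (by simp only [Submonoid.coe_mul, mul_comm, mul_left_comm])
      · refine Multiset.map_congr rfl fun c _ => ?_
        exact locMk_eq B S (by simp only [Submonoid.coe_mul, mul_comm, mul_left_comm])
    exact ⟨x * y, _, _, B.rel_add (B.rel_smul _ h) (B.rel_smul _ h'), key _ _, key _ _⟩
  rel_mul := by
    rintro _ _ _ _ ⟨x, a, b, h, rfl, rfl⟩ ⟨y, c, d, h', rfl, rfl⟩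
    have key : ∀ c d : Multiset B.carrier,
        mulSum (c.map (fun c => Localization.mk c x)) (d.map (fun c => Localization.mk c y)) =
        (mulSum c d).map (fun c => Localization.mk c (x * y)) := by
      intro c d
      simp [mulSum, Multiset.map_bind, Multiset.bind_map, Multiset.map_map,
        Localization.mk_mul]
    exact ⟨x * y, _, _, B.rel_mul h h', key _ _, key _ _⟩
  zero_rel_empty := ⟨1, {0}, 0, B.zero_rel_empty, by simp [Localization.mk_zero], by simp⟩
  empty_rel_zero := ⟨1, 0, {0}, B.empty_rel_zero, by simp, by simp [Localization.mk_zero]⟩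
  rel_antisymm := by
    rintro p q ⟨x, a, b, h, ha, hb⟩ ⟨y, c, d, h', hc, hd⟩
    obtain ⟨a, rfl, rfl⟩ := Multiset.map_eq_singleton.1 ha.symm
    obtain ⟨b, rfl, rfl⟩ := Multiset.map_eq_singleton.1 hb.symm
    obtain ⟨c, rfl, hc'⟩ := Multiset.map_eq_singleton.1 hc.symm
    clear hc
    obtain ⟨d, rfl, hd'⟩ := Multiset.map_eq_singleton.1 hd.symm
    clear hd
    rw [Localization.mk_eq_mk_iff, Localization.r_iff_exists] at hc' hd'
    obtain ⟨r, hr⟩ := hc'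
    obtain ⟨q, hq⟩ := hd'
    simp only at hr hq
    have h1 := B.rel_smul (r * q * y : B.carrier) h
    have h2 := B.rel_smul (r * q * x : B.carrier) h'
    simp only [Multiset.map_singleton] at h1 h2
    have e1 : (r * q * y : B.carrier) * b = r * q * x * c := by
      calc _ = (q : B.carrier) * (r * (y * b)) := by simp only [mul_comm, mul_left_comm]
        _ = (q : B.carrier) * (r * (x * c)) := by rw [← hr]
        _ = _ := by simp only [mul_comm, mul_left_comm]
    have e2 : (r * q * y : B.carrier) * a = r * q * x * d := by
      calc _ = (r : B.carrier) * (q * (y * a)) := by simp only [mul_comm, mul_left_comm]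
        _ = (r : B.carrier) * (q * (x * d)) := by rw [← hq]
        _ = _ := by simp only [mul_comm, mul_left_comm]
    rw [e1, e2] at h1
    have e := B.rel_antisymm h1 h2
    rw [Localization.mk_eq_mk_iff, Localization.r_iff_exists]
    refine ⟨r * q * y, ?_⟩
    simp only [Submonoid.coe_mul]
    calc _ = (x : B.carrier) * ((r * q * y) * a) := by simp only [mul_comm, mul_left_comm]
      _ = (x : B.carrier) * ((r * q * y) * b) := by rw [e1, e2, e]
      _ = _ := by simp only [mul_comm, mul_left_comm]

/-- The fraction `a/x` in `S⁻¹B`. -/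
def frac (a : B.carrier) (x : S) : (B.loc S).carrier := Localization.mk a x

variable {B S}

theorem frac_eq {a b : B.carrier} {x y : S} :
    B.frac S a x = B.frac S b y ↔ ∃ r : S, (r : B.carrier) * (y * a) = r * (x * b) := by
  exact (Localization.mk_eq_mk_iff (S := S)).trans Localization.r_iff_exists

theorem frac_surj (p : (B.loc S).carrier) : ∃ a x, p = B.frac S a x := by
  induction p using Localization.induction_on with
  | H y => exact ⟨y.1, y.2, rfl⟩

theorem frac_mul (a b : B.carrier) (x y : S) :
    B.frac S a x * B.frac S b y = B.frac S (a * b) (x * y) := Localization.mk_mul _ _ _ _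

theorem frac_one : B.frac S 1 1 = 1 := Localization.mk_one

theorem frac_zero : B.frac S 0 1 = 0 := Localization.mk_zero _

/-- The morphism of localizations induced by a morphism `B → C` that maps `S` into `S'`. -/
def locMap (f : Hom B C) (S : Submonoid B.carrier) (S' : Submonoid C.carrier)
    (h : ∀ a ∈ S, f a ∈ S') : Hom (B.loc S) (C.loc S') where
  toFun p := Localization.liftOn p (fun a x => C.frac S' (f a) ⟨f x, h _ x.2⟩) (by
    intro a b x y hr
    rw [Localization.r_iff_exists] at hr
    obtain ⟨r, hr⟩ := hr
    refine frac_eq.2 ⟨⟨f r, h _ r.2⟩, ?_⟩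
    simpa using congrArg f hr)
  map_zero' := by
    rw [← frac_zero]
    change C.frac S' (f 0) ⟨f 1, _⟩ = 0
    rw [← frac_zero]
    simp only [map_zero, map_one]
    rfl
  map_one' := by
    rw [← frac_one]
    change C.frac S' (f 1) ⟨f 1, _⟩ = 1
    rw [← frac_one]
    simp only [map_one]
    rfl
  map_mul' p q := by
    obtain ⟨a, x, rfl⟩ := frac_surj p
    obtain ⟨b, y, rfl⟩ := frac_surj q
    rw [frac_mul]
    change C.frac S' (f (a * b)) ⟨f (x * y), _⟩ = C.frac S' (f a) ⟨f x, _⟩ * C.frac S' (f b) ⟨f y, _⟩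
    rw [frac_mul]
    simp only [map_mul]
    rfl
  map_rel := by
    rintro _ _ ⟨x, a, b, hab, rfl, rfl⟩
    refine ⟨⟨f x, h _ x.2⟩, a.map f, b.map f, f.rel hab, ?_, ?_⟩ <;>
    · refine (Multiset.map_map _ _ _).trans ?_
      symm
      exact Multiset.map_map _ _ _

@[simp] theorem locMap_frac (f : Hom B C) (S : Submonoid B.carrier) (S' : Submonoid C.carrier)
    (h : ∀ a ∈ S, f a ∈ S') (a : B.carrier) (x : S) :
    locMap f S S' h (B.frac S a x) = C.frac S' (f a) ⟨f x, h _ x.2⟩ := rfl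

end Localization

end OBlp

/-! ## Ordered blueprinted spaces -/

/-- An ordered blueprinted space: a topological space with a sheaf of ordered blueprints. -/
structure OBSpace where
  /-- the underlying topological space -/
  carrier : Type u
  [top : TopologicalSpace carrier]
  /-- the ordered blueprint of sections over an open subset -/
  sec : Opens carrier → OBlp.{u}
  /-- the restriction maps -/
  res : ∀ {U V : Opens carrier}, V ≤ U → OBlp.Hom (sec U) (sec V)
  res_self : ∀ {U : Opens carrier} (s : sec U), res le_rfl s = s
  res_res : ∀ {U V W : Opens carrier} (h : V ≤ U) (h' : W ≤ V) (s : sec U),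
    res h' (res h s) = res (h'.trans h) s
  /-- compatible families of sections glue uniquely -/
  glue : ∀ {I : Type u} (W : Opens carrier) (U : I → Opens carrier) (hU : ∀ i, U i ≤ W),
    (∀ x ∈ W, ∃ i, x ∈ U i) → ∀ s : ∀ i, sec (U i),
    (∀ (i j : I) (V : Opens carrier) (hi : V ≤ U i) (hj : V ≤ U j),
      res hi (s i) = res hj (s j)) →
    ∃! t : sec W, ∀ i, res (hU i) t = s i
  /-- relations between sections can be verified on an open covering -/
  rel_local : ∀ {I : Type u} (W : Opens carrier) (U : I → Opens carrier) (hU : ∀ i, U i ≤ W),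
    (∀ x ∈ W, ∃ i, x ∈ U i) → ∀ s t : Multiset (sec W),
    (∀ i, (sec (U i)).rel (s.map (res (hU i))) (t.map (res (hU i)))) → (sec W).rel s t

namespace OBSpace

attribute [instance] OBSpace.top

instance : CoeSort OBSpace.{u} (Type u) := ⟨OBSpace.carrier⟩

/-- A morphism of ordered blueprinted spaces: a continuous map together with maps of sections
`𝒪_Y(V) → 𝒪_X(U)` for all open `U` that are mapped into `V`, compatible with restrictions and local:
if the pullback of a section is invertible around a point, then the section is invertible around the
image of this point. In other words, the maps between stalks send non-units to non-units. -/
structure Hom (X : OBSpace.{u}) (Y : OBSpace.{v}) where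
  /-- the map of points -/
  toFun : X → Y
  continuous_toFun : Continuous toFun
  /-- the pullback of sections -/
  app : ∀ (V : Opens Y) (U : Opens X), (∀ x ∈ U, toFun x ∈ V) → OBlp.Hom (Y.sec V) (X.sec U)
  app_res : ∀ {V V' : Opens Y} {U U' : Opens X} (hV : V' ≤ V) (hU : U' ≤ U)
    (h : ∀ x ∈ U, toFun x ∈ V) (h' : ∀ x ∈ U', toFun x ∈ V') (s : Y.sec V),
    app V' U' h' (Y.res hV s) = X.res hU (app V U h s)
  isLocal : ∀ (V : Opens Y) (U : Opens X) (h : ∀ x ∈ U, toFun x ∈ V) (s : Y.sec V),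
    IsUnit (app V U h s) → ∀ x ∈ U, ∃ (V' : Opens Y) (hV : V' ≤ V), toFun x ∈ V' ∧
      IsUnit (Y.res hV s)

variable {X : OBSpace.{u₁}} {Y : OBSpace.{u₂}} {Z : OBSpace.{u₃}} {Z' : OBSpace.{u₄}}

theorem Hom.ext {f g : Hom X Y} (h : ∀ x, f.toFun x = g.toFun x)
    (h' : ∀ V U (hf : ∀ x ∈ U, f.toFun x ∈ V) (hg : ∀ x ∈ U, g.toFun x ∈ V) (s : Y.sec V),
      f.app V U hf s = g.app V U hg s) : f = g := by
  rcases f with ⟨f, hf, fa, fn, fl⟩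
  rcases g with ⟨g, hg, ga, gn, gl⟩
  obtain rfl : f = g := funext h
  have : fa = ga := by
    funext V U hU
    exact OBlp.Hom.ext fun s => h' V U hU hU s
  subst this
  rfl

/-- The preimage of an open subset. -/
def Hom.preimage (f : Hom X Y) (V : Opens Y) : Opens X :=
  ⟨f.toFun ⁻¹' V, V.isOpen.preimage f.continuous_toFun⟩

/-- The identity morphism. -/
def Hom.id (X : OBSpace.{u}) : Hom X X where
  toFun x := x
  continuous_toFun := continuous_id
  app V U h := X.res (show U ≤ V from h)
  app_res hV hU h h' s := by rw [X.res_res, X.res_res]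
  isLocal V U h s hs x hx := ⟨U, h, hx, hs⟩

/-- Composition of morphisms: first `f`, then `g`. -/
def Hom.comp (g : Hom Y Z) (f : Hom X Y) : Hom X Z where
  toFun x := g.toFun (f.toFun x)
  continuous_toFun := g.continuous_toFun.comp f.continuous_toFun
  app W U h := (f.app (g.preimage W) U h).comp (g.app W (g.preimage W) fun _ hx => hx)
  app_res {W W' U U'} hW hU h h' s :=
    have hp : g.preimage W' ≤ g.preimage W := fun x hx => hW hx
    (congrArg (f.app (g.preimage W') U' h')
      (g.app_res hW hp (fun _ hx => hx) (fun _ hx => hx) s)).trans (f.app_res hp hU h h' _)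
  isLocal W U h s hs x hx := by
    obtain ⟨V', hV', hx', hu⟩ := f.isLocal _ _ _ _ hs x hx
    have e := g.app_res (le_refl W) hV' (fun _ hx => hx) (fun _ hx => hV' hx) s
    have e' : g.app W V' (fun _ hx => hV' hx) s = Y.res hV' (g.app W (g.preimage W) (fun _ hx => hx) s) :=
      (congrArg _ (Z.res_self s).symm).trans e
    exact g.isLocal W V' (fun _ hx => hV' hx) s (e' ▸ hu) _ hx'

theorem Hom.app_restrict (f : Hom X Y) (V : Opens Y) {U U' : Opens X} (hU : U' ≤ U)
    (h : ∀ x ∈ U, f.toFun x ∈ V) (h' : ∀ x ∈ U', f.toFun x ∈ V) (s : Y.sec V) :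
    f.app V U' h' s = X.res hU (f.app V U h s) :=
  (congrArg _ (Y.res_self s).symm).trans (f.app_res (le_refl V) hU h h' s)

theorem Hom.app_restrict' (f : Hom X Y) {V V' : Opens Y} (hV : V' ≤ V) (U : Opens X)
    (h : ∀ x ∈ U, f.toFun x ∈ V) (h' : ∀ x ∈ U, f.toFun x ∈ V') (s : Y.sec V) :
    f.app V' U h' (Y.res hV s) = f.app V U h s :=
  (f.app_res hV (le_refl U) h h' s).trans (X.res_self _)

theorem Hom.comp_app (g : Hom Y Z) (f : Hom X Y) (W : Opens Z) (U : Opens X) (V : Opens Y)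
    (h : ∀ x ∈ U, g.toFun (f.toFun x) ∈ W) (h₁ : ∀ x ∈ U, f.toFun x ∈ V)
    (h₂ : ∀ x ∈ V, g.toFun x ∈ W) (s : Z.sec W) :
    (g.comp f).app W U h s = f.app V U h₁ (g.app W V h₂ s) := by
  have hV : V ≤ g.preimage W := h₂
  have e := g.app_restrict W hV (fun _ hx => hx) h₂ s
  exact (f.app_restrict' hV U h h₁ _).symm.trans (congrArg _ e.symm)

theorem Hom.comp_assoc (k : Hom Z Z') (g : Hom Y Z) (f : Hom X Y) :
    (k.comp g).comp f = k.comp (g.comp f) := Hom.ext (fun _ => rfl) fun _ _ _ _ _ => rfl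

/-! ### Consequences of the sheaf axioms -/

theorem sec_ext (X : OBSpace.{u}) {I : Type w} (W : Opens X) (U : I → Opens X)
    (hU : ∀ i, U i ≤ W) (hcov : ∀ x ∈ W, ∃ i, x ∈ U i) (s t : X.sec W)
    (h : ∀ i, X.res (hU i) s = X.res (hU i) t) : s = t := by
  have hc : ∀ x ∈ W, ∃ V : Set.range U, x ∈ V.1 := fun x hx =>
    let ⟨i, hi⟩ := hcov x hx
    ⟨⟨U i, i, rfl⟩, hi⟩
  have hle : ∀ V : Set.range U, V.1 ≤ W := by
    rintro ⟨_, i, rfl⟩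
    exact hU i
  obtain ⟨r, -, hr⟩ := X.glue W (fun V : Set.range U => V.1) hle hc (fun V => X.res (hle V) s)
    (fun V V' V'' hi hj => by rw [X.res_res, X.res_res])
  have h1 := hr s fun _ => rfl
  have h2 := hr t (by
    rintro ⟨_, i, rfl⟩
    exact (h i).symm)
  exact h1.trans h2.symm

theorem exists_glue (X : OBSpace.{u}) {I : Type w} (W : Opens X) (U : I → Opens X)
    (hU : ∀ i, U i ≤ W) (hcov : ∀ x ∈ W, ∃ i, x ∈ U i) (s : ∀ i, X.sec (U i))
    (hs : ∀ (i j : I) (V : Opens X) (hi : V ≤ U i) (hj : V ≤ U j),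
      X.res hi (s i) = X.res hj (s j)) :
    ∃ t : X.sec W, ∀ i, X.res (hU i) t = s i := by
  have hc : ∀ x ∈ W, ∃ V : Set.range U, x ∈ V.1 := fun x hx =>
    let ⟨i, hi⟩ := hcov x hx
    ⟨⟨U i, i, rfl⟩, hi⟩
  have hle : ∀ V : Set.range U, V.1 ≤ W := by
    rintro ⟨_, i, rfl⟩
    exact hU i
  choose c hcc using fun V : Set.range U => V.2
  obtain ⟨t, ht, -⟩ := X.glue W (fun V : Set.range U => V.1) hle hc
    (fun V => X.res (hcc V).ge (s (c V))) (fun V V' V'' hi hj => by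
      rw [X.res_res, X.res_res]
      exact hs _ _ _ _ _)
  refine ⟨t, fun i => ?_⟩
  have := ht ⟨U i, i, rfl⟩
  exact this.trans ((hs _ i (U i) _ le_rfl).trans (X.res_self _))

theorem rel_of_local (X : OBSpace.{u}) {I : Type w} (W : Opens X) (U : I → Opens X)
    (hU : ∀ i, U i ≤ W) (hcov : ∀ x ∈ W, ∃ i, x ∈ U i) (s t : Multiset (X.sec W))
    (h : ∀ i, (X.sec (U i)).rel (s.map (X.res (hU i))) (t.map (X.res (hU i)))) :
    (X.sec W).rel s t := by
  have hc : ∀ x ∈ W, ∃ V : Set.range U, x ∈ V.1 := fun x hx =>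
    let ⟨i, hi⟩ := hcov x hx
    ⟨⟨U i, i, rfl⟩, hi⟩
  have hle : ∀ V : Set.range U, V.1 ≤ W := by
    rintro ⟨_, i, rfl⟩
    exact hU i
  refine X.rel_local W (fun V : Set.range U => V.1) hle hc s t ?_
  rintro ⟨_, i, rfl⟩
  exact h i

theorem isUnit_of_local (X : OBSpace.{u}) (W : Opens X) (s : X.sec W)
    (h : ∀ x ∈ W, ∃ (V : Opens X) (hV : V ≤ W), x ∈ V ∧ IsUnit (X.res hV s)) : IsUnit s := by
  choose V hV hx hu using h
  choose r hr using fun x : W => (hu x.1 x.2).exists_right_inv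
  have hcov : ∀ x ∈ W, ∃ y : W, x ∈ V y.1 y.2 := fun x hx' => ⟨⟨x, hx'⟩, hx x hx'⟩
  obtain ⟨t, ht⟩ := X.exists_glue W (fun y : W => V y.1 y.2) (fun y => hV y.1 y.2) hcov r (by
    intro x y U hi hj
    have h1 : X.res (hi.trans (hV _ _)) s * X.res hi (r x) = 1 := by
      rw [← X.res_res (hV _ _) hi, ← map_mul, hr, map_one]
    have h2 : X.res (hj.trans (hV _ _)) s * X.res hj (r y) = 1 := by
      rw [← X.res_res (hV _ _) hj, ← map_mul, hr, map_one]
    exact left_inv_eq_right_inv ((mul_comm _ _).trans h1) h2)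
  refine IsUnit.of_mul_eq_one t (X.sec_ext W (fun y : W => V y.1 y.2) (fun y => hV y.1 y.2) hcov _ _
    fun y => ?_)
  rw [map_mul, ht, hr, map_one]

/-! ### Gluing -/

section Colimit

variable {J : Type w} [Preorder J] (X : J → OBSpace.{u}) (m : ∀ i j : J, i ≤ j → Hom (X i) (X j))

/-- The points of the colimit of the spaces `Xᵢ` along the morphisms `Xᵢ → Xⱼ` for `i ≤ j`. It
carries the quotient topology of the disjoint union of the `Xᵢ`. -/
def ColimPt : Type max w u :=
  Quot fun p q : Σ j, (X j).carrier => ∃ h : p.1 ≤ q.1, (m p.1 q.1 h).toFun p.2 = q.2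

instance : TopologicalSpace (ColimPt X m) :=
  inferInstanceAs (TopologicalSpace (Quot _))

/-- The canonical map `Xⱼ → colim Xᵢ` on points. -/
def colimPt (j : J) (x : X j) : ColimPt X m := Quot.mk _ ⟨j, x⟩

theorem colimPt_map {i j : J} (h : i ≤ j) (x : X i) :
    colimPt X m j ((m i j h).toFun x) = colimPt X m i x := (Quot.sound ⟨h, rfl⟩).symm

theorem continuous_colimPt (j : J) : Continuous (colimPt X m j) :=
  continuous_quot_mk.comp continuous_sigmaMk

/-- The preimage in `Xⱼ` of an open subset of `colim Xᵢ`. -/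
def colimPre (W : Opens (ColimPt X m)) (j : J) : Opens (X j) :=
  ⟨colimPt X m j ⁻¹' W, W.isOpen.preimage (continuous_colimPt X m j)⟩

theorem map_mem_colimPre (W : Opens (ColimPt X m)) {i j : J} (h : i ≤ j) (x : X i)
    (hx : x ∈ colimPre X m W i) : (m i j h).toFun x ∈ colimPre X m W j := by
  change colimPt X m j ((m i j h).toFun x) ∈ W
  rw [colimPt_map]
  exact hx

/-- Sections over an open subset `W` of `colim Xᵢ`: compatible families of sections over the
preimages of `W` in the `Xᵢ`. -/
def colimSub (W : Opens (ColimPt X m)) : Submonoid (∀ j, ((X j).sec (colimPre X m W j)).carrier) where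
  carrier := {s | ∀ (i j : J) (h : i ≤ j),
    (m i j h).app _ _ (map_mem_colimPre X m W h) (s j) = s i}
  mul_mem' hs ht i j h := by simp [hs i j h, ht i j h]
  one_mem' i j h := by simp

instance (W : Opens (ColimPt X m)) : CommMonoidWithZero (colimSub X m W) where
  zero := ⟨0, fun i j h => by simp⟩
  zero_mul a := Subtype.ext (zero_mul a.1)
  mul_zero a := Subtype.ext (mul_zero a.1)

/-- The sections over an open subset of `colim Xᵢ` as an ordered blueprint. -/
def colimSec (W : Opens (ColimPt X m)) : OBlp.{max w u} :=
  OBlp.induced (colimSub X m W) (fun j => (X j).sec (colimPre X m W j))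
    (fun j =>
      { toFun := fun s => s.1 j
        map_zero' := rfl
        map_one' := rfl
        map_mul' := fun _ _ => rfl })
    (fun _ _ h => Subtype.ext (funext h))

theorem colimPre_mono {W W' : Opens (ColimPt X m)} (h : W' ≤ W) (j : J) :
    colimPre X m W' j ≤ colimPre X m W j := fun _ hx => h hx

/-- The restriction maps of `colim Xᵢ`. -/
def colimRes {W W' : Opens (ColimPt X m)} (h : W' ≤ W) :
    OBlp.Hom (colimSec X m W) (colimSec X m W') where
  toFun s := ⟨fun j => (X j).res (colimPre_mono X m h j) (s.1 j), fun i j hij => by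
    rw [(m i j hij).app_res _ (colimPre_mono X m h i) (map_mem_colimPre X m W hij), s.2 i j hij]⟩
  map_zero' := Subtype.ext (funext fun j => map_zero ((X j).res (colimPre_mono X m h j)))
  map_one' := Subtype.ext (funext fun j => map_one ((X j).res (colimPre_mono X m h j)))
  map_mul' s t := Subtype.ext (funext fun j => map_mul ((X j).res (colimPre_mono X m h j)) _ _)
  map_rel {s t} hst j := by
    have := ((X j).res (colimPre_mono X m h j)).rel (hst j)
    have e : ∀ r : Multiset (colimSub X m W), ((r.map fun s => s.1 j).map
        ((X j).res (colimPre_mono X m h j))) = r.map fun s => (X j).res (colimPre_mono X m h j) (s.1 j) :=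
      fun r => Multiset.map_map _ _ _
    refine (congrArg₂ _ ?_ ?_).mp this
    · refine (e s).trans ?_
      symm
      exact Multiset.map_map _ _ _
    · refine (e t).trans ?_
      symm
      exact Multiset.map_map _ _ _

/-- The component of index `j` of a section of `colim Xᵢ`. -/
def colimProj (W : Opens (ColimPt X m)) (j : J) :
    OBlp.Hom (colimSec X m W) ((X j).sec (colimPre X m W j)) where
  toFun s := s.1 j
  map_zero' := rfl
  map_one' := rfl
  map_mul' _ _ := rfl
  map_rel h := h j

/-- The colimit of the ordered blueprinted spaces `Xᵢ` along the morphisms `Xᵢ → Xⱼ` for `i ≤ j`: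
the colimit of the topological spaces together with the limit of the sheaves. -/
def colim : OBSpace.{max w u} where
  carrier := ColimPt X m
  sec := colimSec X m
  res h := colimRes X m h
  res_self s := Subtype.ext (funext fun j => (X j).res_self _)
  res_res h h' s := Subtype.ext (funext fun j => (X j).res_res _ _ _)
  glue {I} W U hU hcov s hs := by
    have hcov' : ∀ j, ∀ x ∈ colimPre X m W j, ∃ a, x ∈ colimPre X m (U a) j :=
      fun j x hx => hcov _ hx
    have key : ∀ j, ∃ t : (X j).sec (colimPre X m W j),
        ∀ a, (X j).res (colimPre_mono X m (hU a) j) t = (s a).1 j := by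
      intro j
      refine (X j).exists_glue _ (fun a => colimPre X m (U a) j) _ (hcov' j) _ ?_
      intro a b V ha hb
      have h1 := congrArg (fun r => r.1 j) (hs a b (U a ⊓ U b) inf_le_left inf_le_right)
      have h2 : V ≤ colimPre X m (U a ⊓ U b) j := fun x hx => ⟨ha hx, hb hx⟩
      have h3 := congrArg ((X j).res h2) h1
      exact (((X j).res_res _ _ _).symm.trans h3).trans ((X j).res_res _ _ _)
    choose t ht using key
    have htc : ∀ (i j : J) (h : i ≤ j),
        (m i j h).app _ _ (map_mem_colimPre X m W h) (t j) = t i := by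
      intro i j h
      refine (X i).sec_ext _ (fun a => colimPre X m (U a) i)
        (fun a => colimPre_mono X m (hU a) i) (hcov' i) _ _ fun a => ?_
      rw [ht, ← (s a).2 i j h, ← ht j a]
      exact ((m i j h).app_res _ _ _ _ _).symm
    refine ⟨⟨t, htc⟩, fun a => Subtype.ext (funext fun j => ht j a), ?_⟩
    intro r hr
    refine Subtype.ext (funext fun j => ?_)
    refine (X j).sec_ext _ (fun a => colimPre X m (U a) j)
        (fun a => colimPre_mono X m (hU a) j) (hcov' j) _ _ fun a => ?_
    exact (congrArg (fun r => r.1 j) (hr a)).trans (ht j a).symm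
  rel_local W U hU hcov s t h j := by
    refine (X j).rel_of_local _ (fun a => colimPre X m (U a) j)
        (fun a => colimPre_mono X m (hU a) j) (fun x hx => hcov _ hx) _ _ fun a => ?_
    have := h a j
    have e : ∀ r : Multiset (colimSub X m W), ((r.map (colimProj X m W j)).map
        ((X j).res (colimPre_mono X m (hU a) j))) =
        (r.map (colimRes X m (hU a))).map (colimProj X m (U a) j) := by
      intro r
      refine (Multiset.map_map _ _ _).trans ?_
      symm
      exact Multiset.map_map _ _ _
    refine (congrArg₂ _ ?_ ?_).mpr this
    · exact e s
    · exact e t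

theorem colim_isUnit (W : Opens (ColimPt X m)) (s : colimSub X m W) (h : ∀ j, IsUnit (s.1 j)) :
    IsUnit s := by
  choose r hr using fun j => (h j).exists_right_inv
  have hrc : ∀ (i j : J) (h : i ≤ j),
      (m i j h).app _ _ (map_mem_colimPre X m W h) (r j) = r i := by
    intro i j h
    have h1 : (m i j h).app _ _ (map_mem_colimPre X m W h) (r j) * s.1 i = 1 := by
      rw [← s.2 i j h, ← map_mul, mul_comm, hr, map_one]
    exact left_inv_eq_right_inv h1 (hr i)
  exact IsUnit.of_mul_eq_one ⟨r, hrc⟩ (Subtype.ext (funext hr))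

/-- The section `s` is invertible in a neighbourhood of the point `x`. -/
def UnitAt (X : OBSpace.{u}) {W : Opens X} (s : X.sec W) (x : X) : Prop :=
  ∃ (V : Opens X) (hV : V ≤ W), x ∈ V ∧ IsUnit (X.res hV s)

theorem unitAt_map {W : Opens (ColimPt X m)} (s : colimSub X m W) {i j : J} (h : i ≤ j) (x : X i) :
    UnitAt (X i) (s.1 i) x ↔ UnitAt (X j) (s.1 j) ((m i j h).toFun x) := by
  constructor
  · rintro ⟨V, hV, hx, hu⟩
    rw [← s.2 i j h] at hu
    have hm : ∀ x ∈ V, (m i j h).toFun x ∈ colimPre X m W j := fun x hx =>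
      map_mem_colimPre X m W h x (hV hx)
    have e := (m i j h).app_restrict _ hV (map_mem_colimPre X m W h) hm (s.1 j)
    exact (m i j h).isLocal _ V hm (s.1 j) (e ▸ hu) x hx
  · rintro ⟨V, hV, hx, hu⟩
    have hle : (m i j h).preimage V ⊓ colimPre X m W i ≤ colimPre X m W i := inf_le_right
    refine ⟨(m i j h).preimage V ⊓ colimPre X m W i, hle, ⟨hx, ?_⟩, ?_⟩
    · have := hV hx
      change colimPt X m j ((m i j h).toFun x) ∈ W at this
      rw [colimPt_map] at this
      exact this
    · have hm : ∀ x ∈ (m i j h).preimage V ⊓ colimPre X m W i, (m i j h).toFun x ∈ V :=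
        fun x hx => hx.1
      have e := (m i j h).app_res hV hle (map_mem_colimPre X m W h) hm (s.1 j)
      rw [s.2 i j h] at e
      exact e ▸ hu.map ((m i j h).app V _ hm)

/-- The canonical morphism `Xⱼ → colim Xᵢ`. -/
def ι (j : J) : Hom (X j) (colim X m) where
  toFun := colimPt X m j
  continuous_toFun := continuous_colimPt X m j
  app W U h :=
    { toFun := fun s => (X j).res (show U ≤ colimPre X m W j from h) (s.1 j)
      map_zero' := map_zero ((X j).res (show U ≤ colimPre X m W j from h))
      map_one' := map_one ((X j).res (show U ≤ colimPre X m W j from h))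
      map_mul' := fun s t => map_mul ((X j).res (show U ≤ colimPre X m W j from h)) _ _
      map_rel := fun {s t} hst => by
        have hU : U ≤ colimPre X m W j := h
        have := ((X j).res hU).rel (hst j)
        have e : ∀ r : Multiset (colimSub X m W), (r.map (colimProj X m W j)).map ((X j).res hU) =
            r.map fun s => (X j).res hU (s.1 j) := fun r => Multiset.map_map _ _ _
        refine (congrArg₂ _ ?_ ?_).mp this
        · exact e s
        · exact e t }
  app_res {V V' U U'} hV hU h h' s :=
    (((X j).res_res (colimPre_mono X m hV j) (show U' ≤ colimPre X m V' j from h') (s.1 j))).trans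
      ((X j).res_res (show U ≤ colimPre X m V j from h) hU (s.1 j)).symm
  isLocal W U h s hs x hx := by
    have hsx : UnitAt (X j) (s.1 j) x := ⟨U, h, hx, hs⟩
    let D : ColimPt X m → Prop := Quot.lift (fun p => UnitAt (X p.1) (s.1 p.1) p.2) (by
      rintro ⟨i, x⟩ ⟨j, y⟩ ⟨hij, hy⟩
      exact (propext (unitAt_map X m s hij x)).trans (congrArg (UnitAt (X j) (s.1 j)) hy))
    have hDo : IsOpen {p | D p} := by
      refine isOpen_coinduced.2 (isOpen_sigma_iff.2 fun i => isOpen_iff_forall_mem_open.2 ?_)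
      rintro y ⟨V, hV, hy, hu⟩
      exact ⟨V, fun z hz => ⟨V, hV, hz, hu⟩, V.isOpen, hy⟩
    let V' : Opens (ColimPt X m) := ⟨{p | D p}, hDo⟩
    have hV' : V' ≤ W := by
      rintro p hp
      obtain ⟨⟨i, y⟩, rfl⟩ := Quot.exists_rep p
      obtain ⟨V, hV, hy, hu⟩ := hp
      exact hV hy
    refine ⟨V', hV', hsx, ?_⟩
    refine colim_isUnit X m V' (colimRes X m hV' s) fun i => ?_
    refine (X i).isUnit_of_local _ _ fun y hy => ?_
    obtain ⟨V, hV, hy', hu⟩ : UnitAt (X i) (s.1 i) y := hy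
    have hle : V ≤ colimPre X m V' i := fun z hz => ⟨V, hV, hz, hu⟩
    refine ⟨V, hle, hy', ?_⟩
    have e : (X i).res hle ((X i).res (colimPre_mono X m hV' i) (s.1 i)) = (X i).res hV (s.1 i) :=
      (X i).res_res _ _ _
    exact e ▸ hu

variable {X m}

/-- The universal property of the colimit: the morphism `colim Xᵢ → Y` induced by a compatible family
of morphisms `Xᵢ → Y`. -/
def desc (g : ∀ j, Hom (X j) Y) (hg : ∀ i j (h : i ≤ j), (g j).comp (m i j h) = g i) :
    Hom (colim X m) Y where
  toFun := Quot.lift (fun p => (g p.1).toFun p.2) (by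
    rintro ⟨i, x⟩ ⟨j, y⟩ ⟨h, hy⟩
    exact (congrArg (fun f => f.toFun x) (hg i j h)).symm.trans (congrArg (g j).toFun hy))
  continuous_toFun := by
    refine continuous_coinduced_dom.2 (continuous_sigma_iff.2 fun j => ?_)
    exact (g j).continuous_toFun
  app V U h :=
    { toFun := fun s => ⟨fun j => (g j).app V (colimPre X m U j) (fun x hx => h _ hx) s, by
        intro i j hij
        have h1 : ∀ x ∈ colimPre X m U i, ((g j).comp (m i j hij)).toFun x ∈ V := by
          intro x hx
          rw [hg]
          exact h _ hx
        have e1 := Hom.comp_app (g j) (m i j hij) V (colimPre X m U i) (colimPre X m U j) h1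
          (map_mem_colimPre X m U hij) (fun x hx => h _ hx) s
        refine e1.symm.trans ?_
        have e2 : ∀ (f : Hom (X i) Y) (hf : f = g i) (h2 : ∀ x ∈ colimPre X m U i, f.toFun x ∈ V)
            (h3 : ∀ x ∈ colimPre X m U i, (g i).toFun x ∈ V),
            f.app V (colimPre X m U i) h2 s = (g i).app V (colimPre X m U i) h3 s := by
          rintro _ rfl _ _
          rfl
        exact e2 _ (hg i j hij) _ _⟩
      map_zero' := Subtype.ext (funext fun j => map_zero ((g j).app V (colimPre X m U j) _))
      map_one' := Subtype.ext (funext fun j => map_one ((g j).app V (colimPre X m U j) _))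
      map_mul' := fun s t => Subtype.ext (funext fun j =>
        map_mul ((g j).app V (colimPre X m U j) _) _ _)
      map_rel := fun {s t} hst j => by
        have := ((g j).app V (colimPre X m U j) (fun x hx => h _ hx)).rel hst
        refine (congrArg₂ _ ?_ ?_).mpr this
        · exact Multiset.map_map _ _ _
        · exact Multiset.map_map _ _ _ }
  app_res {V V' U U'} hV hU h h' s := Subtype.ext (funext fun j =>
    (g j).app_res hV (colimPre_mono X m hU j) _ _ s)
  isLocal V U h s hs p hp := by
    obtain ⟨⟨j, x⟩, rfl⟩ := Quot.exists_rep p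
    have hs' := hs.map (colimProj X m U j)
    exact (g j).isLocal V (colimPre X m U j) (fun x hx => h _ hx) s hs' x hp

theorem colim_hom_ext {f g : Hom (colim X m) Y} (h : ∀ j, f.comp (ι X m j) = g.comp (ι X m j)) :
    f = g := by
  refine Hom.ext (fun p => ?_) fun V U hf hg s => Subtype.ext (funext fun j => ?_)
  · obtain ⟨⟨j, x⟩, rfl⟩ := Quot.exists_rep p
    exact congrArg (fun f => f.toFun x) (h j)
  · have hm : ∀ x ∈ colimPre X m U j, (ι X m j).toFun x ∈ U := fun x hx => hx
    have e1 := Hom.comp_app f (ι X m j) V (colimPre X m U j) U (fun x hx => hf _ hx) hm hf s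
    have e2 := Hom.comp_app g (ι X m j) V (colimPre X m U j) U (fun x hx => hg _ hx) hm hg s
    have e3 : ∀ (k k' : Hom (X j) Y) (hk : k = k') (h2 : ∀ x ∈ colimPre X m U j, k.toFun x ∈ V)
        (h3 : ∀ x ∈ colimPre X m U j, k'.toFun x ∈ V),
        k.app V (colimPre X m U j) h2 s = k'.app V (colimPre X m U j) h3 s := by
      rintro _ _ rfl _ _
      rfl
    have e4 : ∀ r : colimSub X m U, (ι X m j).app U (colimPre X m U j) hm r = r.1 j :=
      fun r => (X j).res_self _
    exact (e4 _).symm.trans (e1.symm.trans ((e3 _ _ (h j) _ _).trans (e2.trans (e4 _))))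

end Colimit

end OBSpace

/-! ## Spectra -/

namespace OBlp

/-- A prime `k`-ideal of an ordered blueprint. -/
@[ext] structure PrimeK (B : OBlp.{u}) where
  /-- the underlying set -/
  carrier : Set B.carrier
  zero_mem : (0 : B.carrier) ∈ carrier
  mul_mem : ∀ {a} (b : B.carrier), a ∈ carrier → b * a ∈ carrier
  mem_of_rel : ∀ {c : B.carrier} {s t : Multiset B.carrier}, (∀ a ∈ s, a ∈ carrier) →
    (∀ b ∈ t, b ∈ carrier) → B.rel (c ::ₘ s) t → B.rel t (c ::ₘ s) → c ∈ carrier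
  one_notMem : (1 : B.carrier) ∉ carrier
  mem_or_mem : ∀ {a b : B.carrier}, a * b ∈ carrier → a ∈ carrier ∨ b ∈ carrier

variable {B : OBlp.{u₁}} {C : OBlp.{u₂}} {D : OBlp.{u₃}}

namespace PrimeK

/-- The multiplicative subset of elements that are not in the prime `k`-ideal. -/
def compl (p : PrimeK B) : Submonoid B.carrier where
  carrier := {a | a ∉ p.carrier}
  mul_mem' ha hb h := (p.mem_or_mem h).elim ha hb
  one_mem' := p.one_notMem

/-- The preimage of a prime `k`-ideal. -/
def comap (f : Hom B C) (p : PrimeK C) : PrimeK B where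
  carrier := {a | f a ∈ p.carrier}
  zero_mem := by
    change f 0 ∈ p.carrier
    rw [map_zero]
    exact p.zero_mem
  mul_mem {a} b h := by
    change f (b * a) ∈ p.carrier
    rw [map_mul]
    exact p.mul_mem _ h
  mem_of_rel {c s t} hs ht h h' := by
    refine p.mem_of_rel (c := f c) (s := s.map f) (t := t.map f) ?_ ?_ ?_ ?_
    · intro a ha
      obtain ⟨b, hb, rfl⟩ := Multiset.mem_map.1 ha
      exact hs b hb
    · intro a ha
      obtain ⟨b, hb, rfl⟩ := Multiset.mem_map.1 ha
      exact ht b hb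
    · have := f.rel h
      rwa [Multiset.map_cons] at this
    · have := f.rel h'
      rwa [Multiset.map_cons] at this
  one_notMem h := by
    change f 1 ∈ p.carrier at h
    rw [map_one] at h
    exact p.one_notMem h
  mem_or_mem {a b} h := by
    change f (a * b) ∈ p.carrier at h
    rw [map_mul] at h
    exact p.mem_or_mem h

/-- The topology on the set of prime `k`-ideals is generated by the sets of all primes that do not
contain a given element. -/
instance : TopologicalSpace (PrimeK B) :=
  TopologicalSpace.generateFrom {U | ∃ h : B.carrier, U = {p | h ∉ p.carrier}}

theorem isOpen_basic (h : B.carrier) : IsOpen {p : PrimeK B | h ∉ p.carrier} :=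
  TopologicalSpace.isOpen_generateFrom_of_mem ⟨h, rfl⟩

/-- The principal open subset of all primes that do not contain `h`. -/
def basic (h : B.carrier) : Opens (PrimeK B) := ⟨{p | h ∉ p.carrier}, isOpen_basic h⟩

theorem exists_basic_le (U : Opens (PrimeK B)) (p : PrimeK B) (hp : p ∈ U) :
    ∃ g, g ∉ p.carrier ∧ ∀ q : PrimeK B, g ∉ q.carrier → q ∈ U := by
  have key : ∀ V : Set (PrimeK B), TopologicalSpace.GenerateOpen
      {U | ∃ h : B.carrier, U = {p | h ∉ p.carrier}} V → p ∈ V →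
      ∃ g, g ∉ p.carrier ∧ ∀ q : PrimeK B, g ∉ q.carrier → q ∈ V := by
    intro V hV
    induction hV with
    | basic V hV =>
      obtain ⟨h, rfl⟩ := hV
      exact fun hp => ⟨h, hp, fun q hq => hq⟩
    | univ => exact fun _ => ⟨1, p.one_notMem, fun _ _ => trivial⟩
    | inter V V' _ _ ih ih' =>
      intro hp
      obtain ⟨g, hg, h⟩ := ih hp.1
      obtain ⟨g', hg', h'⟩ := ih' hp.2
      refine ⟨g * g', p.compl.mul_mem hg hg', fun q hq => ⟨h q ?_, h' q ?_⟩⟩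
      · exact fun hh => hq (mul_comm g' g ▸ q.mul_mem g' hh)
      · exact fun hh => hq (q.mul_mem g hh)
    | sUnion S _ ih =>
      rintro ⟨V, hV, hp⟩
      obtain ⟨g, hg, h⟩ := ih V hV hp
      exact ⟨g, hg, fun q hq => ⟨V, hV, h q hq⟩⟩
  exact key U U.isOpen hp

theorem continuous_comap (f : Hom B C) : Continuous (comap f) := by
  refine continuous_generateFrom_iff.2 ?_
  rintro _ ⟨h, rfl⟩
  exact isOpen_basic (f h)

theorem notMem_of_isUnit (p : PrimeK B) {a : B.carrier} {x : p.compl}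
    (h : IsUnit (B.frac p.compl a x)) : a ∉ p.carrier := by
  obtain ⟨c, hc⟩ := h.exists_right_inv
  obtain ⟨b, y, rfl⟩ := frac_surj c
  rw [frac_mul, ← frac_one, frac_eq] at hc
  obtain ⟨r, hr⟩ := hc
  intro ha
  have h1 : (r : B.carrier) * (((1 : p.compl) : B.carrier) * (a * b)) ∈ p.carrier :=
    p.mul_mem _ (p.mul_mem _ (mul_comm a b ▸ p.mul_mem _ ha))
  rw [hr] at h1
  exact (p.compl.mul_mem r.2 (p.compl.mul_mem (x * y).2 p.compl.one_mem)) h1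

end PrimeK

/-! ### The structure sheaf -/

/-- Sections over an open subset `U` of `Spec B`: functions that assign to each prime `p ∈ U` an
element of `B_p` and that are locally given by a fraction `a / h` on a principal open `U_h`. -/
def specSub (B : OBlp.{u}) (U : Opens (PrimeK B)) :
    Submonoid (∀ p : U, (B.loc p.1.compl).carrier) where
  carrier := {s | ∀ p : U, ∃ a h : B.carrier, h ∉ p.1.carrier ∧
    ∀ (q : U) (hq : h ∉ q.1.carrier), s q = B.frac q.1.compl a ⟨h, hq⟩}
  mul_mem' {s t} hs ht p := by
    obtain ⟨a, h, hp, e⟩ := hs p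
    obtain ⟨b, g, hp', e'⟩ := ht p
    refine ⟨a * b, h * g, p.1.compl.mul_mem hp hp', fun q hq => ?_⟩
    have h1 : h ∉ q.1.carrier := fun hh => hq (mul_comm g h ▸ q.1.mul_mem g hh)
    have h2 : g ∉ q.1.carrier := fun hh => hq (q.1.mul_mem h hh)
    rw [Pi.mul_apply, e q h1, e' q h2, frac_mul]
    rfl
  one_mem' p := ⟨1, 1, p.1.one_notMem, fun _ _ => frac_one.symm⟩

instance (B : OBlp.{u}) (U : Opens (PrimeK B)) : CommMonoidWithZero (specSub B U) where
  zero := ⟨0, fun p => ⟨0, 1, p.1.one_notMem, fun _ _ => frac_zero.symm⟩⟩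
  zero_mul a := Subtype.ext (zero_mul a.1)
  mul_zero a := Subtype.ext (mul_zero a.1)

/-- The value of a section at a prime. -/
def specEv (B : OBlp.{u}) (U : Opens (PrimeK B)) (p : U) :
    specSub B U →*₀ (B.loc p.1.compl).carrier where
  toFun s := s.1 p
  map_zero' := rfl
  map_one' := rfl
  map_mul' _ _ := rfl

/-- The ordered blueprint of sections over `U`. Relations are verified in all `B_p`. -/
def specSec (B : OBlp.{u}) (U : Opens (PrimeK B)) : OBlp.{u} :=
  OBlp.induced (specSub B U) (fun p : U => B.loc p.1.compl) (specEv B U)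
    (fun _ _ h => Subtype.ext (funext h))

/-- The restriction maps. -/
def specRes (B : OBlp.{u}) {U V : Opens (PrimeK B)} (hV : V ≤ U) :
    Hom (specSec B U) (specSec B V) where
  toFun s := ⟨fun p => s.1 ⟨p.1, hV p.2⟩, fun p => by
    obtain ⟨a, h, hp, e⟩ := s.2 ⟨p.1, hV p.2⟩
    exact ⟨a, h, hp, fun q hq => e ⟨q.1, hV q.2⟩ hq⟩⟩
  map_zero' := rfl
  map_one' := rfl
  map_mul' _ _ := rfl
  map_rel {s t} h p := by
    have := h ⟨p.1, hV p.2⟩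
    refine (congrArg₂ _ ?_ ?_).mpr this
    · exact Multiset.map_map _ _ _
    · exact Multiset.map_map _ _ _

/-- The spectrum of an ordered blueprint. -/
def Spec (B : OBlp.{u}) : OBSpace.{u} where
  carrier := PrimeK B
  sec := specSec B
  res h := specRes B h
  res_self _ := rfl
  res_res _ _ _ := rfl
  glue {I} W U hU hcov s hs := by
    choose c hc using hcov
    have key : ∀ (i : I) (p : PrimeK B) (hp : p ∈ W) (hi : p ∈ U i),
        (s (c p hp)).1 ⟨p, hc p hp⟩ = (s i).1 ⟨p, hi⟩ := by
      intro i p hp hi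
      have := hs (c p hp) i (U (c p hp) ⊓ U i) inf_le_left inf_le_right
      exact congrArg (fun r => r.1 ⟨p, hc p hp, hi⟩) this
    refine ⟨⟨fun p => (s (c p.1 p.2)).1 ⟨p.1, hc p.1 p.2⟩, fun p => ?_⟩, fun i => ?_, ?_⟩
    · obtain ⟨a, h, hp, e⟩ := (s (c p.1 p.2)).2 ⟨p.1, hc p.1 p.2⟩
      obtain ⟨g, hg, hgU⟩ := PrimeK.exists_basic_le (U (c p.1 p.2)) p.1 (hc p.1 p.2)
      refine ⟨g * a, g * h, p.1.compl.mul_mem hg hp, fun q hq => ?_⟩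
      have h1 : g ∉ q.1.carrier := fun hh => hq (mul_comm h g ▸ q.1.mul_mem h hh)
      have h2 : h ∉ q.1.carrier := fun hh => hq (q.1.mul_mem g hh)
      refine (key _ q.1 q.2 (hgU q.1 h1)).trans ((e ⟨q.1, hgU q.1 h1⟩ h2).trans ?_)
      refine frac_eq.2 ⟨1, ?_⟩
      simp only [mul_comm, mul_left_comm]
    · exact Subtype.ext (funext fun p => key i p.1 (hU i p.2) p.2)
    · intro r hr
      refine Subtype.ext (funext fun p => ?_)
      exact congrArg (fun r => r.1 ⟨p.1, hc p.1 p.2⟩) (hr (c p.1 p.2))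
  rel_local W U hU hcov s t h p := by
    obtain ⟨i, hi⟩ := hcov p.1 p.2
    have := h i ⟨p.1, hi⟩
    refine (congrArg₂ _ ?_ ?_).mp this
    · exact Multiset.map_map _ _ _
    · exact Multiset.map_map _ _ _

/-- The morphism of spectra induced by a morphism of ordered blueprints. -/
def specMap (f : Hom B C) : OBSpace.Hom (Spec C) (Spec B) where
  toFun := PrimeK.comap f
  continuous_toFun := PrimeK.continuous_comap f
  app V U hUV :=
    { toFun := fun s => ⟨fun q => locMap f _ _ (fun _ ha => ha) (s.1 ⟨PrimeK.comap f q.1, hUV _ q.2⟩),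
        fun p => by
          obtain ⟨a, h, hp, e⟩ := s.2 ⟨PrimeK.comap f p.1, hUV _ p.2⟩
          refine ⟨f a, f h, hp, fun q hq => ?_⟩
          exact congrArg (locMap f _ _ (fun _ ha => ha)) (e ⟨PrimeK.comap f q.1, hUV _ q.2⟩ hq)⟩
      map_zero' := Subtype.ext (funext fun q =>
        map_zero (locMap f (PrimeK.comap f q.1).compl q.1.compl (fun _ ha => ha)))
      map_one' := Subtype.ext (funext fun q =>
        map_one (locMap f (PrimeK.comap f q.1).compl q.1.compl (fun _ ha => ha)))
      map_mul' := fun s t => Subtype.ext (funext fun q =>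
        map_mul (locMap f (PrimeK.comap f q.1).compl q.1.compl (fun _ ha => ha)) _ _)
      map_rel := fun {s t} h q => by
        have := (locMap f (PrimeK.comap f q.1).compl q.1.compl (fun _ ha => ha)).rel
          (h ⟨PrimeK.comap f q.1, hUV _ q.2⟩)
        refine (congrArg₂ _ ?_ ?_).mpr this
        · refine (Multiset.map_map _ _ _).trans ?_
          symm
          exact Multiset.map_map _ _ _
        · refine (Multiset.map_map _ _ _).trans ?_
          symm
          exact Multiset.map_map _ _ _ }
  app_res _ _ _ _ _ := rfl
  isLocal V U hUV s hs p hp := by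
    obtain ⟨a, h, hh, e⟩ := s.2 ⟨PrimeK.comap f p, hUV _ hp⟩
    have hu : IsUnit (locMap f (PrimeK.comap f p).compl p.compl (fun _ ha => ha)
        (s.1 ⟨PrimeK.comap f p, hUV _ hp⟩)) := hs.map (specEv C U ⟨p, hp⟩)
    rw [e ⟨PrimeK.comap f p, hUV _ hp⟩ hh] at hu
    have ha : a ∉ (PrimeK.comap f p).carrier := p.notMem_of_isUnit hu
    refine ⟨V ⊓ (PrimeK.basic a ⊓ PrimeK.basic h), inf_le_left, ⟨hUV _ hp, ha, hh⟩, ?_⟩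
    refine IsUnit.of_mul_eq_one (⟨fun q => B.frac q.1.compl h ⟨a, q.2.2.1⟩, fun q =>
      ⟨h, a, q.2.2.1, fun _ _ => rfl⟩⟩ :
      specSub B (V ⊓ (PrimeK.basic a ⊓ PrimeK.basic h))) (Subtype.ext (funext fun q => ?_))
    refine (congrArg (· * B.frac q.1.compl h ⟨a, q.2.2.1⟩) (e ⟨q.1, q.2.1⟩ q.2.2.2)).trans ?_
    refine (frac_mul _ _ _ _).trans ?_
    refine Eq.trans ?_ frac_one
    refine frac_eq.2 ⟨1, ?_⟩
    simp [mul_comm]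

theorem locMap_id (p : PrimeK B) (x : (B.loc p.compl).carrier)
    (h : ∀ a ∈ p.compl, Hom.id B a ∈ p.compl) :
    locMap (Hom.id B) p.compl p.compl h x = x := by
  obtain ⟨a, x, rfl⟩ := frac_surj x
  rfl

theorem specMap_comp (g : Hom C D) (f : Hom B C) :
    specMap (g.comp f) = (specMap f).comp (specMap g) := by
  refine OBSpace.Hom.ext (fun _ => rfl) fun V U hf hg s => Subtype.ext (funext fun q => ?_)
  obtain ⟨a, x, e⟩ := frac_surj (s.1 ⟨PrimeK.comap (g.comp f) q.1, hf _ q.2⟩)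
  change locMap (g.comp f) _ _ _ (s.1 ⟨PrimeK.comap (g.comp f) q.1, hf _ q.2⟩) =
    locMap g _ _ _ (locMap f _ _ _ (s.1 ⟨PrimeK.comap (g.comp f) q.1, hf _ q.2⟩))
  rw [e]
  rfl

theorem specMap_id : specMap (Hom.id B) = OBSpace.Hom.id (Spec B) :=
  OBSpace.Hom.ext (fun _ => rfl) fun _ _ _ _ _ => Subtype.ext (funext fun q =>
    locMap_id q.1 _ (fun _ ha => ha))

/-- The canonical morphism from `B` to the global sections of its spectrum. -/
def toΓ (B : OBlp.{u}) : Hom B ((Spec B).sec ⊤) where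
  toFun a := ⟨fun p => B.frac p.1.compl a 1, fun p => ⟨a, 1, p.1.one_notMem, fun _ _ => rfl⟩⟩
  map_zero' := Subtype.ext (funext fun _ => frac_zero)
  map_one' := Subtype.ext (funext fun _ => frac_one)
  map_mul' a b := Subtype.ext (funext fun p => by
    refine Eq.trans ?_ (frac_mul _ _ _ _).symm
    rw [one_mul])
  map_rel {s t} h p := ⟨1, s, t, h, Multiset.map_map _ _ _, Multiset.map_map _ _ _⟩

end OBlp

/-! ## Rational points -/

namespace OBSpace

/-- The set `X(T)` of `T`-rational points: the `T`-linear morphisms `Spec T → X`, where the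
structure of `X` over `T` is given by the morphism `s : X → Spec T`. -/
def RatPts {T : OBlp.{v}} {X : OBSpace.{u}} (s : Hom X (OBlp.Spec T)) : Type max u v :=
  {φ : Hom (OBlp.Spec T) X // s.comp φ = Hom.id (OBlp.Spec T)}

/-- A morphism over `T` induces a map between the sets of `T`-rational points. -/
def RatPts.map {T : OBlp.{v}} {X : OBSpace.{u₁}} {Y : OBSpace.{u₂}} {s : Hom X (OBlp.Spec T)}
    {r : Hom Y (OBlp.Spec T)} (α : Hom X Y) (hα : r.comp α = s) (φ : RatPts s) : RatPts r :=
  ⟨α.comp φ.1, by rw [← Hom.comp_assoc, hα, φ.2]⟩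

/-- The affine topology on `U(T)` for an affine `U = Spec C` over `T`: it is generated by the
sets of all `φ : Spec T → U` for which `φ^#(a) ∈ V` for given `a ∈ ΓU` and open `V ⊆ T`, where
`T` is identified with the global sections of `Spec T`. -/
@[reducible] def affineTopology {T : OBlp.{v}} [TopologicalSpace T.carrier] {C : OBlp.{u}}
    (s : Hom (OBlp.Spec C) (OBlp.Spec T)) : TopologicalSpace (RatPts s) :=
  TopologicalSpace.generateFrom {W | ∃ (a : (OBlp.Spec C).sec ⊤) (V : Set T.carrier), IsOpen V ∧
    W = {φ | ∃ t ∈ V, φ.1.app ⊤ ⊤ (fun _ _ => trivial) a = OBlp.toΓ T t}}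

/-- The fine topology on `X(T)`: the finest topology such that for all morphisms `α : U → X` over
`T` from affine `U`, the map `U(T) → X(T)` is continuous for the affine topology on `U(T)`. -/
instance {T : OBlp.{v}} [TopologicalSpace T.carrier] {X : OBSpace.{u}}
    (s : Hom X (OBlp.Spec T)) : TopologicalSpace (RatPts s) :=
  ⨆ (C : OBlp.{max u v}) (α : Hom (OBlp.Spec C) X),
    (affineTopology (s.comp α)).coinduced (RatPts.map α rfl)

end OBSpace

/-! ## Schemes over a base as colimits of spectra -/

/-- A diagram of ordered blue `K`-algebras `B_j` with maps `B_j → B_i` for `i ≤ j`, that is, a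
diagram of the affine `K`-schemes `Spec B_j`. -/
structure AlgDiag (K : OBlp.{v}) (J : Type w) [Preorder J] where
  /-- the algebras -/
  obj : J → OBlp.{u}
  /-- the structure maps -/
  str : ∀ j, OBlp.Hom K (obj j)
  /-- the transition maps -/
  map : ∀ i j : J, i ≤ j → OBlp.Hom (obj j) (obj i)
  map_id : ∀ j a, map j j le_rfl a = a
  map_map : ∀ i j l (h : i ≤ j) (h' : j ≤ l) a,
    map i j h (map j l h' a) = map i l (h.trans h') a
  map_str : ∀ i j (h : i ≤ j) a, map i j h (str j a) = str i a

namespace AlgDiag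

variable {K : OBlp.{v}} {J : Type w} [Preorder J]

/-- The colimit of the spectra of the algebras in the diagram. -/
def space (D : AlgDiag.{u} K J) : OBSpace.{max w u} :=
  OBSpace.colim (fun j => OBlp.Spec (D.obj j)) (fun i j h => OBlp.specMap (D.map i j h))

/-- The morphism from the `j`-th spectrum to the colimit. -/
def incl (D : AlgDiag.{u} K J) (j : J) : OBSpace.Hom (OBlp.Spec (D.obj j)) D.space :=
  OBSpace.ι (fun j => OBlp.Spec (D.obj j)) (fun i j h => OBlp.specMap (D.map i j h)) j

theorem incl_comp (D : AlgDiag.{u} K J) (i j : J) (h : i ≤ j) :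
    (D.incl j).comp (OBlp.specMap (D.map i j h)) = D.incl i := by
  refine OBSpace.Hom.ext (fun x => ?_) fun V U h₁ h₂ s => ?_
  · exact OBSpace.colimPt_map (fun j => OBlp.Spec (D.obj j))
      (fun i j h => OBlp.specMap (D.map i j h)) h x
  · refine Subtype.ext (funext fun q => ?_)
    exact congrArg (fun r => r.1 ⟨q.1, h₂ _ q.2⟩) (s.2 i j h)

/-- The structure morphism of the colimit over `Spec K`. -/
def toSpec (D : AlgDiag.{u} K J) : OBSpace.Hom D.space (OBlp.Spec K) :=
  OBSpace.desc (fun j => OBlp.specMap (D.str j)) fun i j h => by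
    rw [← OBlp.specMap_comp]
    exact congrArg _ (OBlp.Hom.ext fun a => D.map_str i j h a)

theorem toSpec_incl (D : AlgDiag.{u} K J) (j : J) :
    D.toSpec.comp (D.incl j) = OBlp.specMap (D.str j) := by
  refine OBSpace.Hom.ext (fun x => rfl) fun V U h₁ h₂ s => rfl

/-- A morphism of diagrams of `K`-algebras. -/
structure Hom (D : AlgDiag.{u₁} K J) (E : AlgDiag.{u₂} K J) where
  /-- the maps between the algebras -/
  app : ∀ j, OBlp.Hom (D.obj j) (E.obj j)
  app_map : ∀ i j (h : i ≤ j) a, E.map i j h (app j a) = app i (D.map i j h a)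
  app_str : ∀ j a, app j (D.str j a) = E.str j a

/-- The morphism of schemes that is induced by a morphism of diagrams of algebras. -/
def Hom.spaceMap {D : AlgDiag.{u₁} K J} {E : AlgDiag.{u₂} K J} (β : Hom D E) :
    OBSpace.Hom E.space D.space :=
  OBSpace.desc (fun j => (D.incl j).comp (OBlp.specMap (β.app j))) fun i j h => by
    rw [OBSpace.Hom.comp_assoc, ← OBlp.specMap_comp, ← D.incl_comp i j h, OBSpace.Hom.comp_assoc,
      ← OBlp.specMap_comp]
    exact congrArg _ (congrArg _ (OBlp.Hom.ext fun a => β.app_map i j h a))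

theorem Hom.spaceMap_incl {D : AlgDiag.{u₁} K J} {E : AlgDiag.{u₂} K J} (β : Hom D E) (j : J) :
    β.spaceMap.comp (E.incl j) = (D.incl j).comp (OBlp.specMap (β.app j)) :=
  OBSpace.Hom.ext (fun _ => rfl) fun _ _ _ _ _ => rfl

theorem Hom.toSpec_spaceMap {D : AlgDiag.{u₁} K J} {E : AlgDiag.{u₂} K J} (β : Hom D E) :
    D.toSpec.comp β.spaceMap = E.toSpec := by
  have key : ∀ j, (D.toSpec.comp β.spaceMap).comp (E.incl j) = E.toSpec.comp (E.incl j) := by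
    intro j
    rw [OBSpace.Hom.comp_assoc, β.spaceMap_incl, ← OBSpace.Hom.comp_assoc, D.toSpec_incl,
      E.toSpec_incl, ← OBlp.specMap_comp]
    exact congrArg _ (OBlp.Hom.ext fun a => β.app_str j a)
  exact OBSpace.colim_hom_ext key

end AlgDiag

/-! ## The bend -/

namespace OBlp

variable {K : OBlp.{u₁}} {T : OBlp.{v}}

/-- The relations that define the bend of a `K`-algebra `B` along `v : K → T`: those of the tensor
product of the monoids `B` and `T` over `K`, those of `T`, and the bend relations
`a ⊗ 1 + ∑ bⱼ ⊗ 1 = ∑ bⱼ ⊗ 1` for all relations `a ≤ ∑ bⱼ` in `B`. -/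
inductive BendGen (v : K.carrier →*₀ T.carrier) (B : OBlp.{u}) (e : Hom K B) :
    Multiset (B.carrier × T.carrier) → Multiset (B.carrier × T.carrier) → Prop
  | zero_left (t) : BendGen v B e {(0, t)} {0}
  | zero_left' (t) : BendGen v B e {0} {(0, t)}
  | zero_right (b) : BendGen v B e {(b, 0)} {0}
  | zero_right' (b) : BendGen v B e {0} {(b, 0)}
  | scalar (c b t) : BendGen v B e {(e c * b, t)} {(b, v c * t)}
  | scalar' (c b t) : BendGen v B e {(b, v c * t)} {(e c * b, t)}
  | base {s t} : T.rel s t → BendGen v B e (s.map fun x => (1, x)) (t.map fun x => (1, x))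
  | bend {a s} : B.rel {a} s → BendGen v B e ((a, 1) ::ₘ s.map fun b => (b, 1))
      (s.map fun b => (b, 1))
  | bend' {a s} : B.rel {a} s → BendGen v B e (s.map fun b => (b, 1))
      ((a, 1) ::ₘ s.map fun b => (b, 1))

/-- The bend of `B` along `v`. -/
def bend (v : K.carrier →*₀ T.carrier) (B : OBlp.{u}) (e : Hom K B) : OBlp.{max u v} :=
  ofGen (BendGen v B e)

/-- The element `b ⊗ t` of the bend. -/
def bendMk (v : K.carrier →*₀ T.carrier) (B : OBlp.{u}) (e : Hom K B) (b : B.carrier)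
    (t : T.carrier) : (bend v B e).carrier := ofGenMk (BendGen v B e) (b, t)

/-- The structure of the bend as a `T`-algebra: `t ↦ 1 ⊗ t`. -/
def bendStr (v : K.carrier →*₀ T.carrier) (B : OBlp.{u}) (e : Hom K B) : Hom T (bend v B e) where
  toFun t := bendMk v B e 1 t
  map_zero' := by
    have h := (quotMk_eq (BendGen v B e)).2 ⟨Gen.of (.zero_right 1), Gen.of (.zero_right' 1)⟩
    exact h.trans (map_zero (quotMk (BendGen v B e)))
  map_one' := rfl
  map_mul' s t := by
    refine Eq.trans ?_ (map_mul (ofGenMk (BendGen v B e)) (1, s) (1, t))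
    change _ = ofGenMk (BendGen v B e) (1 * 1, s * t)
    rw [one_mul]
    rfl
  map_rel {s t} h := by
    have := ofGen_rel _ (Gen.of (.base h : BendGen v B e _ _))
    refine (congrArg₂ _ ?_ ?_).mp this
    · exact Multiset.map_map _ _ _
    · exact Multiset.map_map _ _ _

variable {v : K.carrier →*₀ T.carrier} {B : OBlp.{u₂}} {C : OBlp.{u₃}} {e : Hom K B} {e' : Hom K C}

/-- The universal property of the bend. -/
def bendLift {D : OBlp.{u₄}} (f : B.carrier × T.carrier →*₀ D.carrier)
    (hf : ∀ s t, BendGen v B e s t → D.rel (s.map f) (t.map f)) : Hom (bend v B e) D :=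
  ofGenLift f hf

/-- Functoriality of the bend. -/
def bendMap (f : Hom B C) (hf : ∀ c, f (e c) = e' c) : Hom (bend v B e) (bend v C e') :=
  bendLift (v := v) (e := e)
    { toFun := fun p => bendMk v C e' (f p.1) p.2
      map_zero' := by
        change bendMk v C e' (f 0) 0 = _
        rw [map_zero]
        exact map_zero (ofGenMk (BendGen v C e'))
      map_one' := by
        change bendMk v C e' (f 1) 1 = _
        rw [map_one]
        exact map_one (ofGenMk (BendGen v C e'))
      map_mul' := fun p q => by
        change bendMk v C e' (f (p.1 * q.1)) (p.2 * q.2) = _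
        rw [map_mul]
        exact map_mul (ofGenMk (BendGen v C e')) (f p.1, p.2) (f q.1, q.2) }
    (by
      intro s t h
      have key : ∀ s t : Multiset (B.carrier × T.carrier),
          Gen (BendGen v C e') (s.map fun p => (f p.1, p.2)) (t.map fun p => (f p.1, p.2)) →
          (bend v C e').rel (s.map fun p => bendMk v C e' (f p.1) p.2)
            (t.map fun p => bendMk v C e' (f p.1) p.2) := by
        intro s t h
        have := ofGen_rel _ h
        refine (congrArg₂ _ ?_ ?_).mp this
        · exact Multiset.map_map _ _ _
        · exact Multiset.map_map _ _ _
      refine key s t (Gen.of ?_)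
      cases h with
      | zero_left t =>
        simpa [← Prod.mk_zero_zero] using BendGen.zero_left (v := v) (e := e') t
      | zero_left' t => simpa [← Prod.mk_zero_zero] using BendGen.zero_left' (v := v) (e := e') t
      | zero_right b =>
        simpa [← Prod.mk_zero_zero] using BendGen.zero_right (v := v) (e := e') (f b)
      | zero_right' b =>
        simpa [← Prod.mk_zero_zero] using BendGen.zero_right' (v := v) (e := e') (f b)
      | scalar c b t => simpa [hf] using BendGen.scalar (v := v) (e := e') c (f b) t
      | scalar' c b t => simpa [hf] using BendGen.scalar' (v := v) (e := e') c (f b) t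
      | base h => simpa [Multiset.map_map] using BendGen.base (v := v) (e := e') h
      | bend h =>
        have := f.rel h
        rw [Multiset.map_singleton] at this
        simpa [Multiset.map_map] using BendGen.bend (v := v) (e := e') this
      | bend' h =>
        have := f.rel h
        rw [Multiset.map_singleton] at this
        simpa [Multiset.map_map] using BendGen.bend' (v := v) (e := e') this)

@[simp] theorem bendMap_mk (f : Hom B C) (hf : ∀ c, f (e c) = e' c) (b : B.carrier)
    (t : T.carrier) : bendMap (v := v) f hf (bendMk v B e b t) = bendMk v C e' (f b) t := rfl

theorem bendMk_surjective (x : (bend v B e).carrier) : ∃ b t, x = bendMk v B e b t := by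
  obtain ⟨⟨b, t⟩, rfl⟩ := ofGenMk_surjective _ x
  exact ⟨b, t, rfl⟩

theorem bendMap_str (f : Hom B C) (hf : ∀ c, f (e c) = e' c) (t : T.carrier) :
    bendMap (v := v) f hf (bendStr v B e t) = bendStr v C e' t := by
  change bendMk v C e' (f 1) t = bendMk v C e' 1 t
  rw [map_one]

end OBlp

/-- The bend of a scheme over `K` along `v : K → T`, given as a diagram of `T`-algebras. -/
def AlgDiag.bend {K : OBlp.{u₁}} {T : OBlp.{v}} (v : K.carrier →*₀ T.carrier) {J : Type w}
    [Preorder J] (D : AlgDiag.{u} K J) : AlgDiag.{max u v} T J where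
  obj j := OBlp.bend v (D.obj j) (D.str j)
  str j := OBlp.bendStr v (D.obj j) (D.str j)
  map i j h := OBlp.bendMap (D.map i j h) (D.map_str i j h)
  map_id j a := by
    obtain ⟨b, t, rfl⟩ := OBlp.bendMk_surjective a
    rw [OBlp.bendMap_mk, D.map_id]
  map_map i j l h h' a := by
    obtain ⟨b, t, rfl⟩ := OBlp.bendMk_surjective a
    rw [OBlp.bendMap_mk, OBlp.bendMap_mk, OBlp.bendMap_mk, D.map_map]
  map_str i j h a := OBlp.bendMap_str _ _ _

/-- Functoriality of the bend of schemes. -/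
def AlgDiag.Hom.bend {K : OBlp.{u₁}} {T : OBlp.{v}} (v : K.carrier →*₀ T.carrier) {J : Type w}
    [Preorder J] {D : AlgDiag.{u₂} K J} {E : AlgDiag.{u₃} K J} (β : AlgDiag.Hom D E) :
    AlgDiag.Hom (D.bend v) (E.bend v) where
  app j := OBlp.bendMap (β.app j) (β.app_str j)
  app_map i j h a := by
    obtain ⟨b, t, rfl⟩ := OBlp.bendMk_surjective a
    exact congrArg (fun x => OBlp.bendMk v (E.obj i) (E.str i) x t) (β.app_map i j h b)
  app_str j a := OBlp.bendMap_str _ _ _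

/-- The map `β_T` on `T`-rational points that is induced by a morphism of diagrams. -/
def AlgDiag.Hom.ratMap {T : OBlp.{v}} {J : Type w} [Preorder J] {D : AlgDiag.{u₁} T J}
    {E : AlgDiag.{u₂} T J} (β : AlgDiag.Hom D E) :
    OBSpace.RatPts E.toSpec → OBSpace.RatPts D.toSpec :=
  OBSpace.RatPts.map β.spaceMap β.toSpec_spaceMap

/-- The `T`-rational point `ι_j ∘ Spec f` of the colimit for a morphism `f : B_j → T` of
`T`-algebras. -/
def AlgDiag.point {T : OBlp.{v}} {J : Type w} [Preorder J] (D : AlgDiag.{u} T J) (j : J)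
    (f : OBlp.Hom (D.obj j) T) (hf : ∀ t, f (D.str j t) = t) : OBSpace.RatPts D.toSpec :=
  ⟨(D.incl j).comp (OBlp.specMap f), by
    rw [← OBSpace.Hom.comp_assoc, D.toSpec_incl, ← OBlp.specMap_comp, ← OBlp.specMap_id]
    exact congrArg _ (OBlp.Hom.ext hf)⟩

noncomputable section

/-! ## Valuations and Berkovich spaces -/

/-- A valuation with values in `𝕋` as a multiplicative map. -/
def valHom {R : Type u} [CommRing R] (w : Valuation R ℝ≥0) :
    (OBlp.ofSemiring R).carrier →*₀ OBlp.tropical.carrier :=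
  w.toMonoidWithZeroHom

/-- For a multiplicative map `w : B → 𝕋` with `w(a) ≤ max w(bⱼ)` for all relations `a ≤ ∑ bⱼ` in
`B` that extends `v : K → 𝕋`, the morphism from the bend of `B` to `𝕋` given by
`b ⊗ t ↦ w(b) t`. -/
def OBlp.bendEval {K : OBlp.{u₁}} {v : K.carrier →*₀ OBlp.tropical.carrier} {B : OBlp.{u}}
    {e : OBlp.Hom K B} (w : B.carrier →*₀ OBlp.tropical.carrier) (hwv : ∀ c, w (e c) = v c)
    (hw : ∀ a s, B.rel {a} s → (show ℝ≥0 from w a) ≤ (show Multiset ℝ≥0 from s.map w).sup) :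
    OBlp.Hom (OBlp.bend v B e) OBlp.tropical :=
  OBlp.bendLift (v := v) (e := e)
    { toFun := fun p => w p.1 * p.2
      map_zero' := mul_zero _
      map_one' := by
        change w 1 * 1 = 1
        rw [map_one, mul_one]
      map_mul' := fun p q => by
        change w (p.1 * q.1) * (p.2 * q.2) = _
        rw [map_mul]
        exact mul_mul_mul_comm _ _ _ _ }
    (by
      intro s t h
      have key : ∀ g : B.carrier × OBlp.tropical.carrier → ℝ≥0,
          (∀ p, g p = (show ℝ≥0 from w p.1 * p.2)) → (s.map g).sup = (t.map g).sup := by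
        intro g hg
        have hw1 : ∀ t : ℝ≥0, g (1, t) = t := fun t => by
          refine (hg _).trans ?_
          rw [map_one]
          exact one_mul t
        have hb1 : ∀ b, g (b, 1) = w b := fun b => (hg _).trans (mul_one (w b))
        have h0 : ∀ t, g (0, t) = g 0 := fun t => by
          rw [hg, hg]
          change w 0 * t = w 0 * 0
          rw [map_zero, zero_mul, zero_mul]
        have h0' : ∀ b, g (b, 0) = g 0 := fun b => by
          rw [hg, hg]
          change w b * 0 = w 0 * 0
          rw [mul_zero, mul_zero]
        have hc : ∀ c b t, g (e c * b, t) = g (b, v c * t) := fun c b t => by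
          rw [hg, hg]
          change w (e c * b) * t = w b * (v c * t)
          rw [map_mul, hwv, mul_comm (v c), mul_assoc]
        have hs : ∀ s : Multiset B.carrier,
            ((s.map fun b => (b, (1 : OBlp.tropical.carrier))).map g) = s.map w := fun s =>
          (Multiset.map_map _ _ _).trans (Multiset.map_congr rfl fun b _ => hb1 b)
        have ht : ∀ s : Multiset ℝ≥0,
            ((s.map fun t => ((1 : B.carrier), (show OBlp.tropical.carrier from t))).map g) = s :=
          fun s => (Multiset.map_map _ _ _).trans
            ((Multiset.map_congr rfl fun t _ => hw1 t).trans (Multiset.map_id s))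
        have hbend : ∀ {a s}, B.rel {a} s →
            (((a, (1 : OBlp.tropical.carrier)) ::ₘ s.map fun b => (b, 1)).map g).sup =
              ((s.map fun b => (b, (1 : OBlp.tropical.carrier))).map g).sup := by
          intro a s has
          rw [Multiset.map_cons, Multiset.sup_cons, hb1, hs]
          exact max_eq_right (hw a s has)
        cases h with
        | zero_left t => rw [Multiset.map_singleton, Multiset.map_singleton, h0]
        | zero_left' t => rw [Multiset.map_singleton, Multiset.map_singleton, h0]
        | zero_right b => rw [Multiset.map_singleton, Multiset.map_singleton, h0']
        | zero_right' b => rw [Multiset.map_singleton, Multiset.map_singleton, h0']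
        | scalar c b t => rw [Multiset.map_singleton, Multiset.map_singleton, hc]
        | scalar' c b t => rw [Multiset.map_singleton, Multiset.map_singleton, hc]
        | base h => exact (congrArg _ (ht _)).trans (h.trans (congrArg _ (ht _)).symm)
        | bend h => exact hbend h
        | bend' h => exact (hbend h).symm
      exact key _ fun _ => rfl)

theorem OBlp.bendEval_mk {K : OBlp.{u₁}} {v : K.carrier →*₀ OBlp.tropical.carrier} {B : OBlp.{u}}
    {e : OBlp.Hom K B} (w : B.carrier →*₀ OBlp.tropical.carrier) (hwv : ∀ c, w (e c) = v c)
    (hw : ∀ a s, B.rel {a} s → (show ℝ≥0 from w a) ≤ (show Multiset ℝ≥0 from s.map w).sup)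
    (b : B.carrier) (t : OBlp.tropical.carrier) :
    OBlp.bendEval (v := v) (e := e) w hwv hw (OBlp.bendMk v B e b t) = w b * t := rfl

theorem valuation_le_sup {R : Type u} [CommRing R] (w : Valuation R ℝ≥0) (s : Multiset R) :
    w s.sum ≤ (s.map w).sup := by
  induction s using Multiset.induction_on with
  | empty => simp
  | cons a s ih =>
    rw [Multiset.sum_cons, Multiset.map_cons, Multiset.sup_cons]
    exact (w.map_add a s.sum).trans (max_le_max le_rfl ih)

/-- The set of `𝕋`-rational points, with the fine topology, of the bend along `v` of a scheme over
the field `k`. -/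
abbrev BendPts {k : Type u} [Field k] (v : Valuation k ℝ≥0) {J : Type w} [Preorder J]
    (D : AlgDiag.{u} (OBlp.ofSemiring k) J) : Type max w u :=
  OBSpace.RatPts (D.bend (valHom v)).toSpec

/-- The map between `𝕋`-rational points of the bends that is induced by a morphism of schemes over
`k`. -/
def bendPtsMap {k : Type u} [Field k] (v : Valuation k ℝ≥0) {J : Type w} [Preorder J]
    {D E : AlgDiag.{u} (OBlp.ofSemiring k) J} (β : AlgDiag.Hom D E) :
    BendPts v E → BendPts v D :=
  (β.bend (valHom v)).ratMap

section Berkovich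

variable {k : Type u} [Field k] {Y : Scheme.{u}} (f : Y ⟶ AlgebraicGeometry.Spec (.of k))

/-- The structure of `Γ(Y, U)` as a `k`-algebra for a `k`-scheme `Y`. -/
def kstr (U : Y.Opens) : k →+* Γ(Y, U) :=
  ((Scheme.ΓSpecIso (.of k)).inv ≫ f.appTop ≫ Y.presheaf.map (homOfLE le_top).op).hom

/-- The restriction map `Γ(Y, U) → Γ(Y, V)` for `V ⊆ U`. -/
def resHom (Y : Scheme.{u}) {U V : Y.Opens} (h : V ≤ U) : Γ(Y, U) →+* Γ(Y, V) :=
  (Y.presheaf.map (homOfLE h).op).hom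

theorem resHom_refl (U : Y.Opens) (h : U ≤ U) (a : Γ(Y, U)) : resHom Y h a = a := by
  change (Y.presheaf.map (homOfLE h).op).hom a = a
  have : (homOfLE h).op = 𝟙 _ := rfl
  rw [this, Y.presheaf.map_id]
  rfl

theorem resHom_resHom {U V W : Y.Opens} (h : V ≤ U) (h' : W ≤ V) (a : Γ(Y, U)) :
    resHom Y h' (resHom Y h a) = resHom Y (h'.trans h) a := by
  change (Y.presheaf.map (homOfLE h).op ≫ Y.presheaf.map (homOfLE h').op).hom a = _
  rw [← Y.presheaf.map_comp]
  rfl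

theorem resHom_kstr {U V : Y.Opens} (h : V ≤ U) (c : k) :
    resHom Y h (kstr f U c) = kstr f V c := resHom_resHom le_top h _

/-- An affine presentation of the scheme `Y`: a monotone family of affine open subschemes `U_j` that
covers `Y` and for which `Y` is the colimit of the `U_j`, that is, for every point `x` of `Y` any two
members of the family that contain `x` are connected by a zigzag of inclusions between members
that contain `x`. -/
structure AffinePresentation (Y : Scheme.{u}) (J : Type w) [Preorder J] where
  /-- the affine open subschemes -/
  U : J → Y.Opens
  isAffineOpen : ∀ j, IsAffineOpen (U j)
  mono : ∀ {i j}, i ≤ j → U i ≤ U j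
  connected : ∀ (x : Y) (i j : {j // x ∈ U j}), Relation.EqvGen (fun i j => i.1 ≤ j.1) i j
  covers : ∀ x : Y, ∃ j, x ∈ U j

variable (v : Valuation k ℝ≥0) {J : Type w} [Preorder J] (P : AffinePresentation Y J)

/-- The Berkovich analytification of the affine open `U` of `Y`: the valuations on `Γ(Y, U)` that
extend `v`. -/
def AffAn (U : Y.Opens) : Type u := {w : Valuation Γ(Y, U) ℝ≥0 // ∀ c, w (kstr f U c) = v c}

/-- The coarsest topology for which all evaluation maps `w ↦ w(a)` are continuous. -/
instance (U : Y.Opens) : TopologicalSpace (AffAn f v U) :=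
  TopologicalSpace.induced (fun w a => w.1 a) (inferInstance : TopologicalSpace (Γ(Y, U) → ℝ≥0))

/-- The map `V^an → U^an` for `V ⊆ U`. -/
def AffAn.map {U V : Y.Opens} (h : V ≤ U) (w : AffAn f v V) : AffAn f v U :=
  ⟨w.1.comap (resHom Y h), fun c => (congrArg w.1 (resHom_kstr f h c)).trans (w.2 c)⟩

/-- The Berkovich analytification of the `k`-scheme `Y`: the colimit of the topological spaces
`U_j^an` for an affine presentation of `Y`. -/
def Berk : Type max u w :=
  Quot fun p q : Σ j, AffAn f v (P.U j) => ∃ h : p.1 ≤ q.1, AffAn.map f v (P.mono h) p.2 = q.2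

instance : TopologicalSpace (Berk f v P) := inferInstanceAs (TopologicalSpace (Quot _))

/-- The point of `Y^an` given by a valuation on `Γ(Y, U_j)`. -/
def Berk.mk (j : J) (w : AffAn f v (P.U j)) : Berk f v P := Quot.mk _ ⟨j, w⟩

/-- The `k`-scheme `Y` as an ordered blue scheme over `k`. -/
def schemeDiag : AlgDiag.{u} (OBlp.ofSemiring k) J where
  obj j := OBlp.ofSemiring Γ(Y, P.U j)
  str j := OBlp.Hom.ofRingHom (kstr f (P.U j))
  map _ _ h := OBlp.Hom.ofRingHom (resHom Y (P.mono h))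
  map_id _ _ := resHom_refl _ _ _
  map_map _ _ _ _ _ _ := resHom_resHom _ _ _
  map_str _ _ _ a := resHom_kstr f _ a

/-- The `𝕋`-rational point of the bend of `Y` that is given by a valuation `w` on `Γ(Y, U_j)`
extending `v`: it is induced by the map `a ⊗ t ↦ w(a) t`. -/
def valPoint (j : J) (w : AffAn f v (P.U j)) :
    BendPts v (schemeDiag f P) :=
  ((schemeDiag f P).bend (valHom v)).point j
    (OBlp.bendEval (valHom w.1) w.2 fun a s h => by
      exact (congrArg w.1 (show a = Multiset.sum (M := Γ(Y, P.U j)) s from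
        (Multiset.sum_singleton (M := Γ(Y, P.U j)) a).symm.trans h)).trans_le
          (valuation_le_sup w.1 s))
    (fun t => (congrArg (· * (show ℝ≥0 from t)) w.1.map_one).trans
      (one_mul (show ℝ≥0 from t)))

end Berkovich

/-! ## Cones and fans -/

section Toric

variable {n : ℕ}

/-- The pairing of the real vector space `N_ℝ = ℝⁿ` with its dual. -/
def pair (u y : Fin n → ℝ) : ℝ := ∑ i, u i * y i

/-- The inclusion of the lattice `ℤⁿ` into `ℝⁿ`. -/
def castVec (m : Fin n → ℤ) : Fin n → ℝ := fun i => (m i : ℝ)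

/-- A strongly convex polyhedral rational cone. -/
def IsRatCone (τ : PointedCone ℝ (Fin n → ℝ)) : Prop :=
  (∃ S : Finset (Fin n → ℤ), τ = PointedCone.hull ℝ (castVec '' (S : Set (Fin n → ℤ)))) ∧
    ∀ x ∈ τ, -x ∈ τ → x = 0

/-- The cone `σ` is a face of `τ`: it is the intersection of `τ` with the zero set of a linear form
that is nonnegative on `τ`. -/
def IsFace (σ τ : PointedCone ℝ (Fin n → ℝ)) : Prop :=
  ∃ u : Fin n → ℝ, (∀ y ∈ τ, 0 ≤ pair u y) ∧ ∀ y, y ∈ σ ↔ y ∈ τ ∧ pair u y = 0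

/-- A fan in `ℝⁿ` with respect to the lattice `ℤⁿ`. -/
structure Fan (n : ℕ) where
  /-- the cones of the fan -/
  cones : Set (PointedCone ℝ (Fin n → ℝ))
  isRatCone : ∀ τ ∈ cones, IsRatCone τ
  face_mem : ∀ τ ∈ cones, ∀ σ, IsFace σ τ → σ ∈ cones
  isFace_inf : ∀ σ ∈ cones, ∀ τ ∈ cones, IsFace (σ ⊓ τ) σ ∧ IsFace (σ ⊓ τ) τ

/-- The monoid `τ^∨ ∩ ℤⁿ` of lattice points of the dual cone. -/
def dualMonoid (τ : PointedCone ℝ (Fin n → ℝ)) : AddSubmonoid (Fin n → ℤ) where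
  carrier := {m | ∀ y ∈ τ, 0 ≤ pair (castVec m) y}
  add_mem' {a b} ha hb y hy := by
    have e : pair (castVec (a + b)) y = pair (castVec a) y + pair (castVec b) y := by
      simp [pair, castVec, add_mul, Finset.sum_add_distrib]
    rw [e]
    exact add_nonneg (ha y hy) (hb y hy)
  zero_mem' y _ := by simp [pair, castVec]

theorem pair_add_right (u x y : Fin n → ℝ) : pair u (x + y) = pair u x + pair u y := by
  simp [pair, mul_add, Finset.sum_add_distrib]

theorem pair_smul_right (u : Fin n → ℝ) (r : ℝ) (y : Fin n → ℝ) :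
    pair u (r • y) = r * pair u y := by
  simp only [pair, Pi.smul_apply, smul_eq_mul, Finset.mul_sum]
  exact Finset.sum_congr rfl fun i _ => by ring

theorem pair_add_left (u v x : Fin n → ℝ) : pair (u + v) x = pair u x + pair v x := by
  simp [pair, add_mul, Finset.sum_add_distrib]

theorem castVec_add (a b : Fin n → ℤ) : castVec (a + b) = castVec a + castVec b := by
  ext i
  simp [castVec]

theorem pair_nsmul_left (N : ℕ) (u : Fin n → ℤ) (x : Fin n → ℝ) :
    pair (castVec (N • u)) x = N * pair (castVec u) x := by
  simp only [pair, castVec, Finset.mul_sum]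
  exact Finset.sum_congr rfl fun i _ => by simp [mul_assoc]

theorem span_nonneg {S : Set (Fin n → ℝ)} {u : Fin n → ℝ} (h : ∀ y ∈ S, 0 ≤ pair u y)
    {y : Fin n → ℝ} (hy : y ∈ PointedCone.hull ℝ S) : 0 ≤ pair u y := by
  induction hy using Submodule.span_induction with
  | mem y hy => exact h y hy
  | zero => simp [pair]
  | add x y _ _ hx hy =>
    rw [pair_add_right]
    exact add_nonneg hx hy
  | smul r y _ hy =>
    change 0 ≤ pair u ((r : ℝ) • y)
    rw [pair_smul_right]
    exact mul_nonneg r.2 hy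

/-- A real linear form can be replaced by an integral one with the same signs on finitely many
lattice points on which it is nonnegative. -/
theorem exists_integral_form (S : Finset (Fin n → ℤ)) (u : Fin n → ℝ)
    (hu : ∀ y ∈ S, 0 ≤ pair u (castVec y)) :
    ∃ m : Fin n → ℤ, ∀ y ∈ S, 0 ≤ pair (castVec m) (castVec y) ∧
      (pair (castVec m) (castVec y) = 0 ↔ pair u (castVec y) = 0) := by
  let V : Submodule ℚ ℝ := Submodule.span ℚ (Set.range u)
  have hfin : FiniteDimensional ℚ V := FiniteDimensional.span_of_finite ℚ (Set.finite_range u)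
  let b := Module.finBasis ℚ V
  let uV : Fin n → V := fun i => ⟨u i, Submodule.subset_span ⟨i, rfl⟩⟩
  let pV : (Fin n → ℤ) → V := fun y => ∑ i, (y i : ℚ) • uV i
  have hpV : ∀ y, ((pV y : V) : ℝ) = pair u (castVec y) := by
    intro y
    simp only [pV, pair, castVec, Submodule.coe_sum, Submodule.coe_smul, uV]
    refine Finset.sum_congr rfl fun i _ => ?_
    rw [Rat.smul_def, mul_comm]
    simp
  let ψ : V → (Fin (Module.finrank ℚ V) → ℝ) → ℝ := fun x r => ∑ j, ((b.repr x j : ℚ) : ℝ) * r j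
  have hψc : ∀ x, Continuous (ψ x) := fun x => by
    unfold ψ
    fun_prop
  have hψb : ∀ x : V, ψ x (fun j => ((b j : V) : ℝ)) = x := by
    intro x
    have h := congrArg (fun z : V => (z : ℝ)) (b.sum_repr x)
    simp only [Submodule.coe_sum, Submodule.coe_smul] at h
    rw [← h]
    exact Finset.sum_congr rfl fun j _ => (Rat.smul_def _ _).symm
  have hopen : IsOpen {r : Fin (Module.finrank ℚ V) → ℝ |
      ∀ y ∈ S.filter (fun y => 0 < pair u (castVec y)), 0 < ψ (pV y) r} := by
    simp only [Set.ofPred_forall]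
    exact isOpen_biInter_finset fun y _ => isOpen_lt continuous_const (hψc _)
  have hdense : DenseRange (Pi.map fun (_ : Fin (Module.finrank ℚ V)) (q : ℚ) => (q : ℝ)) :=
    DenseRange.piMap fun _ => Rat.denseRange_cast
  obtain ⟨q, hq⟩ := hdense.exists_mem_open hopen ⟨fun j => ((b j : V) : ℝ), fun y hy => by
    rw [hψb, hpV]
    exact (Finset.mem_filter.1 hy).2⟩
  let φ : V →ₗ[ℚ] ℚ := b.constr ℚ q
  have hφ : ∀ x : V, ((φ x : ℚ) : ℝ) = ψ x (fun j => (q j : ℝ)) := by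
    intro x
    simp only [φ, ψ, Module.Basis.constr_apply_fintype, smul_eq_mul, Module.Basis.equivFun_apply]
    push_cast
    rfl
  obtain ⟨⟨N, hN⟩, hNm⟩ := IsLocalization.exist_integer_multiples_of_finite (nonZeroDivisors ℤ)
    (fun i => φ (uV i))
  have hN0 : N ≠ 0 := nonZeroDivisors.ne_zero hN
  choose m hm using hNm
  have hmq : ∀ i, (m i : ℚ) = N * φ (uV i) := fun i => by
    have := hm i
    simpa using this
  have hpair : ∀ y : Fin n → ℤ, pair (castVec m) (castVec y) = N * ((φ (pV y) : ℚ) : ℝ) := by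
    intro y
    have h1 : φ (pV y) = ∑ i, (y i : ℚ) * φ (uV i) := by simp [pV]
    rw [h1]
    simp only [pair, castVec]
    push_cast
    rw [Finset.mul_sum]
    refine Finset.sum_congr rfl fun i _ => ?_
    have h2 : ((m i : ℤ) : ℝ) = N * ((φ (uV i) : ℚ) : ℝ) := by
      have := congrArg (fun z : ℚ => (z : ℝ)) (hmq i)
      push_cast at this
      exact this
    rw [h2]
    ring
  refine ⟨fun i => N * m i, fun y hy => ?_⟩
  have hpair' : pair (castVec fun i => N * m i) (castVec y) = (N : ℝ) * N * ((φ (pV y) : ℚ) : ℝ) := by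
    have : pair (castVec fun i => N * m i) (castVec y) = N * pair (castVec m) (castVec y) := by
      simp only [pair, castVec, Finset.mul_sum]
      refine Finset.sum_congr rfl fun i _ => ?_
      push_cast
      ring
    rw [this, hpair, mul_assoc]
  have hNN : (0 : ℝ) < N * N := by
    have : (N : ℝ) ≠ 0 := by exact_mod_cast hN0
    exact mul_self_pos.2 this
  rcases (hu y hy).eq_or_lt with h0 | hpos
  · have : pV y = 0 := Subtype.ext ((hpV y).trans h0.symm)
    rw [hpair', this, map_zero]
    simp [h0.symm]
  · have h1 : 0 < ψ (pV y) (fun j => (q j : ℝ)) := hq y (Finset.mem_filter.2 ⟨hy, hpos⟩)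
    rw [← hφ] at h1
    rw [hpair']
    exact ⟨(mul_pos hNN h1).le, ⟨fun h => absurd h (mul_pos hNN h1).ne', fun h => absurd h hpos.ne'⟩⟩

/-- Faces of rational cones are cut out by integral linear forms. -/
theorem IsFace.exists_integral {σ τ : PointedCone ℝ (Fin n → ℝ)} (hτ : IsRatCone τ)
    (h : IsFace σ τ) : ∃ m ∈ dualMonoid τ, ∀ y, y ∈ σ ↔ y ∈ τ ∧ pair (castVec m) y = 0 := by
  obtain ⟨⟨S, rfl⟩, -⟩ := hτ
  obtain ⟨u, hu, hσ⟩ := h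
  have hSmem : ∀ y ∈ S, castVec y ∈ PointedCone.hull ℝ (castVec '' (S : Set (Fin n → ℤ))) :=
    fun y hy => Submodule.subset_span ⟨y, hy, rfl⟩
  obtain ⟨m, hm⟩ := exists_integral_form S u fun y hy => hu _ (hSmem y hy)
  have hm0 : m ∈ dualMonoid (PointedCone.hull ℝ (castVec '' (S : Set (Fin n → ℤ)))) := by
    intro y hy
    refine span_nonneg ?_ hy
    rintro _ ⟨y, hy, rfl⟩
    exact (hm y hy).1
  have key : ∀ y ∈ PointedCone.hull ℝ (castVec '' (S : Set (Fin n → ℤ))),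
      (pair (castVec m) y = 0 ↔ pair u y = 0) := by
    intro y hy
    induction hy using Submodule.span_induction with
    | mem y hy =>
      obtain ⟨y, hy, rfl⟩ := hy
      exact (hm y hy).2
    | zero => simp [pair]
    | add x y hx hy hx' hy' =>
      rw [pair_add_right, pair_add_right, add_eq_zero_iff_of_nonneg (hm0 x hx) (hm0 y hy),
        add_eq_zero_iff_of_nonneg (hu x hx) (hu y hy), hx', hy']
    | smul r y _ hy =>
      change pair (castVec m) ((r : ℝ) • y) = 0 ↔ pair u ((r : ℝ) • y) = 0
      rw [pair_smul_right, pair_smul_right, mul_eq_zero, mul_eq_zero, hy]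
  exact ⟨m, hm0, fun y => (hσ y).trans (and_congr_right fun hy => (key y hy).symm)⟩

theorem exists_add_nsmul_mem {σ τ : PointedCone ℝ (Fin n → ℝ)} (hτ : IsRatCone τ)
    {u : Fin n → ℤ} (hu : u ∈ dualMonoid τ) (hσ : ∀ y, y ∈ σ ↔ y ∈ τ ∧ pair (castVec u) y = 0)
    {m : Fin n → ℤ} (hm : m ∈ dualMonoid σ) : ∃ N : ℕ, m + N • u ∈ dualMonoid τ := by
  obtain ⟨⟨S, rfl⟩, -⟩ := hτ
  have hint : ∀ a b : Fin n → ℤ, ∃ z : ℤ, pair (castVec a) (castVec b) = z := fun a b =>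
    ⟨∑ i, a i * b i, by simp [pair, castVec]⟩
  have hSmem : ∀ y ∈ S, castVec y ∈ PointedCone.hull ℝ (castVec '' (S : Set (Fin n → ℤ))) :=
    fun y hy => Submodule.subset_span ⟨y, hy, rfl⟩
  obtain ⟨N, hN⟩ : ∃ N : ℕ, ∀ y ∈ S, -pair (castVec m) (castVec y) ≤ N := by
    refine ⟨⌈∑ y ∈ S, |pair (castVec m) (castVec y)|⌉₊, fun y hy => ?_⟩
    refine (neg_le_abs _).trans (le_trans ?_ (Nat.le_ceil _))
    exact Finset.single_le_sum (f := fun y => |pair (castVec m) (castVec y)|)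
      (fun _ _ => abs_nonneg _) hy
  refine ⟨N, fun y hy => span_nonneg ?_ hy⟩
  rintro _ ⟨y, hy, rfl⟩
  rw [castVec_add, pair_add_left, pair_nsmul_left]
  rcases (hu _ (hSmem y hy)).eq_or_lt with h0 | hpos
  · have := hm _ ((hσ _).2 ⟨hSmem y hy, h0.symm⟩)
    rw [← h0]
    simpa using this
  · obtain ⟨z, hz⟩ := hint u y
    rw [hz] at hpos ⊢
    have hz1 : (1 : ℝ) ≤ z := by
      have : 0 < z := by exact_mod_cast hpos
      exact_mod_cast this
    have h1 := hN y hy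
    have h2 : (N : ℝ) * 1 ≤ N * z := mul_le_mul_of_nonneg_left hz1 (Nat.cast_nonneg N)
    linarith

/-! ## Toric varieties -/

theorem dualMonoid_anti {σ τ : PointedCone ℝ (Fin n → ℝ)} (h : σ ≤ τ) :
    dualMonoid τ ≤ dualMonoid σ := fun _ hm y hy => hm y (h hy)

/-- The monoid algebra `k[τ^∨ ∩ ℤⁿ]`. -/
abbrev ToricRing (k : Type u) [Field k] (τ : PointedCone ℝ (Fin n → ℝ)) : Type u :=
  AddMonoidAlgebra k (dualMonoid τ)

variable (k : Type u) [Field k]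

/-- The map `k[τ^∨ ∩ ℤⁿ] → k[σ^∨ ∩ ℤⁿ]` for `σ ⊆ τ`. -/
def toricMap {σ τ : PointedCone ℝ (Fin n → ℝ)} (h : σ ≤ τ) : ToricRing k τ →+* ToricRing k σ :=
  AddMonoidAlgebra.mapDomainRingHom k (AddSubmonoid.inclusion (dualMonoid_anti h))

theorem toricMap_single {σ τ : PointedCone ℝ (Fin n → ℝ)} (h : σ ≤ τ) (m : dualMonoid τ) (c : k) :
    toricMap k h (AddMonoidAlgebra.single m c) =
      AddMonoidAlgebra.single (AddSubmonoid.inclusion (dualMonoid_anti h) m) c :=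
  AddMonoidAlgebra.mapDomain_single

theorem toricMap_id (τ : PointedCone ℝ (Fin n → ℝ)) (h : τ ≤ τ) :
    toricMap k h = RingHom.id (ToricRing k τ) :=
  AddMonoidAlgebra.mapDomainRingHom_id

theorem toricMap_comp {ρ σ τ : PointedCone ℝ (Fin n → ℝ)} (h : ρ ≤ σ) (h' : σ ≤ τ) :
    (toricMap k h).comp (toricMap k h') = toricMap k (h.trans h') :=
  (AddMonoidAlgebra.mapDomainRingHom_comp _ _).symm

/-- A cone contained in another one of the fan corresponds to a localization. -/
theorem Fan.isLocalization (Δ : Fan n) {σ τ : PointedCone ℝ (Fin n → ℝ)} (hτ : τ ∈ Δ.cones)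
    (h : σ ≤ τ) (u : dualMonoid τ)
    (hu : ∀ y, y ∈ σ ↔ y ∈ τ ∧ pair (castVec (u : Fin n → ℤ)) y = 0) :
    letI := (toricMap k h).toAlgebra
    IsLocalization.Away (AddMonoidAlgebra.single u (1 : k)) (ToricRing k σ) := by
  let := (toricMap k h).toAlgebra
  have hmap : ∀ a, algebraMap (ToricRing k τ) (ToricRing k σ) a = toricMap k h a := fun _ => rfl
  have hneg : -(u : Fin n → ℤ) ∈ dualMonoid σ := by
    intro y hy
    have e : pair (castVec (-(u : Fin n → ℤ))) y = -pair (castVec (u : Fin n → ℤ)) y := by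
      simp [pair, castVec]
    rw [e, ((hu y).1 hy).2, neg_zero]
  refine IsLocalization.Away.mk _ ?_ ?_ ?_
  · rw [hmap, toricMap_single]
    refine IsUnit.of_mul_eq_one (AddMonoidAlgebra.single ⟨-(u : Fin n → ℤ), hneg⟩ (1 : k)) ?_
    rw [AddMonoidAlgebra.single_mul_single, AddMonoidAlgebra.one_def, one_mul]
    congr 1
    exact Subtype.ext (add_neg_cancel _)
  · have hpow : ∀ N : ℕ, algebraMap (ToricRing k τ) (ToricRing k σ)
        (AddMonoidAlgebra.single u (1 : k)) ^ N =
          AddMonoidAlgebra.single (N • AddSubmonoid.inclusion (dualMonoid_anti h) u) (1 : k) := by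
      intro N
      rw [hmap, toricMap_single, AddMonoidAlgebra.single_pow, one_pow]
    intro s
    induction s using AddMonoidAlgebra.induction_linear with
    | zero => exact ⟨0, 0, by simp⟩
    | add s t hs ht =>
      obtain ⟨N, a, ha⟩ := hs
      obtain ⟨M, b, hb⟩ := ht
      refine ⟨N + M, a * AddMonoidAlgebra.single u (1 : k) ^ M +
        b * AddMonoidAlgebra.single u (1 : k) ^ N, ?_⟩
      rw [map_add, map_mul, map_mul, ← ha, ← hb, map_pow, map_pow]
      ring
    | single m c =>
      obtain ⟨N, hN⟩ := exists_add_nsmul_mem (Δ.isRatCone τ hτ) u.2 hu m.2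
      refine ⟨N, AddMonoidAlgebra.single ⟨_, hN⟩ c, ?_⟩
      rw [hpow, hmap, toricMap_single, AddMonoidAlgebra.single_mul_single, mul_one]
      congr 1
  · intro a b hab
    refine ⟨0, ?_⟩
    have : a = b := AddMonoidAlgebra.mapDomain_injective
      (AddSubmonoid.inclusion_injective (dualMonoid_anti h)) hab
    rw [this]

theorem Fan.exists_form (Δ : Fan n) {σ τ : PointedCone ℝ (Fin n → ℝ)} (hσ : σ ∈ Δ.cones)
    (hτ : τ ∈ Δ.cones) (h : σ ≤ τ) : ∃ u : dualMonoid τ,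
      ∀ y, y ∈ σ ↔ y ∈ τ ∧ pair (castVec (u : Fin n → ℤ)) y = 0 := by
  have := (Δ.isFace_inf σ hσ τ hτ).2
  rw [inf_eq_left.2 h] at this
  obtain ⟨m, hm, hm'⟩ := this.exists_integral (Δ.isRatCone τ hτ)
  exact ⟨⟨m, hm⟩, hm'⟩

theorem Fan.isOpenImmersion_toricMap (Δ : Fan n) {σ τ : PointedCone ℝ (Fin n → ℝ)}
    (hσ : σ ∈ Δ.cones) (hτ : τ ∈ Δ.cones) (h : σ ≤ τ) :
    IsOpenImmersion (Spec.map (CommRingCat.ofHom (toricMap k h))) := by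
  obtain ⟨u, hu⟩ := Δ.exists_form hσ hτ h
  let := (toricMap k h).toAlgebra
  have := Δ.isLocalization k hτ h u hu
  exact IsOpenImmersion.of_isLocalization (R := ToricRing k τ) (S := ToricRing k σ)
    (AddMonoidAlgebra.single u (1 : k))

theorem Fan.mem_range_toricMap (Δ : Fan n) {σ τ : PointedCone ℝ (Fin n → ℝ)} (hτ : τ ∈ Δ.cones)
    (h : σ ≤ τ) (u : dualMonoid τ)
    (hu : ∀ y, y ∈ σ ↔ y ∈ τ ∧ pair (castVec (u : Fin n → ℤ)) y = 0)
    (p : PrimeSpectrum (ToricRing k τ)) :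
    (∃ q, PrimeSpectrum.comap (toricMap k h) q = p) ↔
      AddMonoidAlgebra.single u (1 : k) ∉ p.asIdeal := by
  let := (toricMap k h).toAlgebra
  have := Δ.isLocalization k hτ h u hu
  have h1 := PrimeSpectrum.localization_away_comap_range (ToricRing k σ)
    (AddMonoidAlgebra.single u (1 : k))
  exact Set.ext_iff.1 h1 p

/-- The diagram of the affine toric varieties `Spec k[τ^∨ ∩ ℤⁿ]` for `τ` in the fan. -/
def toricDiagram (Δ : Fan n) : Δ.cones ⥤ Scheme.{u} where
  obj τ := Spec (.of (ToricRing k τ.1))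
  map {σ τ} h := Spec.map (CommRingCat.ofHom (toricMap k (show σ.1 ≤ τ.1 from leOfHom h)))
  map_id τ := by
    rw [toricMap_id]
    exact Spec.map_id _
  map_comp {ρ σ τ} h h' := by
    rw [← toricMap_comp k (show ρ.1 ≤ σ.1 from leOfHom h) (show σ.1 ≤ τ.1 from leOfHom h')]
    exact (congrArg Spec.map (CommRingCat.ofHom_comp _ _)).trans (Spec.map_comp _ _)

instance (Δ : Fan n) {σ τ : Δ.cones} (h : σ ⟶ τ) : IsOpenImmersion ((toricDiagram k Δ).map h) :=
  Δ.isOpenImmersion_toricMap k σ.2 τ.2 (leOfHom h)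

instance (Δ : Fan n) : (toricDiagram k Δ ⋙ Scheme.forget).IsLocallyDirected where
  cond {i j l} fi fj xi xj hx := by
    have hi : i.1 ≤ l.1 := leOfHom fi
    have hj : j.1 ≤ l.1 := leOfHom fj
    obtain ⟨u, hu⟩ := Δ.exists_form j.2 l.2 hj
    have hij : i.1 ⊓ j.1 ∈ Δ.cones := Δ.face_mem _ i.2 _ (Δ.isFace_inf _ i.2 _ j.2).1
    let u' : dualMonoid i.1 := AddSubmonoid.inclusion (dualMonoid_anti hi) u
    have hu' : ∀ y, y ∈ i.1 ⊓ j.1 ↔ y ∈ i.1 ∧ pair (castVec (u' : Fin n → ℤ)) y = 0 := by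
      intro y
      constructor
      · exact fun hy => ⟨hy.1, ((hu y).1 hy.2).2⟩
      · exact fun hy => ⟨hy.1, (hu y).2 ⟨hi hy.1, hy.2⟩⟩
    have hx' : PrimeSpectrum.comap (toricMap k hi) xi = PrimeSpectrum.comap (toricMap k hj) xj := hx
    have h1 := (Δ.mem_range_toricMap k l.2 hj u hu (PrimeSpectrum.comap (toricMap k hj) xj)).1
      ⟨xj, rfl⟩
    rw [← hx'] at h1
    have h2 : AddMonoidAlgebra.single u' (1 : k) ∉ (xi : PrimeSpectrum (ToricRing k i.1)).asIdeal := by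
      intro hmem
      refine h1 ?_
      change toricMap k hi _ ∈ PrimeSpectrum.asIdeal xi
      rw [toricMap_single]
      exact hmem
    obtain ⟨z, hz⟩ := (Δ.mem_range_toricMap k i.2 inf_le_left u' hu' xi).2 h2
    let m : Δ.cones := ⟨i.1 ⊓ j.1, hij⟩
    let fmi : m ⟶ i := homOfLE (show i.1 ⊓ j.1 ≤ i.1 from inf_le_left)
    let fmj : m ⟶ j := homOfLE (show i.1 ⊓ j.1 ≤ j.1 from inf_le_right)
    refine ⟨m, fmi, fmj, z, hz, ?_⟩
    have hinj : Function.Injective ((toricDiagram k Δ ⋙ Scheme.forget).map fj) :=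
      ((toricDiagram k Δ).map fj).isOpenEmbedding.injective
    refine hinj ?_
    have hz' : (toricDiagram k Δ ⋙ Scheme.forget).map fmi z = xi := hz
    have e1 : ∀ {a b c : Δ.cones} (f : a ⟶ b) (g : b ⟶ c)
        (y : (toricDiagram k Δ ⋙ Scheme.forget).obj a),
        (toricDiagram k Δ ⋙ Scheme.forget).map g ((toricDiagram k Δ ⋙ Scheme.forget).map f y) =
          (toricDiagram k Δ ⋙ Scheme.forget).map (f ≫ g) y := by
      intro a b c f g y
      rw [Functor.map_comp]
      rfl
    have e2 : fmj ≫ fj = fmi ≫ fi := Subsingleton.elim _ _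
    refine (e1 fmj fj z).trans (Eq.trans ?_ hx)
    rw [e2]
    refine (e1 fmi fi z).symm.trans ?_
    exact congrArg _ hz'

/-- The toric variety over `k` that is associated with the fan `Δ`. -/
def toricVariety (Δ : Fan n) : Scheme.{u} := Limits.colimit (toricDiagram k Δ)

/-- The open immersion of the affine toric variety of a cone. -/
def toricChart (Δ : Fan n) (τ : Δ.cones) :
    AlgebraicGeometry.Spec (.of (ToricRing k τ.1)) ⟶ toricVariety k Δ :=
  Limits.colimit.ι (toricDiagram k Δ) τ

instance (Δ : Fan n) (τ : Δ.cones) : IsOpenImmersion (toricChart k Δ τ) :=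
  inferInstanceAs (IsOpenImmersion (Limits.colimit.ι (toricDiagram k Δ) τ))

theorem toricMap_toricChart (Δ : Fan n) {σ τ : Δ.cones} (h : σ ≤ τ) :
    Spec.map (CommRingCat.ofHom (toricMap k (show σ.1 ≤ τ.1 from h))) ≫ toricChart k Δ τ =
      toricChart k Δ σ :=
  Limits.colimit.w (toricDiagram k Δ) (homOfLE h)

/-- The structure map of `k[τ^∨ ∩ ℤⁿ]`. -/
def toricStr (τ : PointedCone ℝ (Fin n → ℝ)) : k →+* ToricRing k τ := AddMonoidAlgebra.singleZeroRingHom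

theorem toricMap_str {σ τ : PointedCone ℝ (Fin n → ℝ)} (h : σ ≤ τ) :
    (toricMap k h).comp (toricStr k τ) = toricStr k σ :=
  RingHom.ext fun c => toricMap_single k h 0 c

/-- The structure morphism of the toric variety over `k`. -/
def toricToSpec (Δ : Fan n) : toricVariety k Δ ⟶ AlgebraicGeometry.Spec (.of k) :=
  Limits.colimit.desc (toricDiagram k Δ)
    { pt := AlgebraicGeometry.Spec (.of k)
      ι :=
        { app := fun τ => Spec.map (CommRingCat.ofHom (toricStr k τ.1))
          naturality := fun σ τ h => by
            refine Eq.trans ?_ (Category.comp_id _).symm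
            refine (Spec.map_comp _ _).symm.trans ?_
            exact congrArg (fun f => Spec.map (CommRingCat.ofHom f))
              (toricMap_str k (show σ.1 ≤ τ.1 from leOfHom h)) } }

theorem toricChart_toSpec (Δ : Fan n) (τ : Δ.cones) :
    toricChart k Δ τ ≫ toricToSpec k Δ = Spec.map (CommRingCat.ofHom (toricStr k τ.1)) :=
  Limits.colimit.ι_desc _ _

theorem le_preimage_top {X Y : Scheme.{u}} (f : X ⟶ Y) (U : X.Opens) : U ≤ f ⁻¹ᵁ ⊤ :=
  fun _ _ => trivial

/-- The affine open subset of the toric variety that corresponds to a cone. -/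
def toricOpen (Δ : Fan n) (τ : Δ.cones) : (toricVariety k Δ).Opens := toricChart k Δ τ ''ᵁ ⊤

theorem mem_toricOpen (Δ : Fan n) (τ : Δ.cones) (x : toricVariety k Δ) :
    x ∈ toricOpen k Δ τ ↔ ∃ y, toricChart k Δ τ y = x := by
  change x ∈ (toricChart k Δ τ ''ᵁ ⊤ : (toricVariety k Δ).Opens) ↔ _
  rw [Scheme.Hom.image_top_eq_opensRange]
  rfl

theorem toricOpen_mono (Δ : Fan n) {σ τ : Δ.cones} (h : σ ≤ τ) :
    toricOpen k Δ σ ≤ toricOpen k Δ τ := by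
  intro x hx
  obtain ⟨y, rfl⟩ := (mem_toricOpen k Δ σ x).1 hx
  refine (mem_toricOpen k Δ τ _).2
    ⟨Spec.map (CommRingCat.ofHom (toricMap k (show σ.1 ≤ τ.1 from h))) y, ?_⟩
  rw [← toricMap_toricChart k Δ h]
  rfl

/-- The identification of `k[τ^∨ ∩ ℤⁿ]` with the ring of functions on the affine open subset of the
toric variety that corresponds to `τ`. -/
def toricΓ (Δ : Fan n) (τ : Δ.cones) :
    CommRingCat.of (ToricRing k τ.1) ⟶ Γ(toricVariety k Δ, toricOpen k Δ τ) :=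
  (Scheme.ΓSpecIso (.of (ToricRing k τ.1))).inv ≫ ((toricChart k Δ τ).appIso ⊤).inv

theorem toricΓ_appLE (Δ : Fan n) (τ : Δ.cones) (h : ⊤ ≤ toricChart k Δ τ ⁻¹ᵁ toricOpen k Δ τ) :
    toricΓ k Δ τ ≫ (toricChart k Δ τ).appLE (toricOpen k Δ τ) ⊤ h =
      (Scheme.ΓSpecIso (.of (ToricRing k τ.1))).inv := by
  refine (Category.assoc _ _ _).trans ?_
  refine (congrArg (_ ≫ ·) (Scheme.Hom.appIso_inv_appLE (toricChart k Δ τ) (U := ⊤) h)).trans ?_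
  have : (homOfLE (le_refl (⊤ : (AlgebraicGeometry.Spec (.of (ToricRing k τ.1))).Opens))).op = 𝟙 _ :=
    rfl
  refine (congrArg (_ ≫ ·) ((congrArg _ this).trans (CategoryTheory.Functor.map_id _ _))).trans ?_
  exact Category.comp_id _

theorem toricChart_cancel (Δ : Fan n) (τ : Δ.cones) {R : CommRingCat.{u}}
    (h : ⊤ ≤ toricChart k Δ τ ⁻¹ᵁ toricOpen k Δ τ) {f g : R ⟶ Γ(toricVariety k Δ, toricOpen k Δ τ)}
    (e : f ≫ (toricChart k Δ τ).appLE (toricOpen k Δ τ) ⊤ h =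
      g ≫ (toricChart k Δ τ).appLE (toricOpen k Δ τ) ⊤ h) : f = g := by
  have h1 : (toricChart k Δ τ).appLE (toricOpen k Δ τ) ⊤ h = ((toricChart k Δ τ).appIso ⊤).hom :=
    (Scheme.Hom.appIso_hom' (toricChart k Δ τ) ⊤).symm
  rw [h1] at e
  exact (cancel_mono ((toricChart k Δ τ).appIso ⊤).hom).1 e

theorem toricOpen_top (Δ : Fan n) (τ : Δ.cones) :
    ⊤ ≤ toricChart k Δ τ ⁻¹ᵁ toricOpen k Δ τ := fun y _ =>
  (mem_toricOpen k Δ τ _).2 ⟨y, rfl⟩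

theorem toricΓ_res (Δ : Fan n) {σ τ : Δ.cones} (h : σ ≤ τ) :
    toricΓ k Δ τ ≫ (toricVariety k Δ).presheaf.map (homOfLE (toricOpen_mono k Δ h)).op =
      CommRingCat.ofHom (toricMap k (show σ.1 ≤ τ.1 from h)) ≫ toricΓ k Δ σ := by
  refine toricChart_cancel k Δ σ (toricOpen_top k Δ σ) ?_
  rw [Category.assoc, Category.assoc, toricΓ_appLE, Scheme.Hom.map_appLE]
  have key : ∀ (f : AlgebraicGeometry.Spec (.of (ToricRing k σ.1)) ⟶ toricVariety k Δ)
      (_ : f = toricChart k Δ σ) (h1 : ⊤ ≤ f ⁻¹ᵁ toricOpen k Δ τ)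
      (h2 : ⊤ ≤ toricChart k Δ σ ⁻¹ᵁ toricOpen k Δ τ),
      (toricChart k Δ σ).appLE (toricOpen k Δ τ) ⊤ h2 = f.appLE (toricOpen k Δ τ) ⊤ h1 := by
    rintro _ rfl _ _
    rfl
  have h1 : ⊤ ≤ (Spec.map (CommRingCat.ofHom (toricMap k (show σ.1 ≤ τ.1 from h))) ≫
      toricChart k Δ τ) ⁻¹ᵁ toricOpen k Δ τ := fun y _ => toricOpen_top k Δ τ trivial
  rw [key _ (toricMap_toricChart k Δ h) h1,
    ← Scheme.Hom.appLE_comp_appLE _ _ _ ⊤ _ (toricOpen_top k Δ τ)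
      (le_preimage_top _ _), ← Category.assoc, toricΓ_appLE, Scheme.ΓSpecIso_inv_naturality]
  exact congrArg _ (Scheme.Hom.appLE_eq_app _)

theorem toricΓ_str (Δ : Fan n) (τ : Δ.cones) :
    CommRingCat.ofHom (toricStr k τ.1) ≫ toricΓ k Δ τ =
      (Scheme.ΓSpecIso (.of k)).inv ≫ (toricToSpec k Δ).appLE ⊤ (toricOpen k Δ τ) (le_preimage_top _ _) := by
  refine toricChart_cancel k Δ τ (toricOpen_top k Δ τ) ?_
  rw [Category.assoc, Category.assoc, toricΓ_appLE, Scheme.ΓSpecIso_inv_naturality,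
    Scheme.Hom.appLE_comp_appLE]
  have key : ∀ (f : AlgebraicGeometry.Spec (.of (ToricRing k τ.1)) ⟶ AlgebraicGeometry.Spec (.of k))
      (_ : f = Spec.map (CommRingCat.ofHom (toricStr k τ.1))) (h1 : ⊤ ≤ f ⁻¹ᵁ ⊤),
      (Spec.map (CommRingCat.ofHom (toricStr k τ.1))).appTop = f.appLE ⊤ ⊤ h1 := by
    rintro _ rfl _
    exact (Scheme.Hom.appLE_eq_app _).symm
  rw [key _ (toricChart_toSpec k Δ τ) (le_preimage_top _ _)]

section Subscheme

variable {k} {Δ : Fan n} {Y : Scheme.{u}} (ι : Y ⟶ toricVariety k Δ)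

/-- The intersection of `Y` with the affine toric variety of a cone. -/
def subOpen (τ : Δ.cones) : Y.Opens := ι ⁻¹ᵁ toricOpen k Δ τ

/-- The homomorphism `π : k[τ^∨ ∩ ℤⁿ] → ΓY_τ`. -/
def subΓ (τ : Δ.cones) : ToricRing k τ.1 →+* Γ(Y, subOpen ι τ) :=
  (toricΓ k Δ τ ≫ ι.app (toricOpen k Δ τ)).hom

theorem subOpen_mono {σ τ : Δ.cones} (h : σ ≤ τ) : subOpen ι σ ≤ subOpen ι τ := fun _ hx =>
  toricOpen_mono k Δ h hx

theorem resHom_subΓ {σ τ : Δ.cones} (h : σ ≤ τ) (a : ToricRing k τ.1) :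
    resHom Y (subOpen_mono ι h) (subΓ ι τ a) =
      subΓ ι σ (toricMap k (show σ.1 ≤ τ.1 from h) a) := by
  have e : (toricΓ k Δ τ ≫ ι.app (toricOpen k Δ τ)) ≫
      Y.presheaf.map (homOfLE (subOpen_mono ι h)).op =
      CommRingCat.ofHom (toricMap k (show σ.1 ≤ τ.1 from h)) ≫
        (toricΓ k Δ σ ≫ ι.app (toricOpen k Δ σ)) := by
    rw [← Category.assoc (CommRingCat.ofHom _), ← toricΓ_res k Δ h, Category.assoc, Category.assoc]
    exact congrArg _ (ι.naturality (homOfLE (toricOpen_mono k Δ h)).op).symm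
  exact congrArg (fun f => f.hom a) e

theorem subΓ_str (τ : Δ.cones) (c : k) :
    subΓ ι τ (toricStr k τ.1 c) = kstr (ι ≫ toricToSpec k Δ) (subOpen ι τ) c := by
  have e : CommRingCat.ofHom (toricStr k τ.1) ≫ (toricΓ k Δ τ ≫ ι.app (toricOpen k Δ τ)) =
      (Scheme.ΓSpecIso (.of k)).inv ≫ (ι ≫ toricToSpec k Δ).appTop ≫
        Y.presheaf.map (homOfLE le_top).op := by
    rw [← Category.assoc, toricΓ_str, Category.assoc, Scheme.Hom.app_eq_appLE,
      Scheme.Hom.appLE_comp_appLE]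
    rfl
  exact congrArg (fun f => f.hom c) e

/-- The affine presentation of a closed subscheme `Y` of a toric variety by the affine opens `Y_τ`. -/
def toricPresentation [IsClosedImmersion ι] : AffinePresentation Y Δ.cones where
  U := subOpen ι
  isAffineOpen τ := by
    refine IsAffineOpen.preimage ?_ ι
    change IsAffineOpen (toricChart k Δ τ ''ᵁ ⊤)
    rw [Scheme.Hom.image_top_eq_opensRange]
    exact isAffineOpen_opensRange _
  mono h := subOpen_mono ι h
  connected x i j := by
    obtain ⟨a, ha⟩ := (mem_toricOpen k Δ i.1 (ι x)).1 i.2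
    obtain ⟨b, hb⟩ := (mem_toricOpen k Δ j.1 (ι x)).1 j.2
    obtain ⟨l, fi, fj, z, hz, -⟩ := (Scheme.IsLocallyDirected.ι_eq_ι_iff (toricDiagram k Δ)).1
      (ha.trans hb.symm)
    have hl : x ∈ subOpen ι l := by
      refine (mem_toricOpen k Δ l (ι x)).2 ⟨z, ?_⟩
      rw [← toricMap_toricChart k Δ (leOfHom fi), ← ha, ← hz]
      rfl
    exact (Relation.EqvGen.symm _ _ (.rel ⟨l, hl⟩ i (leOfHom fi))).trans _ _ _
      (.rel ⟨l, hl⟩ j (leOfHom fj))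
  covers x := by
    obtain ⟨τ, y, hy⟩ := Scheme.IsLocallyDirected.ι_jointly_surjective (toricDiagram k Δ) (ι x)
    exact ⟨τ, (mem_toricOpen k Δ τ (ι x)).2 ⟨y, hy⟩⟩

end Subscheme

/-! ## Kajiwara-Payne tropicalizations -/

/-- The monoid with zero `A_τ` that results from writing `τ^∨ ∩ ℤⁿ` multiplicatively and adjoining an
element `0`. -/
abbrev ToricMonoid (τ : PointedCone ℝ (Fin n → ℝ)) : Type :=
  WithZero (Multiplicative (dualMonoid τ))

/-- The map `A_τ → A_σ` for `σ ⊆ τ`. -/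
def toricMonoidMap {σ τ : PointedCone ℝ (Fin n → ℝ)} (h : σ ≤ τ) :
    ToricMonoid τ →*₀ ToricMonoid σ :=
  WithZero.map' (AddMonoidHom.toMultiplicative (AddSubmonoid.inclusion (dualMonoid_anti h)))

/-- The inclusion of `A_τ` into the algebra `k[τ^∨ ∩ ℤⁿ]`. -/
def toricMonomial (τ : PointedCone ℝ (Fin n → ℝ)) : ToricMonoid τ →*₀ ToricRing k τ :=
  WithZero.lift' (AddMonoidAlgebra.of k (dualMonoid τ))

theorem toricMap_monomial {σ τ : PointedCone ℝ (Fin n → ℝ)} (h : σ ≤ τ) (a : ToricMonoid τ) :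
    toricMap k h (toricMonomial k τ a) = toricMonomial k σ (toricMonoidMap h a) := by
  induction a using WithZero.recZeroCoe with
  | zero => simp
  | coe a => exact toricMap_single k h _ _

/-- The tropicalization of the affine toric variety of a cone: the multiplicative maps
`A_τ → 𝕋`. -/
def AffTrop (τ : PointedCone ℝ (Fin n → ℝ)) : Type := ToricMonoid τ →*₀ ℝ≥0

/-- The coarsest topology for which all evaluation maps are continuous. -/
instance (τ : PointedCone ℝ (Fin n → ℝ)) : TopologicalSpace (AffTrop τ) :=
  TopologicalSpace.induced (fun (p : ToricMonoid τ →*₀ ℝ≥0) a => p a)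
    (inferInstance : TopologicalSpace (ToricMonoid τ → ℝ≥0))

/-- The map `Hom(A_σ, 𝕋) → Hom(A_τ, 𝕋)` for `σ ⊆ τ`. -/
def AffTrop.map {σ τ : PointedCone ℝ (Fin n → ℝ)} (h : σ ≤ τ) (p : AffTrop σ) : AffTrop τ :=
  MonoidWithZeroHom.comp p (toricMonoidMap h)

/-- The Kajiwara-Payne tropicalization of the toric variety of a fan: the colimit of the topological
spaces `Hom(A_τ, 𝕋)`. -/
def TropToric (Δ : Fan n) : Type :=
  Quot fun p q : Σ τ : Δ.cones, AffTrop τ.1 =>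
    ∃ h : p.1 ≤ q.1, AffTrop.map (show p.1.1 ≤ q.1.1 from h) p.2 = q.2

instance (Δ : Fan n) : TopologicalSpace (TropToric Δ) := inferInstanceAs (TopologicalSpace (Quot _))

section Subscheme

variable {k} {Δ : Fan n} {Y : Scheme.{u}} (ι : Y ⟶ toricVariety k Δ) (v : Valuation k ℝ≥0)

/-- The tropicalization map on the affine piece of a cone. It restricts a valuation `w` on `ΓY_τ`
to the map `A_τ → 𝕋`, `a ↦ w(π(a))`. -/
def affTrop (τ : Δ.cones) (w : AffAn (ι ≫ toricToSpec k Δ) v (subOpen ι τ)) : AffTrop τ.1 :=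
  (w.1.toMonoidWithZeroHom.comp (subΓ ι τ).toMonoidWithZeroHom).comp (toricMonomial k τ.1)

/-- The Kajiwara-Payne tropicalization map from the Berkovich space of the closed subscheme `Y` of
a toric variety to the tropicalization of the toric variety. -/
def trop [IsClosedImmersion ι] : Berk (ι ≫ toricToSpec k Δ) v (toricPresentation ι) → TropToric Δ :=
  Quot.map (fun p => ⟨p.1, affTrop ι v p.1 p.2⟩) (by
    rintro ⟨σ, w⟩ ⟨τ, w'⟩ ⟨h, hw⟩
    refine ⟨h, ?_⟩
    refine Eq.trans ?_ (congrArg (affTrop ι v τ) hw)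
    refine MonoidWithZeroHom.ext fun a => ?_
    refine (congrArg w.1 ?_)
    change subΓ ι σ (toricMonomial k σ.1 (toricMonoidMap _ a)) =
      resHom Y _ (subΓ ι τ (toricMonomial k τ.1 a))
    rw [resHom_subΓ ι h, toricMap_monomial])

/-- The Kajiwara-Payne tropicalization of `Y`: the image of the tropicalization map, with the
subspace topology. -/
abbrev TropKP [IsClosedImmersion ι] : Type := Set.range (trop ι v)

/-! ### The blue model -/

/-- The multiplicative map `k × A_τ → ΓY_τ`, `(c, a) ↦ π(c a)`. -/
def blueHom (τ : Δ.cones) : k × ToricMonoid τ.1 →*₀ Γ(Y, subOpen ι τ) where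
  toFun p := subΓ ι τ (toricStr k τ.1 p.1 * toricMonomial k τ.1 p.2)
  map_zero' := by simp
  map_one' := by simp
  map_mul' p q := by
    simp only [Prod.fst_mul, Prod.snd_mul, map_mul]
    ring

/-- The underlying monoid of the blue model: all elements of `ΓY_τ` of the form `π(c a)` with
`c ∈ k` and `a ∈ A_τ`. -/
abbrev blueMonoid (τ : Δ.cones) : Submonoid Γ(Y, subOpen ι τ) := MonoidHom.mrange (blueHom ι τ)

/-- The inclusion of the underlying monoid into `ΓY_τ`. -/
def blueIncl (τ : Δ.cones) : blueMonoid ι τ →*₀ (OBlp.ofSemiring Γ(Y, subOpen ι τ)).carrier where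
  toFun a := a.1
  map_zero' := rfl
  map_one' := rfl
  map_mul' _ _ := rfl

/-- The blueprint `B_τ` with the underlying monoid `{π(c a)}`, whose relations are all the relations
`∑ aᵢ = ∑ bⱼ` that hold in `ΓY_τ`. -/
def blueAlg (τ : Δ.cones) : OBlp.{u} :=
  OBlp.induced (blueMonoid ι τ) (fun _ : Unit => OBlp.ofSemiring Γ(Y, subOpen ι τ))
    (fun _ => blueIncl ι τ) (fun _ _ h => Subtype.ext (h ()))

/-- The inclusion `B_τ → ΓY_τ`. -/
def blueToScheme (τ : Δ.cones) : OBlp.Hom (blueAlg ι τ) (OBlp.ofSemiring Γ(Y, subOpen ι τ)) where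
  __ := blueIncl ι τ
  map_rel h := h ()

theorem resHom_blueHom {σ τ : Δ.cones} (h : σ ≤ τ) (p : k × ToricMonoid τ.1) :
    resHom Y (subOpen_mono ι h) (blueHom ι τ p) =
      blueHom ι σ (p.1, toricMonoidMap (show σ.1 ≤ τ.1 from h) p.2) := by
  refine (resHom_subΓ ι h _).trans ?_
  rw [map_mul, toricMap_monomial]
  refine congrArg (fun x => subΓ ι σ (x * _)) ?_
  exact RingHom.congr_fun (toricMap_str k (show σ.1 ≤ τ.1 from h)) p.1

theorem kstr_mem_blueMonoid (τ : Δ.cones) (c : k) :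
    kstr (ι ≫ toricToSpec k Δ) (subOpen ι τ) c ∈ blueMonoid ι τ := by
  refine ⟨(c, 1), ?_⟩
  change subΓ ι τ (toricStr k τ.1 c * toricMonomial k τ.1 1) = _
  rw [map_one, mul_one, subΓ_str]

/-- The blue model `Z` of `Y`, given as the diagram of the blueprints `B_τ`. -/
def blueDiag : AlgDiag.{u} (OBlp.ofSemiring k) Δ.cones where
  obj τ := blueAlg ι τ
  str τ :=
    { toFun := fun c => ⟨kstr (ι ≫ toricToSpec k Δ) (subOpen ι τ) c, kstr_mem_blueMonoid ι τ c⟩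
      map_zero' := Subtype.ext (map_zero (kstr (ι ≫ toricToSpec k Δ) (subOpen ι τ)))
      map_one' := Subtype.ext (map_one (kstr (ι ≫ toricToSpec k Δ) (subOpen ι τ)))
      map_mul' := fun a b =>
        Subtype.ext (map_mul (kstr (ι ≫ toricToSpec k Δ) (subOpen ι τ)) a b)
      map_rel := fun {s t} h _ => by
        refine (congrArg₂ _ ?_ ?_).mpr
          ((OBlp.Hom.ofRingHom (kstr (ι ≫ toricToSpec k Δ) (subOpen ι τ))).rel h)
        · exact Multiset.map_map _ _ _
        · exact Multiset.map_map _ _ _ }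
  map σ τ h :=
    { toFun := fun a => ⟨resHom Y (subOpen_mono ι h) a.1, by
        obtain ⟨p, hp⟩ := a.2
        exact ⟨_, (resHom_blueHom ι h p).symm.trans (congrArg _ hp)⟩⟩
      map_zero' := Subtype.ext (map_zero (resHom Y (subOpen_mono ι h)))
      map_one' := Subtype.ext (map_one (resHom Y (subOpen_mono ι h)))
      map_mul' := fun a b => Subtype.ext (map_mul (resHom Y (subOpen_mono ι h)) a.1 b.1)
      map_rel := fun {s t} hst _ => by
        refine (congrArg₂ _ ?_ ?_).mpr
          ((OBlp.Hom.ofRingHom (resHom Y (subOpen_mono ι h))).rel (hst ()))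
        · refine (Multiset.map_map _ _ _).trans ?_
          symm
          exact Multiset.map_map _ _ _
        · refine (Multiset.map_map _ _ _).trans ?_
          symm
          exact Multiset.map_map _ _ _ }
  map_id _ _ := Subtype.ext (resHom_refl _ _ _)
  map_map _ _ _ _ _ _ := Subtype.ext (resHom_resHom _ _ _)
  map_str _ _ h a := Subtype.ext
    (resHom_kstr (ι ≫ toricToSpec k Δ) (subOpen_mono ι h) (show k from a))

/-- The morphism `β : Y → Z`, given by the inclusions `B_τ → ΓY_τ`. -/
def blueβ [IsClosedImmersion ι] :
    AlgDiag.Hom (blueDiag ι) (schemeDiag (ι ≫ toricToSpec k Δ) (toricPresentation ι)) where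
  app τ := blueToScheme ι τ
  app_map _ _ _ _ := rfl
  app_str _ _ := rfl

end Subscheme

end Toric

end

end BlueTrop

/-!
A morphism `Spec 𝕋 → Spec C` over `𝕋` is determined by the values of the elements of `C`: the ordered
blueprint `𝕋` is a field whose only prime `k`-ideal is `{0}`, so that sections over neighbourhoods of
the image point are fractions, with values that are quotients. The main difficulty is global: the space
`colim Spec D_j` is a colimit of spaces with a sheaf, and a priori it is not clear that its charts are
open or that a `𝕋`-rational point factors through one of them.

Both hold for the bends that occur here. Suppose that `U_j` contains a principal open `D(s)` of `U_i`.
Then functions on the chart `j` are fractions `c / s ^ n` of functions on the chart `i`, and this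
persists for the bends, where it describes the germs in the chart `i` of functions on the chart `j`.
These gluing data (`Glued`) make the charts open, and extend functions on a chart to sections of the
colimit over this chart. Hence a rational point whose image lies in a chart factors through it
(`Glued.point_ofPoint`), the charts inject into the rational points, and their images are open for the
fine topology, because values of sections vary continuously on every affine space of rational points
(`Glued.isOpenMap_point`). So the space of rational points is the colimit of the spaces of rational
points of the charts (`Glued.exists_homeomorph`). The gluing data exist for every blue model
(`BlueModel.glued`) once the overlaps are known to be overlaps in the colimit. For a scheme a prime of
the bend of `ΓU_j` lies over a point of `U_j`, because its elements from `ΓU_j` form a prime ideal, and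
the zigzags of an affine presentation apply (`schemeGlued`). For the blue model of a toric subscheme
the overlaps are given by common faces, which are cut out by monomials (`toricGlued`).

A rational point of the bend of `ΓU_j` is the same as a valuation on `ΓU_j` (`affAnHomeomorph`): the
bend relation for the sum of `a` and `b` is the ultrametric inequality for `a + b`. This gives the
first part.

For the second part, a rational point of the bend of `B_τ` is determined by its restriction to the
monomials `A_τ`, since `B_τ` is generated by these and by scalars. In the tropical toric variety the
charts are open and two of them meet in the chart of a common face (`TropToric.isOpenMap_mk`,
`TropToric.exists_of_mk_eq`), and therefore the rational points of the bend of the blue model are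
embedded in it (`isEmbedding_colimTrop`). The image is that of the Berkovich space, since every rational
point of the bend of `B_τ` comes from a valuation on `ΓY_τ` (`blueTPts_surjective`). Indeed it is a
multiplicative map `w` on a multiplicative submonoid that spans the ring, and it satisfies
`w b ≤ max w(b_j)` whenever `b = ∑ b_j`. Then `x ↦ inf max w(b_j)`, over all representations
`x = ∑ b_j`, is a nonarchimedean submultiplicative function that extends `w`, and a minimal one among
all such functions is multiplicative (`exists_valuation_extension`).
-/

namespace BlueTrop

namespace OBlp

/-! ### The spectrum of the tropical numbers -/

/-- The nonnegative real number that underlies a tropical number. -/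
abbrev nn (x : tropical.carrier) : ℝ≥0 := x

/-- The evaluation `a / x ↦ a x⁻¹` of fractions, for a morphism `f` to the tropical numbers and a
multiplicative set on which `f` does not vanish. -/
noncomputable def locEval {B : OBlp.{u}} (f : Hom B tropical) (S : Submonoid B.carrier)
    (hS : ∀ x ∈ S, nn (f x) ≠ 0) : Hom (B.loc S) tropical where
  toFun p := Localization.liftOn p (fun a x => (nn (f a)) / (nn (f x))) (by
    intro a b x y hr
    rw [Localization.r_iff_exists] at hr
    obtain ⟨r, hr⟩ := hr
    have h := congrArg f hr
    simp only [map_mul] at h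
    have h' := mul_left_cancel₀ (M₀ := ℝ≥0) (hS _ r.2) h
    refine (div_eq_div_iff (G₀ := ℝ≥0) (hS _ x.2) (hS _ y.2)).2 ?_
    exact (mul_comm (G := ℝ≥0) _ _).trans (h'.trans (mul_comm (G := ℝ≥0) _ _)))
  map_zero' := by
    rw [← frac_zero]
    change (nn (f 0)) / (nn (f 1)) = 0
    rw [map_zero]
    exact zero_div _
  map_one' := by
    rw [← frac_one]
    change (nn (f 1)) / (nn (f 1)) = 1
    rw [map_one]
    exact div_self (one_ne_zero (α := ℝ≥0))
  map_mul' p q := by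
    obtain ⟨a, x, rfl⟩ := frac_surj p
    obtain ⟨b, y, rfl⟩ := frac_surj q
    rw [frac_mul]
    change (nn (f (a * b))) / (nn (f (x * y))) =
      ((nn (f a)) / (nn (f x))) * ((nn (f b)) / (nn (f y)))
    rw [map_mul, map_mul]
    exact mul_div_mul_comm (α := ℝ≥0) _ _ _ _
  map_rel := by
    rintro _ _ ⟨x, a, b, hab, rfl, rfl⟩
    have h := tropical.rel_smul ((nn (f x))⁻¹ : ℝ≥0) (f.rel hab)
    refine (congrArg₂ _ ?_ ?_).mpr h <;>
    · refine (Multiset.map_map _ _ _).trans (Eq.trans ?_ (Multiset.map_map _ _ _).symm)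
      refine Multiset.map_congr rfl fun c _ => ?_
      exact div_eq_inv_mul (α := ℝ≥0) _ _

/-- The prime `k`-ideal `{0}` of the tropical numbers. -/
def tropPt : PrimeK tropical where
  carrier := {0}
  zero_mem := rfl
  mul_mem {a} b h := by
    obtain rfl : a = 0 := h
    exact mul_zero b
  mem_of_rel {c s t} hs ht h _ := by
    have key : ∀ (c : ℝ≥0) (s t : Multiset ℝ≥0), (∀ b ∈ t, b = 0) → (c ::ₘ s).sup = t.sup → c = 0 := by
      intro c s t ht h
      have h2 : t.sup ≤ 0 := Multiset.sup_le.2 fun b hb => (ht b hb).le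
      have h3 : c ≤ (c ::ₘ s).sup := Multiset.le_sup (Multiset.mem_cons_self c s)
      exact le_antisymm (h3.trans (h.trans_le h2)) zero_le
    exact key c s t ht h
  one_notMem h := one_ne_zero (α := ℝ≥0) h
  mem_or_mem h := mul_eq_zero (M₀ := ℝ≥0).1 h

/-- Nonzero tropical numbers are invertible, so that `Spec 𝕋` has only one point. -/
theorem eq_tropPt (p : PrimeK tropical) : p = tropPt := by
  refine PrimeK.ext (Set.ext fun a => ⟨fun ha => ?_, ?_⟩)
  · by_contra h
    have h' : (nn a) ≠ 0 := h
    have := p.mul_mem ((nn a)⁻¹ : ℝ≥0) ha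
    exact p.one_notMem ((inv_mul_cancel₀ h').symm ▸ this)
  · rintro rfl
    exact p.zero_mem

/-- The value in `𝕋` of a section over `Spec 𝕋`. -/
noncomputable def tropVal (U : Opens (PrimeK tropical)) (hU : tropPt ∈ U) :
    Hom (specSec tropical U) tropical :=
  (locEval (Hom.id tropical) tropPt.compl fun _ h => h).comp
    { __ := specEv tropical U ⟨tropPt, hU⟩
      map_rel := fun h => h ⟨tropPt, hU⟩ }

/-- Sections over a neighbourhood of the only point of `Spec 𝕋` are determined by their value. -/
theorem tropVal_injective (U : Opens (PrimeK tropical)) (hU : tropPt ∈ U) :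
    Function.Injective (tropVal U hU) := by
  intro s t h
  have hloc : Function.Injective (locEval (Hom.id tropical) tropPt.compl fun _ h => h) := by
    intro p q h
    obtain ⟨a, x, rfl⟩ := frac_surj p
    obtain ⟨b, y, rfl⟩ := frac_surj q
    have h' : (nn a) / (nn x.1) = (nn b) / (nn y.1) := h
    rw [div_eq_div_iff (show nn x.1 ≠ 0 from x.2)
      (show nn y.1 ≠ 0 from y.2)] at h'
    refine frac_eq.2 ⟨1, congrArg _ ?_⟩
    exact (mul_comm (G := ℝ≥0) _ _).trans (h'.trans (mul_comm (G := ℝ≥0) _ _))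
  refine Subtype.ext (funext fun ⟨p, hp⟩ => ?_)
  obtain rfl := eq_tropPt p
  exact hloc h

theorem tropVal_toΓ (t : tropical.carrier) : tropVal ⊤ trivial (toΓ tropical t) = t :=
  div_one (G := ℝ≥0) _

theorem toΓ_tropVal (s : (Spec tropical).sec ⊤) : toΓ tropical (tropVal ⊤ trivial s) = s :=
  tropVal_injective _ _ (tropVal_toΓ _)

theorem isUnit_of_tropVal_ne_zero (U : Opens (PrimeK tropical)) (hU : tropPt ∈ U)
    (s : (Spec tropical).sec U) (h : nn (tropVal U hU s) ≠ 0) : IsUnit s := by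
  obtain rfl : U = ⊤ := by
    ext p
    rw [eq_tropPt p]
    exact ⟨fun _ => trivial, fun _ => hU⟩
  rw [← toΓ_tropVal s]
  exact IsUnit.map (toΓ tropical) (isUnit_iff_ne_zero (G₀ := ℝ≥0).2 h)

end OBlp

namespace OBSpace

open OBlp

variable {Y : OBSpace.{u₁}} {Z : OBSpace.{u₂}}

/-- The value `φ^#(s) ∈ 𝕋` of a section `s` over a neighbourhood of the image of
`φ : Spec 𝕋 → Y`. -/
noncomputable def evalAt (φ : Hom (Spec tropical) Y) (V : Opens Y) (h : φ.toFun tropPt ∈ V) :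
    OBlp.Hom (Y.sec V) tropical :=
  (tropVal ⊤ trivial).comp (φ.app V ⊤ fun x _ => (eq_tropPt x).symm ▸ h)

theorem evalAt_res (φ : Hom (Spec tropical) Y) {V V' : Opens Y} (hV : V' ≤ V)
    (h : φ.toFun tropPt ∈ V') (s : Y.sec V) :
    evalAt φ V' h (Y.res hV s) = evalAt φ V (hV h) s :=
  congrArg (tropVal ⊤ trivial) (φ.app_restrict' hV _ _ _ s)

theorem evalAt_comp (α : Hom Y Z) (φ : Hom (Spec tropical) Y) (W : Opens Z)
    (h : (α.comp φ).toFun tropPt ∈ W) (V : Opens Y) (hV : φ.toFun tropPt ∈ V)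
    (hα : ∀ x ∈ V, α.toFun x ∈ W) (s : Z.sec W) :
    evalAt (α.comp φ) W h s = evalAt φ V hV (α.app W V hα s) :=
  congrArg (tropVal ⊤ trivial) (α.comp_app φ W ⊤ V _ _ _ s)

theorem evalAt_congr {φ ψ : Hom (Spec tropical) Y} (e : φ = ψ) (V : Opens Y)
    (h : φ.toFun tropPt ∈ V) (h' : ψ.toFun tropPt ∈ V) (s : Y.sec V) :
    evalAt φ V h s = evalAt ψ V h' s := by
  subst e
  rfl

/-- Locality of `φ`, in terms of values. -/
theorem evalAt_ne_zero_iff (φ : Hom (Spec tropical) Y) (V : Opens Y) (h : φ.toFun tropPt ∈ V)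
    (s : Y.sec V) :
    nn (evalAt φ V h s) ≠ 0 ↔ UnitAt Y s (φ.toFun tropPt) := by
  constructor
  · intro hs
    obtain ⟨V', hV', hx, hu⟩ := φ.isLocal V ⊤ (fun x _ => (eq_tropPt x).symm ▸ h) s
      (isUnit_of_tropVal_ne_zero _ _ _ hs) tropPt trivial
    exact ⟨V', hV', hx, hu⟩
  · rintro ⟨V', hV', hx, hu⟩
    have := IsUnit.ne_zero (M₀ := ℝ≥0) (hu.map (evalAt φ V' hx))
    rwa [evalAt_res] at this

/-- A morphism from `Spec 𝕋` is determined by its image point and the values of sections. -/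
theorem hom_trop_ext {φ ψ : Hom (Spec tropical) Y} (h : φ.toFun tropPt = ψ.toFun tropPt)
    (h' : ∀ V (hφ : φ.toFun tropPt ∈ V) (hψ : ψ.toFun tropPt ∈ V) (s : Y.sec V),
      evalAt φ V hφ s = evalAt ψ V hψ s) : φ = ψ := by
  refine Hom.ext (fun x => by rw [eq_tropPt x, h]) fun V U hφ hψ s => ?_
  by_cases hU : tropPt ∈ U
  · refine tropVal_injective U hU ?_
    have e := h' V (hφ _ hU) (hψ _ hU) s
    have hle : U ≤ ⊤ := fun _ _ => trivial
    rw [φ.app_restrict V hle (fun x _ => (eq_tropPt x).symm ▸ hφ _ hU) hφ s,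
      ψ.app_restrict V hle (fun x _ => (eq_tropPt x).symm ▸ hψ _ hU) hψ s]
    exact e
  · refine Subtype.ext (funext fun ⟨p, hp⟩ => absurd (eq_tropPt p ▸ hp) hU)

end OBSpace

namespace OBlp

open OBSpace

variable {C : OBlp.{u}}

/-- Near a prime, a section over an open subset of a spectrum is a fraction. -/
theorem exists_frac (V : Opens (PrimeK C)) (s : (Spec C).sec V) (p : PrimeK C) (hp : p ∈ V) :
    ∃ a h : C.carrier, ∃ (hV : PrimeK.basic h ≤ V), h ∉ p.carrier ∧
      (Spec C).res (show PrimeK.basic h ≤ (⊤ : Opens (PrimeK C)) from le_top) (toΓ C h) *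
          (Spec C).res hV s =
        (Spec C).res (show PrimeK.basic h ≤ (⊤ : Opens (PrimeK C)) from le_top) (toΓ C a) := by
  obtain ⟨a, h, hh, e⟩ := s.2 ⟨p, hp⟩
  obtain ⟨g, hg, hgV⟩ := PrimeK.exists_basic_le V p hp
  have h1 : ∀ q : PrimeK C, g * h ∉ q.carrier → g ∉ q.carrier := fun q hq hh =>
    hq (mul_comm h g ▸ q.mul_mem h hh)
  have h2 : ∀ q : PrimeK C, g * h ∉ q.carrier → h ∉ q.carrier := fun q hq hh => hq (q.mul_mem g hh)
  refine ⟨g * a, g * h, fun q hq => hgV q (h1 q hq), p.compl.mul_mem hg hh, ?_⟩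
  refine Subtype.ext (funext fun q => ?_)
  have e' := e ⟨q.1, hgV q.1 (h1 q.1 q.2)⟩ (h2 q.1 q.2)
  change C.frac q.1.compl (g * h) 1 * s.1 ⟨q.1, _⟩ = C.frac q.1.compl (g * a) 1
  rw [e', frac_mul]
  refine frac_eq.2 ⟨1, ?_⟩
  simp only [Submonoid.coe_one, one_mul]
  simp only [mul_comm, mul_left_comm]

theorem unitAt_toΓ_iff (a : C.carrier) (p : PrimeK C) :
    UnitAt (Spec C) (toΓ C a) p ↔ a ∉ p.carrier := by
  constructor
  · rintro ⟨V, hV, hp, hu⟩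
    exact p.notMem_of_isUnit (x := 1) (hu.map (specEv C V ⟨p, hp⟩))
  · intro ha
    refine ⟨PrimeK.basic a, fun _ _ => trivial, ha, IsUnit.of_mul_eq_one (⟨fun q =>
      C.frac q.1.compl 1 ⟨a, q.2⟩, fun q => ⟨1, a, q.2, fun _ _ => rfl⟩⟩ :
        specSub C (PrimeK.basic a)) (Subtype.ext (funext fun q => ?_))⟩
    refine (frac_mul _ _ _ _).trans (Eq.trans ?_ frac_one)
    refine frac_eq.2 ⟨1, ?_⟩
    simp

/-- The morphism `C → 𝕋` that corresponds to a morphism `Spec 𝕋 → Spec C`. -/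
noncomputable def evalΓ (φ : OBSpace.Hom (Spec tropical) (Spec C)) : Hom C tropical :=
  (evalAt φ ⊤ trivial).comp (toΓ C)

/-- The image point of `φ : Spec 𝕋 → Spec C` is the prime of all elements with value `0`. -/
theorem evalΓ_ne_zero_iff (φ : OBSpace.Hom (Spec tropical) (Spec C)) (a : C.carrier) :
    nn (evalΓ φ a) ≠ 0 ↔ a ∉ (φ.toFun tropPt).carrier :=
  (evalAt_ne_zero_iff φ ⊤ trivial _).trans (unitAt_toΓ_iff a _)

/-- Values of fractions. -/
theorem evalAt_frac (φ : OBSpace.Hom (Spec tropical) (Spec C)) (V : Opens (PrimeK C))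
    (s : (Spec C).sec V) (a h : C.carrier) (hV : PrimeK.basic h ≤ V)
    (hh : nn (evalΓ φ h) ≠ 0)
    (e : (Spec C).res (show PrimeK.basic h ≤ (⊤ : Opens (PrimeK C)) from le_top) (toΓ C h) *
          (Spec C).res hV s =
        (Spec C).res (show PrimeK.basic h ≤ (⊤ : Opens (PrimeK C)) from le_top) (toΓ C a)) :
    evalAt φ V (hV ((evalΓ_ne_zero_iff φ h).1 hh)) s =
      (nn (evalΓ φ a)) / (nn (evalΓ φ h)) := by
  have hp : φ.toFun tropPt ∈ PrimeK.basic h := (evalΓ_ne_zero_iff φ h).1 hh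
  have e1 := congrArg (evalAt φ (PrimeK.basic h) hp) e
  have e2 := (map_mul (evalAt φ (PrimeK.basic h) hp) _ _).symm.trans e1
  refine (eq_div_iff (G₀ := ℝ≥0) hh).2 ((mul_comm (G := ℝ≥0) _ _).trans ?_)
  have hle : PrimeK.basic h ≤ (⊤ : Opens (PrimeK C)) := le_top
  refine Eq.trans ?_ (e2.trans (evalAt_res φ hle hp _))
  exact congrArg₂ (· * ·) (evalAt_res φ hle hp _).symm (evalAt_res φ hV hp s).symm

theorem evalΓ_specMap (f : Hom C tropical) : evalΓ (specMap f) = f :=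
  Hom.ext fun a => by
    change (nn (f a)) / (nn (f 1)) = f a
    rw [map_one]
    exact div_one (G := ℝ≥0) _

end OBlp

/-! ### The affine topology -/

namespace OBSpace

open OBlp

variable {C : OBlp.{u}}

/-- The affine topology is the coarsest topology for which the evaluations are continuous. -/
theorem affineTopology_eq (s : Hom (OBlp.Spec C) (OBlp.Spec tropical)) :
    affineTopology s = TopologicalSpace.induced (fun (φ : RatPts s) (a : (OBlp.Spec C).sec ⊤) =>
      (nn (evalAt φ.1 ⊤ trivial a))) inferInstance := by
  have key : ∀ (a : (OBlp.Spec C).sec ⊤) (V : Set tropical.carrier),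
      {φ : RatPts s | ∃ t ∈ V, φ.1.app ⊤ ⊤ (fun _ _ => trivial) a = OBlp.toΓ tropical t} =
        {φ : RatPts s | evalAt φ.1 ⊤ trivial a ∈ V} := by
    intro a V
    ext φ
    constructor
    · rintro ⟨t, ht, e⟩
      have : evalAt φ.1 ⊤ trivial a = t := (congrArg (tropVal ⊤ trivial) e).trans (tropVal_toΓ t)
      exact (congrArg (· ∈ V) this).mpr ht
    · exact fun h => ⟨_, h, (toΓ_tropVal _).symm⟩
  refine le_antisymm ?_ ?_
  · rw [← continuous_iff_le_induced]
    refine @continuous_pi _ _ _ (_) _ _ fun a => ?_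
    refine @Continuous.mk _ _ (_) _ _ fun V hV => ?_
    exact TopologicalSpace.isOpen_generateFrom_of_mem ⟨a, V, hV, (key a V).symm⟩
  · refine le_generateFrom ?_
    rintro _ ⟨a, V, hV, rfl⟩
    rw [key]
    exact ⟨{x | x a ∈ V}, IsOpen.preimage (continuous_apply (A := fun _ => ℝ≥0) a) hV, rfl⟩

/-- The values of a section over an open subset of `Spec C` vary continuously if the values of all
elements of `C` do. -/
theorem continuousOn_evalAt {E : Type w} [TopologicalSpace E]
    (φ : E → Hom (OBlp.Spec tropical) (OBlp.Spec C))
    (hφ : ∀ a : C.carrier, Continuous fun x => (nn (evalΓ (φ x) a)))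
    (V : Opens (PrimeK C)) (s : (OBlp.Spec C).sec V) :
    IsOpen {x | (φ x).toFun tropPt ∈ V} ∧
      Continuous fun x : {x | (φ x).toFun tropPt ∈ V} =>
        (nn (evalAt (φ x.1) V x.2 s)) := by
  have key : ∀ x, (φ x).toFun tropPt ∈ V → ∃ (a h : C.carrier) (hV : PrimeK.basic h ≤ V),
      nn (evalΓ (φ x) h) ≠ 0 ∧
      ∀ y (hy : nn (evalΓ (φ y) h) ≠ 0),
        evalAt (φ y) V (hV ((evalΓ_ne_zero_iff (φ y) h).1 hy)) s =
          (nn (evalΓ (φ y) a)) / (nn (evalΓ (φ y) h)) := by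
    intro x hx
    obtain ⟨a, h, hV, hh, e⟩ := exists_frac V s _ hx
    exact ⟨a, h, hV, (evalΓ_ne_zero_iff _ _).2 hh, fun y hy => evalAt_frac (φ y) V s a h hV hy e⟩
  constructor
  · refine isOpen_iff_forall_mem_open.2 fun x hx => ?_
    obtain ⟨a, h, hV, hh, -⟩ := key x hx
    exact ⟨_, fun y hy => hV ((evalΓ_ne_zero_iff (φ y) h).1 hy),
      isOpen_ne_fun (hφ h) continuous_const, hh⟩
  · refine continuous_iff_continuousAt.2 fun x => ?_
    obtain ⟨a, h, hV, hh, e⟩ := key x.1 x.2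
    have hc : ContinuousAt (fun y : {x | (φ x).toFun tropPt ∈ V} =>
        (nn (evalΓ (φ y.1) a)) / (nn (evalΓ (φ y.1) h))) x :=
      (((hφ a).comp continuous_subtype_val).continuousAt).div₀
        (((hφ h).comp continuous_subtype_val).continuousAt) hh
    refine hc.congr ?_
    filter_upwards [(isOpen_ne_fun ((hφ h).comp continuous_subtype_val)
      continuous_const).mem_nhds hh] with y hy
    exact (e y.1 hy).symm

theorem continuous_affine_evalΓ (s : Hom (OBlp.Spec C) (OBlp.Spec tropical)) (a : C.carrier) :
    @Continuous _ _ (affineTopology s) _ fun φ : RatPts s => (nn (evalΓ φ.1 a)) := by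
  rw [affineTopology_eq]
  have h := @continuous_induced_dom (RatPts s) ((OBlp.Spec C).sec ⊤ → ℝ≥0)
    (fun φ a => nn (evalAt φ.1 ⊤ trivial a)) inferInstance
  exact @Continuous.comp _ _ _ (_) _ _ _ _ (continuous_apply (toΓ C a)) h

/-- A map to `U(𝕋)` for an affine `U = Spec C` is continuous if all values of elements of `C` vary
continuously. -/
theorem continuous_affine_of_evalΓ {E : Type w} [TopologicalSpace E]
    (s : Hom (OBlp.Spec C) (OBlp.Spec tropical)) (φ : E → RatPts s)
    (hφ : ∀ a : C.carrier, Continuous fun x => (nn (evalΓ (φ x).1 a))) :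
    @Continuous _ _ _ (affineTopology s) φ := by
  rw [affineTopology_eq]
  refine continuous_induced_rng.2 (continuous_pi fun a => ?_)
  have := (continuousOn_evalAt (fun x => (φ x).1) hφ ⊤ a).2
  exact this.comp (continuous_id.subtype_mk fun x => trivial)

theorem continuous_ratPtsMap_affine {X : OBSpace.{u}} (s : Hom X (OBlp.Spec tropical))
    (α : Hom (OBlp.Spec C) X) :
    @Continuous _ _ (affineTopology (s.comp α)) _ (RatPts.map (r := s) α rfl) := by
  refine continuous_iff_coinduced_le.2 ?_
  exact le_iSup₂ (f := fun (C : OBlp.{u}) (α : Hom (OBlp.Spec C) X) =>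
    (affineTopology (s.comp α)).coinduced (RatPts.map (r := s) α rfl)) C α

/-- A set of rational points is open for the fine topology if and only if its preimages under all
morphisms from affine spaces are open for the affine topology. -/
theorem isOpen_ratPts_iff {X : OBSpace.{u}} (s : Hom X (OBlp.Spec tropical)) (O : Set (RatPts s)) :
    IsOpen O ↔ ∀ (C : OBlp.{u}) (α : Hom (OBlp.Spec C) X),
      @IsOpen _ (affineTopology (s.comp α)) (RatPts.map (r := s) α rfl ⁻¹' O) := by
  refine isOpen_iSup_iff.trans (forall_congr' fun C => ?_)
  refine isOpen_iSup_iff.trans (forall_congr' fun α => ?_)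
  exact isOpen_coinduced

/-- A morphism over `𝕋` induces a continuous map between the spaces of rational points. -/
theorem continuous_ratPtsMap {X Y : OBSpace.{u}} {s : Hom X (OBlp.Spec tropical)}
    {r : Hom Y (OBlp.Spec tropical)} (α : Hom X Y) (hα : r.comp α = s) :
    Continuous (RatPts.map α hα) := by
  refine continuous_iSup_dom.2 fun C => continuous_iSup_dom.2 fun β => ?_
  refine continuous_coinduced_dom.2 ?_
  subst hα
  exact continuous_ratPtsMap_affine r (α.comp β)

end OBSpace

/-! ### Sections and units on colimits -/

namespace OBlp

theorem isUnit_frac {B : OBlp.{u}} {S : Submonoid B.carrier} {a : B.carrier} (ha : a ∈ S) (x : S) :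
    IsUnit (B.frac S a x) := by
  refine IsUnit.of_mul_eq_one (B.frac S x ⟨a, ha⟩) ?_
  rw [frac_mul, ← frac_one, frac_eq]
  exact ⟨1, by simp [mul_comm]⟩

theorem PrimeK.map_mem_compl {B : OBlp.{u₁}} {C : OBlp.{u₂}} (f : Hom B C) (q : PrimeK C) :
    ∀ a ∈ (q.comap f).compl, f a ∈ q.compl := fun _ ha => ha

/-- The map between local rings that is induced by a morphism of ordered blueprints. -/
def stalkMap {B : OBlp.{u₁}} {C : OBlp.{u₂}} (f : Hom B C) (q : PrimeK C) :
    Hom (B.loc (q.comap f).compl) (C.loc q.compl) :=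
  locMap f _ _ (q.map_mem_compl f)

theorem stalkMap_frac {B : OBlp.{u₁}} {C : OBlp.{u₂}} (f : Hom B C) (q : PrimeK C) (a : B.carrier)
    (x : (q.comap f).compl) :
    stalkMap f q (B.frac _ a x) = C.frac q.compl (f a) ⟨f x, q.map_mem_compl f x x.2⟩ := rfl

end OBlp

namespace OBSpace

open OBlp

/-- Locality of morphisms: a section is a unit at the image of `x` if and only if its pullback is a unit
at `x`. -/
theorem unitAt_app_iff {X : OBSpace.{u₁}} {Y : OBSpace.{u₂}} (f : Hom X Y) (V : Opens Y)
    (U : Opens X) (h : ∀ x ∈ U, f.toFun x ∈ V) (s : Y.sec V) (x : X) (hx : x ∈ U) :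
    UnitAt X (f.app V U h s) x ↔ UnitAt Y s (f.toFun x) := by
  constructor
  · rintro ⟨U', hU', hx', hu⟩
    rw [← f.app_restrict V hU' h (fun x hx => h x (hU' hx))] at hu
    exact f.isLocal V U' _ s hu x hx'
  · rintro ⟨V', hV', hx', hu⟩
    have hle : f.preimage V' ⊓ U ≤ U := inf_le_right
    refine ⟨f.preimage V' ⊓ U, hle, ⟨hx', hx⟩, ?_⟩
    rw [← f.app_res hV' hle h fun x hx => hx.1]
    exact hu.map _

end OBSpace

namespace AlgDiag

open OBlp OBSpace

variable {J : Type w} [Preorder J]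

/-- Gluing data for a diagram of `𝕋`-algebras `D_j`: for all `i` and `j`, an open subset `N i j` of
`Spec D_i`, which is the part that lies in the chart `Spec D_j` of the colimit, and for `q ∈ N i j`
a morphism from `D_j` to the local ring of `Spec D_i` at `q` that expresses functions on the chart `j`
in terms of the chart `i`. -/
structure Glued (D : AlgDiag.{max w u} tropical J) where
  /-- the part of the chart `i` that lies in the chart `j` -/
  N : ∀ i j : J, Opens (PrimeK (D.obj i))
  /-- the germs in the chart `i` of functions on the chart `j` -/
  germ : ∀ (i j : J) (q : PrimeK (D.obj i)), q ∈ N i j → OBlp.Hom (D.obj j) ((D.obj i).loc q.compl)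
  germ_frac : ∀ (i j : J) (a : D.obj j) (q : PrimeK (D.obj i)), q ∈ N i j →
    ∃ b h : (D.obj i).carrier, h ∉ q.carrier ∧ ∀ (q' : PrimeK (D.obj i)) (hq' : q' ∈ N i j)
      (hh : h ∉ q'.carrier), germ i j q' hq' a = (D.obj i).frac q'.compl b ⟨h, hh⟩
  mem_self : ∀ (j : J) (q : PrimeK (D.obj j)), q ∈ N j j
  germ_self : ∀ (j : J) (q : PrimeK (D.obj j)) (hq : q ∈ N j j) (a : D.obj j),
    germ j j q hq a = (D.obj j).frac q.compl a 1
  germ_str : ∀ (i j : J) (q : PrimeK (D.obj i)) (hq : q ∈ N i j) (t : tropical.carrier),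
    germ i j q hq (D.str j t) = (D.obj i).frac q.compl (D.str i t) 1
  mem_comap : ∀ (i i' j : J) (h : i ≤ i') (q : PrimeK (D.obj i)),
    q.comap (D.map i i' h) ∈ N i' j ↔ q ∈ N i j
  germ_comap : ∀ (i i' j : J) (h : i ≤ i') (q : PrimeK (D.obj i)) (hq : q ∈ N i j)
    (hq' : q.comap (D.map i i' h) ∈ N i' j) (a : D.obj j),
    stalkMap (D.map i i' h) q (germ i' j _ hq' a) = germ i j q hq a
  germ_map : ∀ (i j : J) (h : i ≤ j) (q : PrimeK (D.obj j)) (hq : q ∈ N j i) (a : D.obj j),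
    germ j i q hq (D.map i j h a) = (D.obj j).frac q.compl a 1
  exists_eq : ∀ (i j : J) (q : PrimeK (D.obj i)), q ∈ N i j → ∃ p : PrimeK (D.obj j),
    (D.incl j).toFun p = (D.incl i).toFun q

/-- The `𝕋`-rational points of the affine chart `Spec D_j`, as morphisms of `𝕋`-algebras. -/
def TPts (D : AlgDiag.{u} tropical J) (j : J) : Type u :=
  {f : OBlp.Hom (D.obj j) tropical // ∀ t, f (D.str j t) = t}

/-- The coarsest topology for which all evaluations are continuous. -/
instance (D : AlgDiag.{u} tropical J) (j : J) : TopologicalSpace (D.TPts j) :=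
  TopologicalSpace.induced (fun f a => nn (f.1 a))
    (inferInstance : TopologicalSpace ((D.obj j).carrier → ℝ≥0))

theorem continuous_tPts_apply (D : AlgDiag.{u} tropical J) (j : J) (a : D.obj j) :
    Continuous fun f : D.TPts j => nn (f.1 a) :=
  (continuous_apply (A := fun _ : (D.obj j).carrier => ℝ≥0) a).comp continuous_induced_dom

theorem continuous_tPts_of_apply {D : AlgDiag.{u} tropical J} {j : J} {E : Type v}
    [TopologicalSpace E] {F : E → D.TPts j} (h : ∀ a, Continuous fun x => nn ((F x).1 a)) :
    Continuous F :=
  continuous_induced_rng.2 (continuous_pi h)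

/-- The map on `𝕋`-rational points that is induced by `Spec D_i → Spec D_j`. -/
def TPts.map {D : AlgDiag.{u} tropical J} {i j : J} (h : i ≤ j) (f : D.TPts i) : D.TPts j :=
  ⟨f.1.comp (D.map i j h), fun t => (congrArg f.1 (D.map_str i j h t)).trans (f.2 t)⟩

/-- The `𝕋`-rational point of the colimit that is given by a `𝕋`-rational point of a chart. -/
def TPts.point {D : AlgDiag.{u} tropical J} {j : J} (f : D.TPts j) : RatPts D.toSpec :=
  D.point j f.1 f.2

theorem TPts.point_map {D : AlgDiag.{u} tropical J} {i j : J} (h : i ≤ j) (f : D.TPts i) :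
    (f.map h).point = f.point := by
  refine Subtype.ext ?_
  change (D.incl j).comp (specMap (f.1.comp (D.map i j h))) = (D.incl i).comp (specMap f.1)
  rw [specMap_comp, ← OBSpace.Hom.comp_assoc, D.incl_comp]

namespace Glued

variable {D : AlgDiag.{max w u} tropical J} (G : D.Glued)

include G in
/-- The maps between local rings of the charts are injective: germs provide a left inverse. -/
theorem stalkMap_injective {i j : J} (h : i ≤ j) (q : PrimeK (D.obj i)) : Function.Injective
    (stalkMap (D.map i j h) q) := by
  intro z z' e
  obtain ⟨a, x, rfl⟩ := frac_surj z
  obtain ⟨b, y, rfl⟩ := frac_surj z'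
  rw [stalkMap_frac, stalkMap_frac, frac_eq] at e
  obtain ⟨r, hr⟩ := e
  have hp : q.comap (D.map i j h) ∈ G.N j i := (G.mem_comap i j i h q).2 (G.mem_self i q)
  have hu : IsUnit (G.germ j i _ hp r) := by
    have e1 := G.germ_comap i j i h q (G.mem_self i q) hp r
    rw [G.germ_self] at e1
    obtain ⟨c, s, hc⟩ := frac_surj (G.germ j i _ hp r)
    rw [hc, stalkMap_frac] at e1
    rw [hc]
    have h2 : IsUnit ((D.obj i).frac q.compl (D.map i j h c) ⟨D.map i j h s, s.2⟩) := by
      rw [e1]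
      exact isUnit_frac r.2 1
    exact isUnit_frac (q.notMem_of_isUnit h2) s
  have e2 := congrArg (G.germ j i _ hp) hr
  have e4 : ∀ c d : (D.obj j).carrier, G.germ j i _ hp (r.1 * (D.map i j h c * D.map i j h d)) =
      G.germ j i _ hp r.1 * (D.obj j).frac (q.comap (D.map i j h)).compl (c * d) 1 := fun c d => by
    rw [map_mul, ← map_mul (D.map i j h), G.germ_map]
  rw [e4, e4] at e2
  have e3 := hu.mul_left_cancel e2
  rw [frac_eq] at e3 ⊢
  simpa using e3

/-- The open subset of the colimit that consists of the points of the chart `Spec D_j`. -/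
def chart (j : J) : Opens D.space :=
  ⟨{x | Quot.lift (fun p : Σ i, PrimeK (D.obj i) => p.2 ∈ G.N p.1 j) (by
      rintro ⟨i, q⟩ ⟨i', q'⟩ ⟨h, e⟩
      exact (propext (G.mem_comap i i' j h q).symm).trans (congrArg (· ∈ G.N i' j) e)) x},
    isOpen_coinduced.2 (isOpen_sigma_iff.2 fun i => (G.N i j).isOpen)⟩

theorem exists_of_mem_chart {j : J} {x : D.space} (hx : x ∈ G.chart j) :
    ∃ p : PrimeK (D.obj j), (D.incl j).toFun p = x := by
  obtain ⟨⟨i, q⟩, rfl⟩ := Quot.exists_rep x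
  exact G.exists_eq i j q hx

include G in
/-- Sections over an open subset of the colimit with the same germ in one chart agree near the given
point. -/
theorem exists_res_eq {V : Opens D.space} (s t : D.space.sec V) (j : J) (p : PrimeK (D.obj j))
    (hp : (D.incl j).toFun p ∈ V) (h : (s.1 j).1 ⟨p, hp⟩ = (t.1 j).1 ⟨p, hp⟩) :
    ∃ (V' : Opens D.space) (hV : V' ≤ V), (D.incl j).toFun p ∈ V' ∧
      D.space.res hV s = D.space.res hV t := by
  -- The set of all points at which the germs agree is well defined, because the maps between stalks are
  -- injective, and it is open, because germs are fractions locally.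
  let P : D.space.carrier → Prop := Quot.lift (fun p : Σ i, PrimeK (D.obj i) =>
      ∃ hp : (D.incl p.1).toFun p.2 ∈ V, (s.1 p.1).1 ⟨p.2, hp⟩ = (t.1 p.1).1 ⟨p.2, hp⟩) (by
    suffices key : ∀ (i i' : J) (h : i ≤ i') (q : PrimeK (D.obj i)) (q' : PrimeK (D.obj i')),
        q.comap (D.map i i' h) = q' →
        (∃ hq : (D.incl i).toFun q ∈ V, (s.1 i).1 ⟨q, hq⟩ = (t.1 i).1 ⟨q, hq⟩) =
          ∃ hq : (D.incl i').toFun q' ∈ V, (s.1 i').1 ⟨q', hq⟩ = (t.1 i').1 ⟨q', hq⟩ by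
      rintro ⟨i, q⟩ ⟨i', q'⟩ ⟨h, e⟩
      exact key i i' h q q' e
    rintro i i' h q _ rfl
    have hpt : (D.incl i').toFun (q.comap (D.map i i' h)) = (D.incl i).toFun q :=
      OBSpace.colimPt_map (fun j => OBlp.Spec (D.obj j)) (fun i j h => OBlp.specMap (D.map i j h)) h q
    have hs : ∀ (r : D.space.sec V) (hq : (D.incl i).toFun q ∈ V)
        (hq' : (D.incl i').toFun (q.comap (D.map i i' h)) ∈ V),
        locMap (D.map i i' h) (q.comap (D.map i i' h)).compl q.compl (fun _ ha => ha)
          ((r.1 i').1 ⟨_, hq'⟩) = (r.1 i).1 ⟨q, hq⟩ := fun r hq hq' =>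
      congrArg (fun r => r.1 ⟨q, hq⟩) (r.2 i i' h)
    refine propext ⟨?_, ?_⟩
    · rintro ⟨hq, e⟩
      have hq' : (D.incl i').toFun (q.comap (D.map i i' h)) ∈ V := hpt.symm ▸ hq
      refine ⟨hq', G.stalkMap_injective h q ?_⟩
      exact (hs s hq hq').trans (e.trans (hs t hq hq').symm)
    · rintro ⟨hq', e⟩
      have hq : (D.incl i).toFun q ∈ V := hpt ▸ hq'
      exact ⟨hq, (hs s hq hq').symm.trans ((congrArg _ e).trans (hs t hq hq'))⟩)
  have hP : IsOpen {x | P x} := by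
    refine isOpen_coinduced.2 (isOpen_sigma_iff.2 fun i => isOpen_iff_forall_mem_open.2 ?_)
    rintro q ⟨hq, e⟩
    obtain ⟨a, x, hx, ea⟩ := (s.1 i).2 ⟨q, hq⟩
    obtain ⟨b, y, hy, eb⟩ := (t.1 i).2 ⟨q, hq⟩
    have e' := (ea ⟨q, hq⟩ hx).symm.trans (e.trans (eb ⟨q, hq⟩ hy))
    rw [frac_eq] at e'
    obtain ⟨r, hr⟩ := e'
    let O : Opens (PrimeK (D.obj i)) :=
      (D.incl i).preimage V ⊓ PrimeK.basic x ⊓ PrimeK.basic y ⊓ PrimeK.basic r.1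
    refine ⟨(O : Set (PrimeK (D.obj i))), ?_, O.isOpen, ⟨⟨⟨hq, hx⟩, hy⟩, r.2⟩⟩
    rintro q' ⟨⟨⟨hq', hx'⟩, hy'⟩, hr'⟩
    refine ⟨hq', ?_⟩
    refine (ea ⟨q', hq'⟩ hx').trans (Eq.trans ?_ (eb ⟨q', hq'⟩ hy').symm)
    exact frac_eq.2 ⟨⟨r.1, hr'⟩, hr⟩
  have hle : (⟨{x | P x}, hP⟩ : Opens D.space) ≤ V := by
    intro x hx
    obtain ⟨⟨i, q⟩, rfl⟩ := Quot.exists_rep x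
    exact hx.1
  exact ⟨⟨{x | P x}, hP⟩, hle, ⟨hp, h⟩,
    Subtype.ext (funext fun i => Subtype.ext (funext fun q => q.2.2))⟩

/-- The functions on the chart `Spec D_j` as sections of the colimit. -/
def toSec (j : J) : OBlp.Hom (D.obj j) (D.space.sec (G.chart j)) where
  toFun a := ⟨fun i => ⟨fun q => G.germ i j q.1 q.2 a, fun q => by
      obtain ⟨b, h, hh, e⟩ := G.germ_frac i j a q.1 q.2
      exact ⟨b, h, hh, fun q' hq' => e q'.1 q'.2 hq'⟩⟩,
    fun i i' h => Subtype.ext (funext fun q => G.germ_comap i i' j h q.1 q.2 _ a)⟩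
  map_zero' := Subtype.ext (funext fun i => Subtype.ext (funext fun q => map_zero _))
  map_one' := Subtype.ext (funext fun i => Subtype.ext (funext fun q => map_one _))
  map_mul' a b := Subtype.ext (funext fun i => Subtype.ext (funext fun q => map_mul _ a b))
  map_rel {s t} hst i q := by
    have := (G.germ i j q.1 q.2).rel hst
    refine (congrArg₂ _ ?_ ?_).mp this <;>
    · symm
      refine (Multiset.map_map _ _ _).trans ?_
      exact Multiset.map_map _ _ _

/-- The section over a chart that is given by a function on this chart restricts to this function. -/
theorem incl_app_toSec (j : J) (a : D.obj j) :
    (D.incl j).app (G.chart j) ⊤ (fun q _ => G.mem_self j q) (G.toSec j a) = toΓ (D.obj j) a :=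
  Subtype.ext (funext fun q => G.germ_self j q.1 _ a)

theorem toSec_str (j : J) (t : tropical.carrier) :
    G.toSec j (D.str j t) = D.toSpec.app ⊤ (G.chart j) (fun _ _ => trivial) (toΓ tropical t) := by
  refine Subtype.ext (funext fun i => Subtype.ext (funext fun q => ?_))
  refine (G.germ_str i j q.1 q.2 t).trans ?_
  refine frac_eq.2 ⟨1, ?_⟩
  change _ * (D.str i 1 * D.str i t) = _
  rw [map_one]
  rfl

/-- A `𝕋`-rational point of the colimit whose image lies in the chart `Spec D_j` yields a
`𝕋`-rational point of this chart. -/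
noncomputable def ofPoint (j : J) (φ : RatPts D.toSpec) (h : φ.1.toFun tropPt ∈ G.chart j) :
    D.TPts j :=
  ⟨(evalAt φ.1 (G.chart j) h).comp (G.toSec j), fun t => by
    change evalAt φ.1 (G.chart j) h (G.toSec j (D.str j t)) = t
    rw [G.toSec_str]
    refine (evalAt_comp D.toSpec φ.1 ⊤ trivial (G.chart j) h (fun _ _ => trivial) _).symm.trans ?_
    refine (evalAt_congr φ.2 ⊤ trivial trivial _).trans ?_
    exact (congrArg (tropVal ⊤ trivial) ((OBlp.Spec tropical).res_self _)).trans (tropVal_toΓ t)⟩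

/-- The image of a rational point of a chart lies in the open subset of this chart. -/
theorem point_mem_chart {j : J} (f : D.TPts j) : f.point.1.toFun tropPt ∈ G.chart j :=
  G.mem_self j _

theorem ofPoint_point {j : J} (f : D.TPts j) :
    G.ofPoint j f.point (G.point_mem_chart f) = f := by
  refine Subtype.ext (OBlp.Hom.ext fun a => ?_)
  have e := evalAt_comp (D.incl j) (specMap f.1) (G.chart j) (G.point_mem_chart f) ⊤ trivial
    (fun q _ => G.mem_self j q) (G.toSec j a)
  refine e.trans ?_
  rw [G.incl_app_toSec]
  exact congrArg (fun g => g a) (evalΓ_specMap f.1)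

include G in
/-- Charts inject into the rational points of the colimit: the values of functions on the chart can be
recovered as values of sections of the colimit. -/
theorem point_injective (j : J) :
    Function.Injective fun f : D.TPts j => f.point := by
  intro f g h
  rw [← G.ofPoint_point f, ← G.ofPoint_point g]
  have h' : f.point = g.point := h
  congr 1

/-- A `𝕋`-rational point of the colimit whose image lies in a chart factors through this chart. -/
theorem point_ofPoint (j : J) (φ : RatPts D.toSpec) (h : φ.1.toFun tropPt ∈ G.chart j) :
    (G.ofPoint j φ h).point = φ := by
  obtain ⟨p, hp⟩ := G.exists_of_mem_chart h
  set f := G.ofPoint j φ h with hf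
  have hfp : (specMap f.1).toFun tropPt = p := by
    refine PrimeK.ext (Set.ext fun a => ?_)
    rw [← not_iff_not, ← evalΓ_ne_zero_iff, evalΓ_specMap]
    refine (evalAt_ne_zero_iff φ.1 (G.chart j) h (G.toSec j a)).trans ?_
    rw [← hp, ← unitAt_app_iff (D.incl j) (G.chart j) ⊤ (fun q _ => G.mem_self j q) _ p trivial,
      G.incl_app_toSec]
    exact unitAt_toΓ_iff a p
  have hpt : f.point.1.toFun tropPt = φ.1.toFun tropPt :=
    (congrArg (D.incl j).toFun hfp).trans hp
  refine Subtype.ext (hom_trop_ext hpt fun V hV hV' s => ?_)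
  have hpV : p ∈ (D.incl j).preimage V := by
    change (D.incl j).toFun p ∈ V
    rw [hp]
    exact hV'
  -- In the chart, the section is a fraction `a / x` near the image point.
  obtain ⟨a, x, hx, hxp, e⟩ := exists_frac ((D.incl j).preimage V)
    ((D.incl j).app V ((D.incl j).preimage V) (fun _ h => h) s) p hpV
  have hfx : nn (f.1 x) ≠ 0 := by
    have := (evalΓ_ne_zero_iff (specMap f.1) x).2 (by rwa [hfp])
    rwa [evalΓ_specMap] at this
  have e1 : evalAt f.point.1 V hV s = nn (f.1 a) / nn (f.1 x) := by
    have hm : (specMap f.1).toFun tropPt ∈ (D.incl j).preimage V := by rwa [hfp]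
    refine (evalAt_comp (D.incl j) (specMap f.1) V hV ((D.incl j).preimage V) hm
      (fun _ h => h) s).trans ?_
    refine (evalAt_frac (specMap f.1) _ _ a x hx (by rwa [evalΓ_specMap]) e).trans ?_
    rw [evalΓ_specMap]
  rw [e1]
  -- The equation `x s = a` of germs lifts to the colimit.
  have hV₁ : V ⊓ G.chart j ≤ V := inf_le_left
  have hV₂ : V ⊓ G.chart j ≤ G.chart j := inf_le_right
  have hpV₁ : (D.incl j).toFun p ∈ V ⊓ G.chart j := ⟨hpV, G.mem_self j p⟩
  obtain ⟨V', hV'', hpV', e2⟩ := G.exists_res_eq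
    (D.space.res hV₂ (G.toSec j x) * D.space.res hV₁ s) (D.space.res hV₂ (G.toSec j a)) j p hpV₁ (by
      have e3 := congrArg (fun r => r.1 ⟨p, hxp⟩) e
      have e4 : (D.obj j).frac p.compl x 1 * (s.1 j).1 ⟨p, hpV⟩ = (D.obj j).frac p.compl a 1 := e3
      refine Eq.trans ?_ (e4.trans (G.germ_self j p _ a).symm)
      exact congrArg (· * (s.1 j).1 ⟨p, hpV⟩) (G.germ_self j p _ x))
  have hφ : φ.1.toFun tropPt ∈ V' := hp ▸ hpV'
  have e5 := congrArg (evalAt φ.1 V' hφ) e2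
  rw [evalAt_res, evalAt_res, map_mul, evalAt_res, evalAt_res, evalAt_res] at e5
  refine (div_eq_iff (G₀ := ℝ≥0) hfx).2 ?_
  exact e5.symm.trans (mul_comm (G := ℝ≥0) _ _)

include G in
/-- Every `𝕋`-rational point of the colimit factors through a chart. -/
theorem exists_point (φ : RatPts D.toSpec) : ∃ (j : J) (f : D.TPts j), f.point = φ := by
  obtain ⟨⟨j, p⟩, hp⟩ := Quot.exists_rep (φ.1.toFun tropPt)
  have h : φ.1.toFun tropPt ∈ G.chart j := hp ▸ G.mem_self j p
  exact ⟨j, _, G.point_ofPoint j φ h⟩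

include G in
/-- Two points of charts that define the same point of the colimit are connected by a zigzag of maps
between charts. -/
theorem eqvGen_of_point_eq {i j : J} (f : D.TPts i) (g : D.TPts j) (h : f.point = g.point) :
    Relation.EqvGen (fun p q : Σ j, D.TPts j => ∃ h : p.1 ≤ q.1, p.2.map h = q.2)
      ⟨i, f⟩ ⟨j, g⟩ := by
  have key : ∀ P Q : Σ j, PrimeK (D.obj j), Relation.EqvGen
      (fun p q : Σ j, (OBlp.Spec (D.obj j)).carrier =>
        ∃ h : p.1 ≤ q.1, (specMap (D.map p.1 q.1 h)).toFun p.2 = q.2) P Q →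
      ∀ φ : RatPts D.toSpec, (D.incl P.1).toFun P.2 = φ.1.toFun tropPt →
      ∀ (f : D.TPts P.1) (g : D.TPts Q.1), f.point = φ → g.point = φ →
      Relation.EqvGen (fun p q : Σ j, D.TPts j => ∃ h : p.1 ≤ q.1, p.2.map h = q.2)
        ⟨P.1, f⟩ ⟨Q.1, g⟩ := by
    intro P Q hPQ
    induction hPQ with
    | rel P Q hPQ =>
      obtain ⟨hle, -⟩ := hPQ
      intro φ _ f g hf hg
      refine .rel _ _ ⟨hle, G.point_injective _ ?_⟩
      exact (TPts.point_map hle f).trans (hf.trans hg.symm)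
    | refl P =>
      intro φ _ f g hf hg
      obtain rfl := G.point_injective _ (hf.trans hg.symm)
      exact .refl _
    | symm P Q hPQ ih =>
      intro φ hφ f g hf hg
      exact .symm _ _ (ih φ ((Quot.eqvGen_sound hPQ).trans hφ) g f hg hf)
    | trans P Q R hPQ _ ih ih' =>
      -- The point factors through the intermediate chart, as its image lies in this chart.
      intro φ hφ f g hf hg
      have hQ : (D.incl Q.1).toFun Q.2 = φ.1.toFun tropPt := (Quot.eqvGen_sound hPQ).symm.trans hφ
      have hm : φ.1.toFun tropPt ∈ G.chart Q.1 := hQ ▸ G.mem_self Q.1 Q.2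
      have e := G.point_ofPoint Q.1 φ hm
      exact (ih φ hφ f _ hf e).trans _ _ _ (ih' φ hQ _ g e hg)
  have hpt : (D.incl i).toFun ((specMap f.1).toFun tropPt) =
      (D.incl j).toFun ((specMap g.1).toFun tropPt) :=
    congrArg (fun φ => φ.1.toFun tropPt) h
  exact key ⟨i, _⟩ ⟨j, _⟩ (Quot.eqvGen_exact hpt) f.point rfl f g rfl h.symm

/-! ### The fine topology on the rational points of a glued space -/

theorem continuous_point (j : J) : Continuous fun f : D.TPts j => f.point := by
  let φ : D.TPts j → RatPts (D.toSpec.comp (D.incl j)) := fun f =>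
    ⟨specMap f.1, (OBSpace.Hom.comp_assoc _ _ _).trans f.point.2⟩
  have h1 := continuous_affine_of_evalΓ (D.toSpec.comp (D.incl j)) φ fun a => by
    have : (fun f : D.TPts j => nn (evalΓ (φ f).1 a)) = fun f => nn (f.1 a) :=
      funext fun f => congrArg (fun g => g a) (evalΓ_specMap f.1)
    rw [this]
    exact D.continuous_tPts_apply j a
  exact @Continuous.comp _ _ _ _ (_) _ _ _ (continuous_ratPtsMap_affine D.toSpec (D.incl j)) h1

include G in
/-- The charts are open for the fine topology: the condition that the image of a rational point lies in a
chart is open on every affine space of rational points, and on this open subset the values of functions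
on the chart vary continuously. -/
theorem isOpenMap_point (j : J) : IsOpenMap fun f : D.TPts j => f.point := by
  intro O hO
  refine (isOpen_ratPts_iff D.toSpec _).2 fun C α => ?_
  have key : ∀ (E : Type (max w u)) [TopologicalSpace E] (ψ : E → RatPts (D.toSpec.comp α)),
      (∀ a : C.carrier, Continuous fun x => nn (evalΓ (ψ x).1 a)) →
      IsOpen {x | RatPts.map (r := D.toSpec) α rfl (ψ x) ∈ (fun f : D.TPts j => f.point) '' O} := by
    intro E _ ψ hψ
    have hc := continuousOn_evalAt (fun x => (ψ x).1) hψ (α.preimage (G.chart j))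
    let F : {x | (ψ x).1.toFun tropPt ∈ α.preimage (G.chart j)} → D.TPts j := fun x =>
      G.ofPoint j (RatPts.map (r := D.toSpec) α rfl (ψ x.1)) x.2
    have hF : Continuous F := by
      refine continuous_tPts_of_apply fun a => ?_
      refine (hc (α.app (G.chart j) _ (fun _ h => h) (G.toSec j a))).2.congr fun x => ?_
      exact (evalAt_comp α (ψ x.1).1 (G.chart j) x.2 (α.preimage (G.chart j)) x.2 (fun _ h => h)
        (G.toSec j a)).symm
    have e : {x | RatPts.map (r := D.toSpec) α rfl (ψ x) ∈ (fun f : D.TPts j => f.point) '' O} =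
        Subtype.val '' (F ⁻¹' O) := by
      ext x
      constructor
      · rintro ⟨f, hf, e⟩
        have e' : f.point = RatPts.map (r := D.toSpec) α rfl (ψ x) := e
        have hx : (RatPts.map (r := D.toSpec) α rfl (ψ x)).1.toFun tropPt ∈ G.chart j :=
          e' ▸ G.point_mem_chart f
        refine ⟨⟨x, hx⟩, ?_, rfl⟩
        have : F ⟨x, hx⟩ = f := G.point_injective j ((G.point_ofPoint j _ hx).trans e'.symm)
        exact (congrArg (· ∈ O) this).mpr hf
      · rintro ⟨y, hy, rfl⟩
        exact ⟨F y, hy, G.point_ofPoint j (RatPts.map (r := D.toSpec) α rfl (ψ y.1)) y.2⟩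
    rw [e]
    exact (hc 0).1.isOpenMap_subtype_val _ (hF.isOpen_preimage _ hO)
  exact @key _ (affineTopology (D.toSpec.comp α)) id
    fun a => continuous_affine_evalΓ (D.toSpec.comp α) a

include G in
/-- The space of `𝕋`-rational points of the colimit is the colimit of the spaces of `𝕋`-rational
points of the charts. -/
theorem exists_homeomorph (F : J → Type v) [∀ j, TopologicalSpace (F j)]
    (m : ∀ i j : J, i ≤ j → F i → F j) (θ : ∀ j, F j ≃ₜ D.TPts j)
    (hθ : ∀ i j (h : i ≤ j) x, θ j (m i j h x) = (θ i x).map h) :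
    ∃ Φ : (Quot fun p q : Σ j, F j => ∃ h : p.1 ≤ q.1, m p.1 q.1 h p.2 = q.2) ≃ₜ RatPts D.toSpec,
      ∀ j x, Φ (Quot.mk _ ⟨j, x⟩) = (θ j x).point := by
  let Φ : (Quot fun p q : Σ j, F j => ∃ h : p.1 ≤ q.1, m p.1 q.1 h p.2 = q.2) → RatPts D.toSpec :=
    Quot.lift (fun p => (θ p.1 p.2).point) (by
      rintro ⟨i, x⟩ ⟨j, y⟩ ⟨h, e⟩
      refine Eq.trans ?_ (congrArg (fun y => (θ j y).point) e)
      exact (TPts.point_map h (θ i x)).symm.trans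
        (congrArg (fun f : D.TPts j => f.point) (hθ i j h x).symm))
  have hinj : Function.Injective Φ := by
    intro x y hxy
    obtain ⟨⟨i, x⟩, rfl⟩ := Quot.exists_rep x
    obtain ⟨⟨j, y⟩, rfl⟩ := Quot.exists_rep y
    have h1 := G.eqvGen_of_point_eq _ _ (show (θ i x).point = (θ j y).point from hxy)
    have key : ∀ P Q : Σ j, D.TPts j,
        Relation.EqvGen (fun p q : Σ j, D.TPts j => ∃ h : p.1 ≤ q.1, p.2.map h = q.2) P Q →
        (Quot.mk (fun p q : Σ j, F j => ∃ h : p.1 ≤ q.1, m p.1 q.1 h p.2 = q.2)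
          ⟨P.1, (θ P.1).symm P.2⟩) = Quot.mk _ ⟨Q.1, (θ Q.1).symm Q.2⟩ := by
      intro P Q h
      induction h with
      | rel P Q h =>
        obtain ⟨h, e⟩ := h
        refine Quot.sound ⟨h, (θ Q.1).injective ?_⟩
        change θ Q.1 (m _ _ h ((θ P.1).symm P.2)) = _
        rw [hθ, Homeomorph.apply_symm_apply, Homeomorph.apply_symm_apply, e]
      | refl P => rfl
      | symm P Q _ ih => exact ih.symm
      | trans P Q R _ _ ih ih' => exact ih.trans ih'
    have := key _ _ h1
    simpa using this
  have hsurj : Function.Surjective Φ := by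
    intro φ
    obtain ⟨j, f, rfl⟩ := G.exists_point φ
    exact ⟨Quot.mk _ ⟨j, (θ j).symm f⟩,
      congrArg (fun f : D.TPts j => f.point) ((θ j).apply_symm_apply f)⟩
  have hcont : Continuous Φ := by
    refine continuous_coinduced_dom.2 (continuous_sigma_iff.2 fun j => ?_)
    exact (continuous_point j).comp (θ j).continuous
  have hopen : IsOpenMap Φ := by
    intro O hO
    have hO' := isOpen_sigma_iff.1 (isOpen_coinduced.1 hO)
    have e : Φ '' O = ⋃ j, (fun x => (θ j x).point) '' {x | Quot.mk _ ⟨j, x⟩ ∈ O} := by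
      ext φ
      simp only [Set.mem_image, Set.mem_iUnion]
      constructor
      · rintro ⟨x, hx, rfl⟩
        obtain ⟨⟨j, x⟩, rfl⟩ := Quot.exists_rep x
        exact ⟨j, x, hx, rfl⟩
      · rintro ⟨j, x, hx, rfl⟩
        exact ⟨_, hx, rfl⟩
    rw [e]
    exact isOpen_iUnion fun j => ((G.isOpenMap_point j).comp (θ j).isOpenMap) _ (hO' j)
  exact ⟨(Equiv.ofBijective Φ ⟨hinj, hsurj⟩).toHomeomorphOfContinuousOpen hcont hopen,
    fun _ _ => rfl⟩

end Glued

end AlgDiag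

open OBlp

/-! ### Blue models of schemes -/

theorem exists_pow_mul_eq_of_res_eq {Y : Scheme.{u}} {U : Y.Opens} (hU : IsAffineOpen U)
    (t a b : Γ(Y, U)) (h : resHom Y (Y.basicOpen_le t) a = resHom Y (Y.basicOpen_le t) b) :
    ∃ n : ℕ, t ^ n * a = t ^ n * b := by
  obtain ⟨n, hn⟩ := exists_pow_mul_eq_zero_of_res_basicOpen_eq_zero_of_isAffineOpen Y hU (a - b) t
    ((map_sub (resHom Y (Y.basicOpen_le t)) a b).trans (sub_eq_zero.2 h))
  exact ⟨n, by rwa [mul_sub, sub_eq_zero] at hn⟩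

section Model

variable {k : Type u} [Field k] {Y : Scheme.{u}} (f : Y ⟶ AlgebraicGeometry.Spec (.of k))
  {J : Type w} [Preorder J] (P : AffinePresentation Y J)

/-- A blue model of the presented scheme `Y`: for each `j`, the blueprint `B_j` is a multiplicative
submonoid of the ring `ΓU_j`, with the relations that hold in this ring. The set `loc i j` consists
of elements `s` of `B_i` such that `U_j` contains the principal open subset `D(s)` of `U_i`, and such
that all elements of `B_j` are fractions of elements of `B_i` by powers of `s` over `D(s)`. -/
structure BlueModel (B : AlgDiag.{u} (OBlp.ofSemiring k) J) where
  /-- the inclusion into the ring of functions -/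
  ev : ∀ j : J, (B.obj j).carrier →*₀ Γ(Y, P.U j)
  ev_injective : ∀ j, Function.Injective (ev j)
  rel_iff : ∀ (j : J) (s t : Multiset (B.obj j).carrier),
    (B.obj j).rel s t ↔ (s.map (ev j)).sum = (t.map (ev j)).sum
  ev_map : ∀ (i j : J) (h : i ≤ j) (b : B.obj j),
    ev i (B.map i j h b) = resHom Y (P.mono h) (ev j b)
  ev_str : ∀ (j : J) (c : k), ev j (B.str j c) = kstr f (P.U j) c
  /-- the elements whose principal open subset lies in another chart -/
  loc : ∀ i j : J, Set (B.obj i).carrier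
  basicOpen_le : ∀ {i j : J} {s : B.obj i}, s ∈ loc i j → Y.basicOpen (ev i s) ≤ P.U j
  exists_frac : ∀ {i j : J} {s : B.obj i} (hs : s ∈ loc i j) (b : B.obj j),
    ∃ (n : ℕ) (c : (B.obj i).carrier), resHom Y (Y.basicOpen_le (ev i s)) (ev i c) =
      resHom Y (Y.basicOpen_le (ev i s)) (ev i s) ^ n * resHom Y (basicOpen_le hs) (ev j b)
  one_mem : ∀ j : J, 1 ∈ loc j j
  map_mem : ∀ {i i' j : J} (h : i ≤ i') {s : B.obj i'}, s ∈ loc i' j → B.map i i' h s ∈ loc i j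

namespace BlueModel

variable {f P} {B : AlgDiag.{u} (OBlp.ofSemiring k) J} (M : BlueModel f P B)

/-- The element `b` of `B_j` is equal to `c / h` over the principal open subset `D(t)` of `U_i`. -/
def IsFrac (i j : J) (t c h : B.obj i) (b : B.obj j) : Prop :=
  ∃ hj : Y.basicOpen (M.ev i t) ≤ P.U j, resHom Y (Y.basicOpen_le (M.ev i t)) (M.ev i c) =
    resHom Y (Y.basicOpen_le (M.ev i t)) (M.ev i h) * resHom Y hj (M.ev j b)

variable {M}

theorem IsFrac.res {i j : J} {t c h : B.obj i} {b : B.obj j} (H : M.IsFrac i j t c h b)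
    {V : Y.Opens} (hV : V ≤ Y.basicOpen (M.ev i t)) (hi : V ≤ P.U i) (hj : V ≤ P.U j) :
    resHom Y hi (M.ev i c) = resHom Y hi (M.ev i h) * resHom Y hj (M.ev j b) := by
  obtain ⟨hj', e⟩ := H
  have := congrArg (resHom Y hV) e
  rwa [map_mul, resHom_resHom, resHom_resHom, resHom_resHom] at this

theorem IsFrac.mul {i j : J} {t c h t' c' h' : B.obj i} {b b' : B.obj j}
    (H : M.IsFrac i j t c h b) (H' : M.IsFrac i j t' c' h' b') :
    M.IsFrac i j (t * t') (c * c') (h * h') (b * b') := by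
  have hle : Y.basicOpen (M.ev i (t * t')) ≤ Y.basicOpen (M.ev i t) := by
    rw [map_mul, Scheme.basicOpen_mul]
    exact inf_le_left
  have hle' : Y.basicOpen (M.ev i (t * t')) ≤ Y.basicOpen (M.ev i t') := by
    rw [map_mul, Scheme.basicOpen_mul]
    exact inf_le_right
  have hj : Y.basicOpen (M.ev i (t * t')) ≤ P.U j := hle.trans H.1
  refine ⟨hj, ?_⟩
  rw [map_mul (M.ev i) c c', map_mul (M.ev i) h h', map_mul (M.ev j) b b', map_mul (resHom Y _),
    map_mul (resHom Y _), map_mul (resHom Y _),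
    H.res hle (Y.basicOpen_le _) hj, H'.res hle' (Y.basicOpen_le _) hj]
  ring

variable (M)

/-- A relation that holds over `D(t)` holds after multiplication with a power of `t`. -/
theorem exists_pow_rel (i : J) (t : B.obj i) (s s' : Multiset (B.obj i).carrier)
    (h : resHom Y (Y.basicOpen_le (M.ev i t)) (s.map (M.ev i)).sum =
      resHom Y (Y.basicOpen_le (M.ev i t)) (s'.map (M.ev i)).sum) :
    ∃ n : ℕ, (B.obj i).rel (s.map (t ^ n * ·)) (s'.map (t ^ n * ·)) := by
  obtain ⟨n, hn⟩ := exists_pow_mul_eq_of_res_eq (P.isAffineOpen i) _ _ _ h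
  refine ⟨n, (M.rel_iff i _ _).2 ?_⟩
  have e : ∀ s : Multiset (B.obj i).carrier, ((s.map (t ^ n * ·)).map (M.ev i)).sum =
      M.ev i t ^ n * (s.map (M.ev i)).sum := by
    intro s
    rw [← Multiset.sum_map_mul_left, Multiset.map_map]
    simp only [Function.comp_def, map_mul, map_pow]
  rw [e, e, hn]

/-- An equality that holds over `D(t)` holds after multiplication with a power of `t`. -/
theorem exists_pow_eq (i : J) (t a b : B.obj i)
    (h : resHom Y (Y.basicOpen_le (M.ev i t)) (M.ev i a) =
      resHom Y (Y.basicOpen_le (M.ev i t)) (M.ev i b)) :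
    ∃ n : ℕ, t ^ n * a = t ^ n * b := by
  obtain ⟨n, hn⟩ := exists_pow_mul_eq_of_res_eq (P.isAffineOpen i) _ _ _ h
  exact ⟨n, M.ev_injective i (by simpa using hn)⟩

variable {M}

/-- Two representations of an element of `B_j` as a fraction of elements of `B_i` agree in
localizations of `B_i`. -/
theorem IsFrac.frac_eq {i j : J} {S : Submonoid (B.obj i).carrier} {t c t' c' : B.obj i}
    {h h' : S} {b : B.obj j} (ht : t ∈ S) (ht' : t' ∈ S)
    (H : M.IsFrac i j t c h b) (H' : M.IsFrac i j t' c' h' b) :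
    (B.obj i).frac S c h = (B.obj i).frac S c' h' := by
  have hle : Y.basicOpen (M.ev i (t * t')) ≤ Y.basicOpen (M.ev i t) := by
    rw [map_mul, Scheme.basicOpen_mul]
    exact inf_le_left
  have hle' : Y.basicOpen (M.ev i (t * t')) ≤ Y.basicOpen (M.ev i t') := by
    rw [map_mul, Scheme.basicOpen_mul]
    exact inf_le_right
  have hj : Y.basicOpen (M.ev i (t * t')) ≤ P.U j := hle.trans H.1
  obtain ⟨n, hn⟩ := M.exists_pow_eq i (t * t') (h' * c) (h * c') (by
    rw [map_mul (M.ev i) (h' : (B.obj i).carrier) c, map_mul (M.ev i) (h : (B.obj i).carrier) c',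
      map_mul (resHom Y _), map_mul (resHom Y _), H.res hle (Y.basicOpen_le _) hj,
      H'.res hle' (Y.basicOpen_le _) hj]
    ring)
  exact OBlp.frac_eq.2 ⟨⟨(t * t') ^ n, S.pow_mem (S.mul_mem ht ht') n⟩, hn⟩

variable (M) {i j : J} (S : Submonoid (B.obj i).carrier) (hS : ∃ t ∈ M.loc i j, t ∈ S)

/-- Finitely many elements of `B_j` have a common denominator. -/
theorem exists_common_denom {t : B.obj i} (ht : t ∈ M.loc i j) (s : Multiset (B.obj j).carrier) :
    ∃ N : ℕ, ∀ b ∈ s, ∃ c, M.IsFrac i j t c (t ^ N) b := by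
  have mono : ∀ {n N : ℕ} {b : B.obj j}, n ≤ N → (∃ c, M.IsFrac i j t c (t ^ n) b) →
      ∃ c, M.IsFrac i j t c (t ^ N) b := by
    rintro n N b h ⟨c, hj, hc⟩
    obtain ⟨m, rfl⟩ := Nat.exists_eq_add_of_le h
    refine ⟨t ^ m * c, hj, ?_⟩
    rw [map_mul, map_mul, hc, pow_add, map_mul, map_mul]
    ring
  induction s using Multiset.induction_on with
  | empty => exact ⟨0, by simp⟩
  | cons b s ih =>
    obtain ⟨N, hN⟩ := ih
    obtain ⟨n, c, hc⟩ := M.exists_frac ht b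
    have hb : ∃ c, M.IsFrac i j t c (t ^ n) b := ⟨c, M.basicOpen_le ht, by
      rw [map_pow, map_pow]
      exact hc⟩
    refine ⟨max n N, fun b' hb' => ?_⟩
    rcases Multiset.mem_cons.1 hb' with rfl | h
    · exact mono (le_max_left _ _) hb
    · exact mono (le_max_right _ _) (hN b' h)

include hS in
/-- If an element of `loc i j` lies in `S`, then all elements of `B_j` are fractions of elements of `B_i`
with denominator in `S`. -/
theorem exists_isFrac (b : B.obj j) : ∃ (t c : (B.obj i).carrier) (h : S),
    t ∈ S ∧ M.IsFrac i j t c h b := by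
  obtain ⟨t, ht, htS⟩ := hS
  obtain ⟨N, hN⟩ := M.exists_common_denom ht {b}
  obtain ⟨c, hc⟩ := hN b (Multiset.mem_singleton_self b)
  exact ⟨t, c, ⟨t ^ N, S.pow_mem htS N⟩, htS, hc⟩

/-- The element of a localization of `B_i` that represents an element of `B_j`. -/
noncomputable def germFun (b : B.obj j) : ((B.obj i).loc S).carrier :=
  (B.obj i).frac S (M.exists_isFrac S hS b).choose_spec.choose
    (M.exists_isFrac S hS b).choose_spec.choose_spec.choose

theorem germFun_eq {b : B.obj j} {t c : B.obj i} {h : S} (ht : t ∈ S) (H : M.IsFrac i j t c h b) :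
    M.germFun S hS b = (B.obj i).frac S c h :=
  IsFrac.frac_eq (M.exists_isFrac S hS b).choose_spec.choose_spec.choose_spec.1 ht
    (M.exists_isFrac S hS b).choose_spec.choose_spec.choose_spec.2 H

include hS in
theorem isFrac_str (c : k) : ∃ t ∈ S, M.IsFrac i j t (B.str i c) 1 (B.str j c) := by
  obtain ⟨t, ht, htS⟩ := hS
  refine ⟨t, htS, M.basicOpen_le ht, ?_⟩
  rw [map_one, map_one, one_mul, M.ev_str, M.ev_str, resHom_kstr, resHom_kstr]

theorem germFun_str (c : k) : M.germFun S hS (B.str j c) = (B.obj i).frac S (B.str i c) 1 := by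
  obtain ⟨t, htS, H⟩ := M.isFrac_str S hS c
  exact M.germFun_eq S hS (h := 1) htS H

/-- The morphism from `B_j` to a localization of `B_i` in which an element of `loc i j` is
invertible. -/
noncomputable def germ : OBlp.Hom (B.obj j) ((B.obj i).loc S) where
  toFun := M.germFun S hS
  map_zero' := by
    refine (congrArg _ (map_zero (B.str j)).symm).trans ((M.germFun_str S hS 0).trans ?_)
    exact (congrArg (fun a => (B.obj i).frac S a 1) (map_zero (B.str i))).trans frac_zero
  map_one' := by
    refine (congrArg _ (map_one (B.str j)).symm).trans ((M.germFun_str S hS 1).trans ?_)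
    exact (congrArg (fun a => (B.obj i).frac S a 1) (map_one (B.str i))).trans frac_one
  map_mul' b b' := by
    obtain ⟨t, c, h, ht, H⟩ := M.exists_isFrac S hS b
    obtain ⟨t', c', h', ht', H'⟩ := M.exists_isFrac S hS b'
    rw [M.germFun_eq S hS ht H, M.germFun_eq S hS ht' H', frac_mul]
    exact M.germFun_eq S hS (h := h * h') (S.mul_mem ht ht') (H.mul H')
  map_rel {s s'} hss := by
    obtain ⟨t, ht, htS⟩ := hS
    obtain ⟨N, hN⟩ := M.exists_common_denom ht (s + s')
    have hN' : ∀ b, ∃ c, b ∈ s + s' → M.IsFrac i j t c (t ^ N) b := fun b => by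
      by_cases hb : b ∈ s + s'
      · obtain ⟨c, hc⟩ := hN b hb
        exact ⟨c, fun _ => hc⟩
      · exact ⟨0, fun h => absurd h hb⟩
    choose c hc using hN'
    have hres : ∀ r : Multiset (B.obj j).carrier, (∀ b ∈ r, b ∈ s + s') →
        resHom Y (Y.basicOpen_le (M.ev i t)) ((r.map c).map (M.ev i)).sum =
          resHom Y (Y.basicOpen_le (M.ev i t)) (M.ev i (t ^ N)) *
            resHom Y (M.basicOpen_le ht) (r.map (M.ev j)).sum := by
      intro r hr
      rw [map_multiset_sum, map_multiset_sum, ← Multiset.sum_map_mul_left, Multiset.map_map,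
        Multiset.map_map, Multiset.map_map]
      refine congrArg _ (Multiset.map_congr rfl fun b hb => ?_)
      exact (hc b (hr b hb)).2
    obtain ⟨n, hn⟩ := M.exists_pow_rel i t (s.map c) (s'.map c) (by
      rw [hres s fun b hb => Multiset.mem_add.2 (.inl hb),
        hres s' fun b hb => Multiset.mem_add.2 (.inr hb), (M.rel_iff j s s').1 hss])
    have key : ∀ r : Multiset (B.obj j).carrier, (∀ b ∈ r, b ∈ s + s') →
        r.map (M.germFun S ⟨t, ht, htS⟩) = ((r.map c).map (t ^ n * ·)).map
          fun a => Localization.mk a ⟨t ^ (n + N), S.pow_mem htS (n + N)⟩ := by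
      intro r hr
      rw [Multiset.map_map, Multiset.map_map]
      refine Multiset.map_congr rfl fun b hb => ?_
      refine (M.germFun_eq S ⟨t, ht, htS⟩ (h := ⟨t ^ N, S.pow_mem htS N⟩) htS
        (hc b (hr b hb))).trans ?_
      refine OBlp.frac_eq.2 ⟨1, ?_⟩
      simp only [pow_add, Submonoid.coe_one, one_mul]
      rw [mul_left_comm, mul_assoc, mul_left_comm]
    exact ⟨⟨t ^ (n + N), S.pow_mem htS (n + N)⟩, _, _, hn,
      key s fun b hb => Multiset.mem_add.2 (.inl hb), key s' fun b hb => Multiset.mem_add.2 (.inr hb)⟩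

theorem germ_eq {b : B.obj j} {t c : B.obj i} {h : S} (ht : t ∈ S) (H : M.IsFrac i j t c h b) :
    M.germ S hS b = (B.obj i).frac S c h := M.germFun_eq S hS ht H

theorem germ_str (c : k) : M.germ S hS (B.str j c) = (B.obj i).frac S (B.str i c) 1 :=
  M.germFun_str S hS c

end BlueModel

end Model

/-! ### Localizations of bends -/

namespace OBlp

variable {K : OBlp.{u₁}} {T : OBlp.{v}} {v : K.carrier →*₀ T.carrier} {B : OBlp.{u₂}} {C : OBlp.{u₃}}
  {e : Hom K B} {e' : Hom K C}

theorem bendMk_mul (b b' : B.carrier) (t t' : T.carrier) :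
    bendMk v B e (b * b') (t * t') = bendMk v B e b t * bendMk v B e b' t' :=
  map_mul (ofGenMk (BendGen v B e)) (b, t) (b', t')

theorem bendMk_one : bendMk v B e 1 1 = 1 := map_one (ofGenMk (BendGen v B e))

theorem bendMk_eq (b : B.carrier) (t : T.carrier) :
    bendMk v B e b t = bendMk v B e b 1 * bendMk v B e 1 t := by
  rw [← bendMk_mul, mul_one, one_mul]

theorem bendMk_zero_left (t : T.carrier) : bendMk v B e 0 t = 0 :=
  ((quotMk_eq (BendGen v B e)).2 ⟨.of (.zero_left t), .of (.zero_left' t)⟩).trans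
    (map_zero (ofGenMk (BendGen v B e)))

theorem bendMk_zero_right (b : B.carrier) : bendMk v B e b 0 = 0 :=
  ((quotMk_eq (BendGen v B e)).2 ⟨.of (.zero_right b), .of (.zero_right' b)⟩).trans
    (map_zero (ofGenMk (BendGen v B e)))

theorem bendMk_scalar (c : K.carrier) (b : B.carrier) (t : T.carrier) :
    bendMk v B e (e c * b) t = bendMk v B e b (v c * t) :=
  (quotMk_eq (BendGen v B e)).2 ⟨.of (.scalar c b t), .of (.scalar' c b t)⟩

/-- The multiplicative map `b ↦ b ⊗ 1`. -/
def bendIn (v : K.carrier →*₀ T.carrier) (B : OBlp.{u₂}) (e : Hom K B) :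
    B.carrier →*₀ (bend v B e).carrier where
  toFun b := bendMk v B e b 1
  map_zero' := bendMk_zero_left 1
  map_one' := bendMk_one
  map_mul' b b' := by rw [← bendMk_mul, one_mul]

/-- The defining relations of the bend. -/
theorem bendIn_rel {a : B.carrier} {s : Multiset B.carrier} (h : B.rel {a} s) :
    (bend v B e).rel ((a ::ₘ s).map (bendIn v B e)) (s.map (bendIn v B e)) ∧
      (bend v B e).rel (s.map (bendIn v B e)) ((a ::ₘ s).map (bendIn v B e)) := by
  have h1 := ofGen_rel _ (Gen.of (.bend h : BendGen v B e _ _))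
  have h2 := ofGen_rel _ (Gen.of (.bend' h : BendGen v B e _ _))
  have e1 : ∀ s : Multiset B.carrier, (s.map fun b => (b, (1 : T.carrier))).map
      (ofGenMk (BendGen v B e)) = s.map (bendIn v B e) := fun s => Multiset.map_map _ _ _
  rw [← Multiset.map_cons (fun b => (b, (1 : T.carrier))), e1, e1] at h1 h2
  exact ⟨h1, h2⟩

variable (q : PrimeK (bend v B e))

/-- The multiplicative set of all `b` for which `b ⊗ 1` does not lie in the given prime. -/
def bendCompl : Submonoid B.carrier where
  carrier := {b | bendMk v B e b 1 ∉ q.carrier}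
  mul_mem' {a b} ha hb := by
    have := q.compl.mul_mem ha hb
    rw [← bendMk_mul, one_mul] at this
    exact this
  one_mem' := q.one_notMem

/-- The map `a / x ↦ (a ⊗ 1) / (x ⊗ 1)`. -/
def bendLocIn : (B.loc (bendCompl q)).carrier →*₀ ((bend v B e).loc q.compl).carrier where
  toFun p := Localization.liftOn p
    (fun a x => (bend v B e).frac q.compl (bendIn v B e a) ⟨bendIn v B e x, x.2⟩) (by
    intro a b x y hr
    rw [Localization.r_iff_exists] at hr
    obtain ⟨r, hr⟩ := hr
    refine frac_eq.2 ⟨⟨bendIn v B e r, r.2⟩, ?_⟩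
    have := congrArg (bendIn v B e) hr
    simpa only [map_mul] using this)
  map_zero' := by
    rw [← frac_zero]
    change (bend v B e).frac q.compl (bendIn v B e 0) ⟨bendIn v B e 1, _⟩ = 0
    rw [← frac_zero]
    simp only [map_zero, map_one]
    rfl
  map_one' := by
    rw [← frac_one]
    change (bend v B e).frac q.compl (bendIn v B e 1) ⟨bendIn v B e 1, _⟩ = 1
    rw [← frac_one]
    simp only [map_one]
    rfl
  map_mul' p r := by
    obtain ⟨a, x, rfl⟩ := frac_surj p
    obtain ⟨b, y, rfl⟩ := frac_surj r
    rw [frac_mul]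
    change (bend v B e).frac q.compl (bendIn v B e (a * b)) ⟨bendIn v B e (x * y), _⟩ =
      (bend v B e).frac q.compl (bendIn v B e a) ⟨bendIn v B e x, _⟩ *
        (bend v B e).frac q.compl (bendIn v B e b) ⟨bendIn v B e y, _⟩
    rw [frac_mul]
    simp only [map_mul]
    rfl

theorem bendLocIn_frac (a : B.carrier) (x : bendCompl q) :
    bendLocIn q (B.frac _ a x) =
      (bend v B e).frac q.compl (bendMk v B e a 1) ⟨bendMk v B e x 1, x.2⟩ := rfl

/-- The bend relations hold in localizations of the bend. -/
theorem bendLocIn_rel {a : (B.loc (bendCompl q)).carrier}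
    {s : Multiset (B.loc (bendCompl q)).carrier} (h : (B.loc (bendCompl q)).rel {a} s) :
    ((bend v B e).loc q.compl).rel ((a ::ₘ s).map (bendLocIn q)) (s.map (bendLocIn q)) ∧
      ((bend v B e).loc q.compl).rel (s.map (bendLocIn q)) ((a ::ₘ s).map (bendLocIn q)) := by
  obtain ⟨x, a', s', h', ha, rfl⟩ := h
  obtain ⟨a', rfl, rfl⟩ := Multiset.map_eq_singleton.1 ha.symm
  have e1 : ∀ r : Multiset B.carrier, (r.map fun c => Localization.mk c x).map (bendLocIn q) =
      (r.map (bendIn v B e)).map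
        fun c => Localization.mk c (⟨bendMk v B e x 1, x.2⟩ : q.compl) := by
    intro r
    refine (Multiset.map_map _ _ _).trans ?_
    symm
    exact Multiset.map_map _ _ _
  have e2 := (e1 (a' ::ₘ s')).symm.trans (congrArg _ (Multiset.map_cons _ _ _))
  obtain ⟨h1, h2⟩ := bendIn_rel (v := v) (e := e) h'
  exact ⟨⟨_, _, _, h1, e2.symm, e1 s'⟩, ⟨_, _, _, h2, e1 s', e2.symm⟩⟩

/-- A morphism `C → S⁻¹B` of `K`-algebras, where `S` consists of the elements of `B` that do not
lie in a prime of the bend of `B`, induces a morphism from the bend of `C` to the local ring of the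
bend of `B`. -/
def bendLocHom (g : Hom C (B.loc (bendCompl q)))
    (hg : ∀ c, g (e' c) = B.frac (bendCompl q) (e c) 1) :
    Hom (bend v C e') ((bend v B e).loc q.compl) :=
  bendLift (v := v) (e := e')
    { toFun := fun p => bendLocIn q (g p.1) * (bend v B e).frac q.compl (bendMk v B e 1 p.2) 1
      map_zero' := by
        change bendLocIn q (g 0) * _ = _
        rw [map_zero, map_zero, zero_mul]
      map_one' := by
        change bendLocIn q (g 1) * (bend v B e).frac q.compl (bendMk v B e 1 1) 1 = _
        rw [map_one, map_one, one_mul, bendMk_one, frac_one]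
      map_mul' := fun p r => by
        change bendLocIn q (g (p.1 * r.1)) *
          (bend v B e).frac q.compl (bendMk v B e 1 (p.2 * r.2)) 1 = _
        have h1 : bendMk v B e 1 (p.2 * r.2) = bendMk v B e 1 p.2 * bendMk v B e 1 r.2 := by
          rw [← bendMk_mul, one_mul]
        rw [map_mul, map_mul, h1, ← mul_one (1 : q.compl), ← frac_mul, mul_one]
        exact mul_mul_mul_comm _ _ _ _ }
    (by
      intro s t h
      have key : ∀ G : C.carrier × T.carrier → ((bend v B e).loc q.compl).carrier,
          (∀ p, G p = bendLocIn q (g p.1) * (bend v B e).frac q.compl (bendMk v B e 1 p.2) 1) →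
          ((bend v B e).loc q.compl).rel (s.map G) (t.map G) := by
        intro G hG
        have h0 : ∀ p : C.carrier × T.carrier, p.1 = 0 ∨ p.2 = 0 → G p = 0 := by
          rintro ⟨c, t⟩ (h | h) <;> obtain rfl := h
          · rw [hG, map_zero, map_zero, zero_mul]
          · rw [hG, bendMk_zero_right, frac_zero, mul_zero]
        have hsc : ∀ c b t, G (e' c * b, t) = G (b, v c * t) := fun c b t => by
          have h1 : bendMk v B e 1 (v c * t) = bendMk v B e (e c) 1 * bendMk v B e 1 t := by
            rw [← bendMk_scalar, mul_one, bendMk_eq (e c) t]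
          rw [hG, hG, map_mul, map_mul, hg, bendLocIn_frac, h1, ← mul_one (1 : q.compl), ← frac_mul,
            mul_one, mul_left_comm, mul_assoc]
          rfl
        have hr : ∀ p p' : C.carrier × T.carrier, G p = G p' →
            ((bend v B e).loc q.compl).rel (({p} : Multiset _).map G)
              (({p'} : Multiset _).map G) := fun p p' h => by
          rw [Multiset.map_singleton, Multiset.map_singleton, h]
          exact rel_refl _ _
        have hT : ∀ t, G (1, t) = (bend v B e).frac q.compl (bendStr v B e t) 1 := fun t => by
          rw [hG, map_one, map_one, one_mul]
          rfl
        have hC : ∀ c, G (c, 1) = bendLocIn q (g c) := fun c => by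
          rw [hG, bendMk_one, frac_one, mul_one]
        have hbase : ∀ s : Multiset T.carrier, (s.map fun x => ((1 : C.carrier), x)).map G =
            (s.map (bendStr v B e)).map fun c => Localization.mk c (1 : q.compl) := fun s => by
          refine (Multiset.map_map _ _ _).trans ((Multiset.map_congr rfl fun t _ => hT t).trans ?_)
          symm
          exact Multiset.map_map _ _ _
        have hbend : ∀ s : Multiset C.carrier, (s.map fun b => (b, (1 : T.carrier))).map G =
            (s.map g).map (bendLocIn q) := fun s => by
          refine (Multiset.map_map _ _ _).trans ((Multiset.map_congr rfl fun t _ => hC t).trans ?_)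
          symm
          exact Multiset.map_map _ _ _
        have hcons : ∀ {a s}, C.rel {a} s →
            (((bend v B e).loc q.compl).rel
              (((a, (1 : T.carrier)) ::ₘ s.map fun b => (b, 1)).map G)
              ((s.map fun b => (b, (1 : T.carrier))).map G)) ∧
            (((bend v B e).loc q.compl).rel
              ((s.map fun b => (b, (1 : T.carrier))).map G)
              (((a, (1 : T.carrier)) ::ₘ s.map fun b => (b, 1)).map G)) := by
          intro a s has
          rw [← Multiset.map_cons (fun b => (b, (1 : T.carrier))), hbend, hbend, Multiset.map_cons]
          have := g.rel has
          rw [Multiset.map_singleton] at this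
          exact bendLocIn_rel q this
        cases h with
        | zero_left t => exact hr _ _ ((h0 _ (.inl rfl)).trans (h0 _ (.inl rfl)).symm)
        | zero_left' t => exact hr _ _ ((h0 _ (.inl rfl)).trans (h0 _ (.inl rfl)).symm)
        | zero_right b => exact hr _ _ ((h0 _ (.inr rfl)).trans (h0 _ (.inl rfl)).symm)
        | zero_right' b => exact hr _ _ ((h0 _ (.inl rfl)).trans (h0 _ (.inr rfl)).symm)
        | scalar c b t => exact hr _ _ (hsc c b t)
        | scalar' c b t => exact hr _ _ (hsc c b t).symm
        | base h =>
          rw [hbase, hbase]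
          exact ⟨1, _, _, (bendStr v B e).rel h, rfl, rfl⟩
        | bend h => exact (hcons h).1
        | bend' h => exact (hcons h).2
      exact key _ fun _ => rfl)

theorem bendLocHom_mk (g : Hom C (B.loc (bendCompl q)))
    (hg : ∀ c, g (e' c) = B.frac (bendCompl q) (e c) 1) (c : C.carrier) (t : T.carrier)
    (b : B.carrier) (x : bendCompl q) (h : g c = B.frac _ b x) :
    bendLocHom q g hg (bendMk v C e' c t) =
      (bend v B e).frac q.compl (bendMk v B e b t) ⟨bendMk v B e x 1, x.2⟩ := by
  change bendLocIn q (g c) * (bend v B e).frac q.compl (bendMk v B e 1 t) 1 = _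
  rw [h, bendLocIn_frac, frac_mul, mul_one, ← bendMk_eq]

/-- The maximal ideal of the local ring at a prime. -/
def PrimeK.locMax {B : OBlp.{u}} (p : PrimeK B) : PrimeK (B.loc p.compl) where
  carrier := {z | ∃ a ∈ p.carrier, ∃ x, z = B.frac p.compl a x}
  zero_mem := ⟨0, p.zero_mem, 1, frac_zero.symm⟩
  mul_mem := by
    rintro _ z ⟨a, ha, x, rfl⟩
    obtain ⟨b, y, rfl⟩ := frac_surj z
    exact ⟨b * a, p.mul_mem b ha, y * x, frac_mul _ _ _ _⟩
  mem_of_rel := by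
    have hmem : ∀ (a : B.carrier) (x : p.compl),
        (∃ a' ∈ p.carrier, ∃ x', B.frac p.compl a x = B.frac p.compl a' x') → a ∈ p.carrier := by
      rintro a x ⟨a', ha', x', e⟩
      obtain ⟨r, hr⟩ := frac_eq.1 e
      have h1 : (r : B.carrier) * (x' * a) ∈ p.carrier :=
        hr ▸ p.mul_mem _ (p.mul_mem _ ha')
      exact ((p.mem_or_mem h1).resolve_left r.2 |> p.mem_or_mem).resolve_left x'.2
    rintro c s t hs ht ⟨x, a, b, hab, ha, hb⟩ ⟨y, b', a', hab', hb', ha'⟩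
    obtain ⟨r, hr⟩ := loc_map_eq B p.compl (ha.symm.trans ha')
    obtain ⟨r', hr'⟩ := loc_map_eq B p.compl (hb.symm.trans hb')
    have h1 := B.rel_smul (r' * (r * y) : B.carrier) hab
    have h2 := B.rel_smul (r' * (r * x) : B.carrier) hab'
    have e1 : b'.map ((r' * (r * x) : B.carrier) * ·) = b.map ((r' * (r * y) : B.carrier) * ·) := by
      have := congrArg (Multiset.map ((r : B.carrier) * ·)) hr'
      rw [Multiset.map_map, Multiset.map_map] at this
      refine Eq.trans ?_ (this.symm.trans ?_) <;>
      · refine Multiset.map_congr rfl fun c _ => ?_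
        simp only [Function.comp_apply, mul_left_comm, mul_assoc]
    have e2 : a'.map ((r' * (r * x) : B.carrier) * ·) = a.map ((r' * (r * y) : B.carrier) * ·) := by
      have := congrArg (Multiset.map ((r' : B.carrier) * ·)) hr
      rw [Multiset.map_map, Multiset.map_map] at this
      refine Eq.trans ?_ (this.symm.trans ?_) <;>
      · refine Multiset.map_congr rfl fun c _ => ?_
        simp only [Function.comp_apply, mul_assoc]
    rw [e1, e2] at h2
    classical
    obtain ⟨a₀, ha₀, hc, hs'⟩ := (Multiset.map_eq_cons _ _ _ _).2 ha.symm
    obtain ⟨a₁, rfl⟩ := Multiset.exists_cons_of_mem ha₀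
    rw [Multiset.erase_cons_head] at hs'
    rw [Multiset.map_cons] at h1 h2
    have h3 : (r' * (r * y) : B.carrier) * a₀ ∈ p.carrier := by
      refine p.mem_of_rel ?_ ?_ h1 h2
      · intro z hz
        obtain ⟨w, hw, rfl⟩ := Multiset.mem_map.1 hz
        refine p.mul_mem _ (hmem w x (hs _ ?_))
        rw [← hs']
        exact Multiset.mem_map_of_mem _ hw
      · intro z hz
        obtain ⟨w, hw, rfl⟩ := Multiset.mem_map.1 hz
        refine p.mul_mem _ (hmem w x (ht _ ?_))
        rw [hb]
        exact Multiset.mem_map_of_mem _ hw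
    refine ⟨a₀, ?_, x, hc.symm⟩
    exact (p.mem_or_mem h3).resolve_left (p.compl.mul_mem r'.2 (p.compl.mul_mem r.2 y.2))
  one_notMem := by
    rintro ⟨a, ha, x, e⟩
    rw [← frac_one, frac_eq] at e
    obtain ⟨r, hr⟩ := e
    have h1 : (r : B.carrier) * (x * 1) ∈ p.carrier := hr ▸ p.mul_mem _ (p.mul_mem _ ha)
    exact p.compl.mul_mem r.2 (p.compl.mul_mem x.2 p.compl.one_mem) h1
  mem_or_mem := by
    intro z z' h
    obtain ⟨a, x, rfl⟩ := frac_surj z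
    obtain ⟨b, y, rfl⟩ := frac_surj z'
    obtain ⟨c, hc, w, e⟩ := h
    rw [frac_mul, frac_eq] at e
    obtain ⟨r, hr⟩ := e
    have h1 : (r : B.carrier) * (w * (a * b)) ∈ p.carrier := hr ▸ p.mul_mem _ (p.mul_mem _ hc)
    have h2 := (p.mem_or_mem ((p.mem_or_mem h1).resolve_left r.2)).resolve_left w.2
    exact (p.mem_or_mem h2).imp (fun h => ⟨a, h, x, rfl⟩) fun h => ⟨b, h, y, rfl⟩

theorem PrimeK.frac_mem_locMax {B : OBlp.{u}} (p : PrimeK B) (a : B.carrier) :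
    B.frac p.compl a 1 ∈ p.locMax.carrier ↔ a ∈ p.carrier := by
  refine ⟨?_, fun h => ⟨a, h, 1, rfl⟩⟩
  rintro ⟨c, hc, w, e⟩
  obtain ⟨r, hr⟩ := frac_eq.1 e
  have h1 : (r : B.carrier) * (w * a) ∈ p.carrier := hr ▸ p.mul_mem _ (p.mul_mem _ hc)
  exact (p.mem_or_mem ((p.mem_or_mem h1).resolve_left r.2)).resolve_left w.2

end OBlp

/-! ### Bends of blue models are glued -/

namespace BlueModel

open OBlp AlgDiag

variable {k : Type (max w u)} [Field k] {Y : Scheme.{max w u}}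
  {f : Y ⟶ AlgebraicGeometry.Spec (.of k)} {J : Type w} [Preorder J] {P : AffinePresentation Y J}
  {B : AlgDiag.{max w u} (OBlp.ofSemiring k) J} {M : BlueModel f P B}

theorem IsFrac.smul {i j : J} {t c h : B.obj i} {b : B.obj j} (H : M.IsFrac i j t c h b)
    (d : B.obj i) : M.IsFrac i j t (d * c) (d * h) b := by
  obtain ⟨hj, e⟩ := H
  exact ⟨hj, by rw [map_mul, map_mul, e, map_mul, map_mul, mul_assoc]⟩

theorem IsFrac.map {i i' j : J} (hle : i ≤ i') {t c h : B.obj i'} {b : B.obj j}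
    (H : M.IsFrac i' j t c h b) :
    M.IsFrac i j (B.map i i' hle t) (B.map i i' hle c) (B.map i i' hle h) b := by
  have h1 : Y.basicOpen (M.ev i (B.map i i' hle t)) ≤ Y.basicOpen (M.ev i' t) := by
    rw [M.ev_map]
    exact (Y.basicOpen_res (M.ev i' t) (homOfLE (P.mono hle)).op).trans_le inf_le_right
  have h2 : Y.basicOpen (M.ev i (B.map i i' hle t)) ≤ P.U i := Y.basicOpen_le _
  have e := H.res h1 (h2.trans (P.mono hle)) (h1.trans H.1)
  refine ⟨h1.trans H.1, ?_⟩
  rw [M.ev_map i i' hle c, M.ev_map i i' hle h, resHom_resHom, resHom_resHom]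
  exact e

variable (M) (v : (OBlp.ofSemiring k).carrier →*₀ tropical.carrier)

/-- The part of the `i`-th chart of the bend that lies in the `j`-th chart. -/
def bendNhd (i j : J) : Opens (PrimeK ((B.bend v).obj i)) :=
  ⨆ t : M.loc i j, PrimeK.basic (bendMk v (B.obj i) (B.str i) t 1)

theorem mem_bendNhd {i j : J} {q : PrimeK ((B.bend v).obj i)} :
    q ∈ M.bendNhd v i j ↔ ∃ t ∈ M.loc i j, t ∈ bendCompl q :=
  Opens.mem_iSup.trans ⟨fun ⟨t, ht⟩ => ⟨t.1, t.2, ht⟩, fun ⟨t, ht, h⟩ => ⟨⟨t, ht⟩, h⟩⟩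

/-- Germs in the chart `i` of the bend of functions on the chart `j`. -/
noncomputable def bendGerm (i j : J) (q : PrimeK ((B.bend v).obj i)) (hq : q ∈ M.bendNhd v i j) :
    OBlp.Hom ((B.bend v).obj j) (((B.bend v).obj i).loc q.compl) :=
  bendLocHom q (M.germ (bendCompl q) ((M.mem_bendNhd v).1 hq)) (M.germ_str _ _)

theorem bendGerm_mk {i j : J} {q : PrimeK ((B.bend v).obj i)} (hq : q ∈ M.bendNhd v i j)
    {t c x : B.obj i} {b : B.obj j} (s : tropical.carrier) (ht : t ∈ bendCompl q)
    (hx : x ∈ bendCompl q) (H : M.IsFrac i j t c x b) :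
    M.bendGerm v i j q hq (bendMk v (B.obj j) (B.str j) b s) =
      ((B.bend v).obj i).frac q.compl (bendMk v (B.obj i) (B.str i) c s)
        ⟨bendMk v (B.obj i) (B.str i) x 1, hx⟩ :=
  bendLocHom_mk q _ _ b s c ⟨x, hx⟩ (M.germ_eq _ _ (h := ⟨x, hx⟩) ht H)

/-- The germ of a function on the chart `i` that is restricted from the larger chart `j` is this
function. -/
theorem bendGerm_map {i j : J} (h : i ≤ j) {q : PrimeK ((B.bend v).obj j)}
    (hq : q ∈ M.bendNhd v j i) (a : (B.bend v).obj j) :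
    M.bendGerm v j i q hq ((B.bend v).map i j h a) = ((B.bend v).obj j).frac q.compl a 1 := by
  obtain ⟨b, s, rfl⟩ := bendMk_surjective a
  obtain ⟨t, ht, htq⟩ := (M.mem_bendNhd v).1 hq
  have H : M.IsFrac j i t b 1 (B.map i j h b) := ⟨M.basicOpen_le ht, by
    rw [map_one, map_one, one_mul, M.ev_map, resHom_resHom]⟩
  refine (M.bendGerm_mk v hq s htq (bendCompl q).one_mem H).trans ?_
  exact congrArg _ (Subtype.ext bendMk_one)

/-- Primes in the part of the chart `j` that lies in a smaller chart `i` come from this chart. -/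
theorem exists_comap_eq {i j : J} (h : i ≤ j) {q : PrimeK ((B.bend v).obj j)}
    (hq : q ∈ M.bendNhd v j i) :
    ∃ p : PrimeK ((B.bend v).obj i), p.comap ((B.bend v).map i j h) = q := by
  -- The closed point of the local ring at `q`, pulled back along the germs.
  refine ⟨q.locMax.comap (M.bendGerm v j i q hq), PrimeK.ext (Set.ext fun a => ?_)⟩
  change M.bendGerm v j i q hq ((B.bend v).map i j h a) ∈ q.locMax.carrier ↔ _
  rw [M.bendGerm_map v h hq]
  exact q.frac_mem_locMax a

/-- The gluing data of the bend of a blue model. It remains to be verified that the overlaps of the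
charts are compatible with the transition maps, and that they are overlaps in the colimit. -/
noncomputable def glued
    (mem_comap : ∀ (i i' j : J) (h : i ≤ i') (q : PrimeK ((B.bend v).obj i)),
      q ∈ M.bendNhd v i j → q.comap ((B.bend v).map i i' h) ∈ M.bendNhd v i' j)
    (exists_eq : ∀ (i j : J) (q : PrimeK ((B.bend v).obj i)), q ∈ M.bendNhd v i j →
      ∃ p : PrimeK ((B.bend v).obj j),
        ((B.bend v).incl j).toFun p = ((B.bend v).incl i).toFun q) :
    Glued.{u, w} (B.bend v) where
  N := M.bendNhd v
  germ := M.bendGerm v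
  germ_frac i j a q hq := by
    obtain ⟨b, s, rfl⟩ := bendMk_surjective a
    obtain ⟨t, ht, htq⟩ := (M.mem_bendNhd v).1 hq
    obtain ⟨N, hN⟩ := M.exists_common_denom ht {b}
    obtain ⟨c, hc⟩ := hN b (Multiset.mem_singleton_self b)
    refine ⟨bendMk v _ _ (t * c) s, bendMk v _ _ (t * t ^ N) 1,
      (bendCompl q).mul_mem htq ((bendCompl q).pow_mem htq N), fun q' hq' hh => ?_⟩
    have htq' : t ∈ bendCompl q' := fun hmem => hh (by
      have := q'.mul_mem (bendMk v (B.obj i) (B.str i) (t ^ N) 1) hmem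
      refine (congrArg (· ∈ q'.carrier) ?_).mp this
      refine (bendMk_mul _ _ _ _).symm.trans ?_
      rw [mul_one, mul_comm])
    exact M.bendGerm_mk v hq' s htq' hh (hc.smul t)
  mem_self j q := (M.mem_bendNhd v).2 ⟨1, M.one_mem j, (bendCompl q).one_mem⟩
  germ_self j q hq a := by
    have := M.bendGerm_map v le_rfl hq a
    rwa [(B.bend v).map_id] at this
  germ_str i j q hq s := by
    obtain ⟨t, ht, htq⟩ := (M.mem_bendNhd v).1 hq
    have H : M.IsFrac i j t 1 1 (1 : B.obj j) := ⟨M.basicOpen_le ht, by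
      rw [map_one, map_one, map_one, map_one, one_mul]⟩
    refine (M.bendGerm_mk v hq s htq (bendCompl q).one_mem H).trans ?_
    exact congrArg _ (Subtype.ext bendMk_one)
  mem_comap i i' j h q := by
    refine ⟨fun hq => ?_, mem_comap i i' j h q⟩
    obtain ⟨t, ht, htq⟩ := (M.mem_bendNhd v).1 hq
    exact (M.mem_bendNhd v).2 ⟨_, M.map_mem h ht, htq⟩
  germ_comap i i' j h q hq hq' a := by
    obtain ⟨b, s, rfl⟩ := bendMk_surjective a
    obtain ⟨t, c, x, ht, H⟩ := M.exists_isFrac (bendCompl _) ((M.mem_bendNhd v).1 hq') b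
    have e1 := M.bendGerm_mk v hq' s ht x.2 H
    have e2 := M.bendGerm_mk v hq s (show B.map i i' h t ∈ bendCompl q from ht)
      (show B.map i i' h x.1 ∈ bendCompl q from x.2) (H.map h)
    exact (congrArg _ e1).trans e2.symm
  germ_map i j h q hq a := M.bendGerm_map v h hq a
  exists_eq := exists_eq

end BlueModel

open OBlp AlgDiag

namespace OBlp

/-- If `a ≤ ∑ b_j`, then a prime of the bend that contains all `b_j` contains `a`. -/
theorem bendMk_mem_of_rel {K : OBlp.{u₁}} {T : OBlp.{v}} {v : K.carrier →*₀ T.carrier}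
    {B : OBlp.{u₂}} {e : Hom K B} (q : PrimeK (bend v B e)) {a : B.carrier}
    {s : Multiset B.carrier} (h : B.rel {a} s) (hs : ∀ b ∈ s, bendMk v B e b 1 ∈ q.carrier) :
    bendMk v B e a 1 ∈ q.carrier := by
  obtain ⟨h1, h2⟩ := bendIn_rel (v := v) (e := e) h
  rw [Multiset.map_cons] at h1 h2
  have hs' : ∀ b ∈ s.map (bendIn v B e), b ∈ q.carrier := fun b hb => by
    obtain ⟨c, hc, rfl⟩ := Multiset.mem_map.1 hb
    exact hs c hc
  exact q.mem_of_rel hs' hs' h1 h2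

end OBlp

/-! ### The gluing data of the bend of a scheme -/

section

variable {k : Type u} [Field k] {Y : Scheme.{u}} (f : Y ⟶ AlgebraicGeometry.Spec (.of k))
  {J : Type w} [Preorder J] (P : AffinePresentation Y J)

/-- A scheme as a blue model of itself. -/
def schemeModel : BlueModel f P (schemeDiag f P) where
  ev j := (RingHom.id Γ(Y, P.U j)).toMonoidWithZeroHom
  ev_injective _ _ _ h := h
  rel_iff j s t := by
    have : ∀ s : Multiset Γ(Y, P.U j), s.map (RingHom.id Γ(Y, P.U j)).toMonoidWithZeroHom = s :=
      fun s => Multiset.map_id s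
    exact (iff_of_eq (congrArg₂ (fun s t : Multiset Γ(Y, P.U j) => s.sum = t.sum) (this s)
      (this t))).symm
  ev_map _ _ _ _ := rfl
  ev_str _ _ := rfl
  loc i j := {s | Y.basicOpen (show Γ(Y, P.U i) from s) ≤ P.U j}
  basicOpen_le h := h
  exists_frac {i j s} hs b := by
    obtain ⟨n, c, e⟩ := exists_eq_pow_mul_of_isAffineOpen Y (P.U i) (P.isAffineOpen i) s
      (resHom Y hs b)
    exact ⟨n, c, e⟩
  one_mem j := Y.basicOpen_le _
  map_mem {i i' j} h s hs := by
    change Y.basicOpen (resHom Y (P.mono h) s) ≤ P.U j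
    exact ((Y.basicOpen_res _ (homOfLE (P.mono h)).op).trans_le inf_le_right).trans hs

theorem mem_basicOpen_resHom {U V : Y.Opens} (h : V ≤ U) (a : Γ(Y, U)) {x : Y} (hx : x ∈ V) :
    x ∈ Y.basicOpen (resHom Y h a) ↔ x ∈ Y.basicOpen a := by
  have e : Y.basicOpen (resHom Y h a) = V ⊓ Y.basicOpen a := Y.basicOpen_res _ (homOfLE h).op
  rw [e]
  exact ⟨fun h => h.2, fun h => ⟨hx, h⟩⟩

/-- The point of an affine open subset that corresponds to a prime ideal. -/
theorem exists_mem_basicOpen_iff {U : Y.Opens} (hU : IsAffineOpen U) (I : Ideal Γ(Y, U))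
    [hI : I.IsPrime] : ∃ x ∈ U, ∀ a : Γ(Y, U), x ∈ Y.basicOpen a ↔ a ∉ I := by
  have key : ∀ a : Γ(Y, U), hU.fromSpec ⟨I, hI⟩ ∈ Y.basicOpen a ↔ a ∉ I := fun a => by
    have h1 : (⟨I, hI⟩ : PrimeSpectrum Γ(Y, U)) ∈ hU.fromSpec ⁻¹ᵁ Y.basicOpen a ↔ a ∉ I := by
      rw [hU.fromSpec_preimage_basicOpen]
      exact Iff.rfl
    exact h1
  exact ⟨_, Y.basicOpen_le 1 ((key 1).2 hI.one_notMem), key⟩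

theorem eq_of_mem_basicOpen_iff {U : Y.Opens} (hU : IsAffineOpen U) {x y : Y} (hx : x ∈ U)
    (hy : y ∈ U) (h : ∀ a : Γ(Y, U), x ∈ Y.basicOpen a ↔ y ∈ Y.basicOpen a) : x = y := by
  have key : ∀ {x y : Y}, x ∈ U → (∀ a : Γ(Y, U), x ∈ Y.basicOpen a → y ∈ Y.basicOpen a) →
      ∀ V : Set Y, IsOpen V → x ∈ V → y ∈ V := by
    intro x y hx h V hV hxV
    obtain ⟨a, ha, hxa⟩ := hU.exists_basicOpen_le (V := ⟨V, hV⟩) ⟨x, hxV⟩ hx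
    exact ha (h a hxa)
  exact Inseparable.eq (inseparable_iff_forall_isOpen.2 fun V hV =>
    ⟨key hx (fun a => (h a).1) V hV, key hy (fun a => (h a).2) V hV⟩)

variable {f P} (v : (OBlp.ofSemiring k).carrier →*₀ tropical.carrier)

/-- The prime `q` of the bend of `ΓU_j` lies over the point `x` of `Y`. -/
def LiesOver {j : J} (q : PrimeK (((schemeDiag f P).bend v).obj j)) (x : Y) : Prop :=
  x ∈ P.U j ∧ ∀ a : Γ(Y, P.U j), x ∈ Y.basicOpen a ↔
    bendMk v ((schemeDiag f P).obj j) ((schemeDiag f P).str j) a 1 ∉ q.carrier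

/-- The elements of `ΓU_j` that lie in a prime of the bend form a prime ideal: the bend relation of
`a + b` shows that the set is closed under addition. -/
theorem exists_liesOver {j : J} (q : PrimeK (((schemeDiag f P).bend v).obj j)) :
    ∃ x, LiesOver v q x := by
  let I : Ideal Γ(Y, P.U j) :=
    { carrier := {a | bendMk v ((schemeDiag f P).obj j) ((schemeDiag f P).str j) a 1 ∈ q.carrier}
      zero_mem' := (congrArg (· ∈ q.carrier) (bendMk_zero_left 1)).mpr q.zero_mem
      add_mem' := fun {a b} ha hb => by
        refine bendMk_mem_of_rel (B := (schemeDiag f P).obj j) q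
          (s := (show Multiset Γ(Y, P.U j) from {a, b})) ?_ fun c hc => ?_
        · change Multiset.sum (M := Γ(Y, P.U j)) {a + b} = Multiset.sum (M := Γ(Y, P.U j)) {a, b}
          simp
        · rcases Multiset.mem_cons.1 hc with rfl | hc
          · exact ha
          · obtain rfl := Multiset.mem_singleton.1 hc
            exact hb
      smul_mem' := fun c a ha => by
        refine (congrArg (· ∈ q.carrier) ?_).mp (q.mul_mem
          (bendMk v ((schemeDiag f P).obj j) ((schemeDiag f P).str j) c 1) ha)
        refine (bendMk_mul _ _ _ _).symm.trans ?_
        rw [mul_one]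
        rfl }
  have hI : I.IsPrime := by
    refine ⟨fun h => ?_, fun {a b} h => q.mem_or_mem ?_⟩
    · exact q.one_notMem ((Ideal.eq_top_iff_one I).1 h)
    · refine (congrArg (· ∈ q.carrier) ?_).mp (show _ ∈ q.carrier from h)
      refine Eq.trans ?_ (bendMk_mul _ _ _ _)
      rw [mul_one]
      rfl
  obtain ⟨x, hx, h⟩ := exists_mem_basicOpen_iff (P.isAffineOpen j) I
  exact ⟨x, hx, h⟩

variable {v}

theorem LiesOver.comap {i j : J} (h : i ≤ j) {q : PrimeK (((schemeDiag f P).bend v).obj i)} {x : Y}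
    (hx : LiesOver v q x) : LiesOver v (q.comap (((schemeDiag f P).bend v).map i j h)) x :=
  ⟨P.mono h hx.1, fun a => (mem_basicOpen_resHom (P.mono h) a hx.1).symm.trans (hx.2 _)⟩

theorem LiesOver.eq {j : J} {q : PrimeK (((schemeDiag f P).bend v).obj j)} {x y : Y}
    (hx : LiesOver v q x) (hy : LiesOver v q y) : x = y :=
  eq_of_mem_basicOpen_iff (P.isAffineOpen j) hx.1 hy.1 fun a => (hx.2 a).trans (hy.2 a).symm

end

section

variable {k : Type (max w u)} [Field k] {Y : Scheme.{max w u}}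
  {f : Y ⟶ AlgebraicGeometry.Spec (.of k)} {J : Type w} [Preorder J] {P : AffinePresentation Y J}
  {v : (OBlp.ofSemiring k).carrier →*₀ tropical.carrier}

/-- The overlap of two charts of the bend lies over the overlap of the charts of the scheme. -/
theorem LiesOver.mem_bendNhd_iff {i j : J} {q : PrimeK (((schemeDiag f P).bend v).obj i)} {x : Y}
    (hx : LiesOver v q x) : q ∈ (schemeModel f P).bendNhd v i j ↔ x ∈ P.U j := by
  rw [BlueModel.mem_bendNhd]
  constructor
  · rintro ⟨t, ht, htq⟩
    exact ht ((hx.2 t).2 htq)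
  · intro hxj
    obtain ⟨t, ht, hxt⟩ := (P.isAffineOpen i).exists_basicOpen_le ⟨x, hxj⟩ hx.1
    exact ⟨t, ht, (hx.2 t).1 hxt⟩

/-- The bend of a scheme is glued from the bends of the charts. -/
noncomputable def schemeGlued (f : Y ⟶ AlgebraicGeometry.Spec (.of k)) (P : AffinePresentation Y J)
    (v : (OBlp.ofSemiring k).carrier →*₀ tropical.carrier) :
    Glued.{u, w} ((schemeDiag f P).bend v) :=
  (schemeModel f P).glued v
    (fun i i' j h q hq => by
      obtain ⟨x, hx⟩ := exists_liesOver v q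
      exact (hx.comap h).mem_bendNhd_iff.2 (hx.mem_bendNhd_iff.1 hq))
    (fun i j q hq => by
      obtain ⟨x, hx⟩ := exists_liesOver v q
      -- Primes over `x` are transported along a zigzag of charts that contain `x`.
      have key : ∀ i j : {j // x ∈ P.U j}, Relation.EqvGen (fun i j => i.1 ≤ j.1) i j →
          (∀ q : PrimeK (((schemeDiag f P).bend v).obj i.1), LiesOver v q x →
            ∃ p : PrimeK (((schemeDiag f P).bend v).obj j.1), LiesOver v p x ∧
              (((schemeDiag f P).bend v).incl j.1).toFun p =
                (((schemeDiag f P).bend v).incl i.1).toFun q) ∧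
          (∀ q : PrimeK (((schemeDiag f P).bend v).obj j.1), LiesOver v q x →
            ∃ p : PrimeK (((schemeDiag f P).bend v).obj i.1), LiesOver v p x ∧
              (((schemeDiag f P).bend v).incl i.1).toFun p =
                (((schemeDiag f P).bend v).incl j.1).toFun q) := by
        intro i j hij
        induction hij with
        | rel i j h =>
          have hpt : ∀ q, (((schemeDiag f P).bend v).incl j.1).toFun
              (q.comap (((schemeDiag f P).bend v).map i.1 j.1 h)) =
                (((schemeDiag f P).bend v).incl i.1).toFun q := fun q =>
            OBSpace.colimPt_map (fun j => OBlp.Spec (((schemeDiag f P).bend v).obj j))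
              (fun i j h => OBlp.specMap (((schemeDiag f P).bend v).map i j h)) h q
          refine ⟨fun q hq => ⟨_, hq.comap h, hpt q⟩, fun q hq => ?_⟩
          obtain ⟨p, rfl⟩ := (schemeModel f P).exists_comap_eq v h (hq.mem_bendNhd_iff.2 i.2)
          obtain ⟨y, hy⟩ := exists_liesOver v p
          obtain rfl := (hy.comap h).eq hq
          exact ⟨p, hy, (hpt p).symm⟩
        | refl i => exact ⟨fun q hq => ⟨q, hq, rfl⟩, fun q hq => ⟨q, hq, rfl⟩⟩
        | symm i j _ ih => exact ih.symm
        | trans i j l _ _ ih ih' =>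
          refine ⟨fun q hq => ?_, fun q hq => ?_⟩
          · obtain ⟨p, hp, e⟩ := ih.1 q hq
            obtain ⟨p', hp', e'⟩ := ih'.1 p hp
            exact ⟨p', hp', e'.trans e⟩
          · obtain ⟨p, hp, e⟩ := ih'.2 q hq
            obtain ⟨p', hp', e'⟩ := ih.2 p hp
            exact ⟨p', hp', e'.trans e⟩
      obtain ⟨p, -, e⟩ := (key _ _ (P.connected x ⟨i, hx.1⟩ ⟨j, hx.mem_bendNhd_iff.1 hq⟩)).1 q hx
      exact ⟨p, e⟩)

end

/-! ### Faces and monomials -/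

section Faces

variable {n : ℕ}

theorem pair_castVec_neg (u : Fin n → ℤ) (y : Fin n → ℝ) :
    pair (castVec (-u)) y = -pair (castVec u) y := by
  simp [pair, castVec]

/-- The face of a cone of the fan that is cut out by an element of the dual monoid. -/
theorem Fan.exists_face (Δ : Fan n) (σ : Δ.cones) (u : dualMonoid σ.1) :
    ∃ ρ : Δ.cones, ∀ y, y ∈ ρ.1 ↔ y ∈ σ.1 ∧ pair (castVec (u : Fin n → ℤ)) y = 0 := by
  let ρ : PointedCone ℝ (Fin n → ℝ) :=
    { carrier := {y | y ∈ σ.1 ∧ pair (castVec (u : Fin n → ℤ)) y = 0}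
      zero_mem' := ⟨σ.1.zero_mem, by simp [pair]⟩
      add_mem' := fun {a b} ha hb =>
        ⟨σ.1.add_mem ha.1 hb.1, by rw [pair_add_right, ha.2, hb.2, add_zero]⟩
      smul_mem' := fun r a ha => ⟨Submodule.smul_mem σ.1 r ha.1, by
        change pair _ ((r : ℝ) • a) = 0
        rw [pair_smul_right, ha.2, mul_zero]⟩ }
  exact ⟨⟨ρ, Δ.face_mem _ σ.2 ρ ⟨_, u.2, fun y => Iff.rfl⟩⟩, fun y => Iff.rfl⟩

/-- The monomial in `A_τ` with exponent `u`. -/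
def toricChar {τ : PointedCone ℝ (Fin n → ℝ)} (u : dualMonoid τ) : ToricMonoid τ :=
  ((Multiplicative.ofAdd u : Multiplicative (dualMonoid τ)) : WithZero _)

theorem toricChar_add {τ : PointedCone ℝ (Fin n → ℝ)} (u u' : dualMonoid τ) :
    toricChar (u + u') = toricChar u * toricChar u' := rfl

theorem toricChar_nsmul {τ : PointedCone ℝ (Fin n → ℝ)} (N : ℕ) (u : dualMonoid τ) :
    toricChar (N • u) = toricChar u ^ N := rfl

theorem toricMonoidMap_char {σ τ : PointedCone ℝ (Fin n → ℝ)} (h : σ ≤ τ) (u : dualMonoid τ) :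
    toricMonoidMap h (toricChar u) =
      toricChar (AddSubmonoid.inclusion (dualMonoid_anti h) u) := rfl

theorem eq_zero_or_exists_toricChar {τ : PointedCone ℝ (Fin n → ℝ)} (a : ToricMonoid τ) :
    a = 0 ∨ ∃ u, a = toricChar u := by
  induction a using WithZero.recZeroCoe with
  | zero => exact .inl rfl
  | coe a => exact .inr ⟨a.toAdd, rfl⟩

/-- If `u` cuts out the face `σ` of `τ`, then all elements of `A_σ` become elements of `A_τ` after
multiplication with a power of the monomial of `u`. -/
theorem exists_toricMonoidMap_eq {σ τ : PointedCone ℝ (Fin n → ℝ)} (hτ : IsRatCone τ) (h : σ ≤ τ)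
    (u : dualMonoid τ) (hu : ∀ y, y ∈ σ ↔ y ∈ τ ∧ pair (castVec (u : Fin n → ℤ)) y = 0)
    (a : ToricMonoid σ) : ∃ (N : ℕ) (b : ToricMonoid τ),
      toricMonoidMap h b = toricMonoidMap h (toricChar u) ^ N * a := by
  rcases eq_zero_or_exists_toricChar a with rfl | ⟨m, rfl⟩
  · exact ⟨0, 0, by simp⟩
  · obtain ⟨N, hN⟩ := exists_add_nsmul_mem hτ u.2 hu m.2
    refine ⟨N, toricChar ⟨_, hN⟩, ?_⟩
    rw [toricMonoidMap_char, toricMonoidMap_char, ← toricChar_nsmul, ← toricChar_add]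
    exact congrArg _ (Subtype.ext (add_comm _ _))

/-- If the face of `σ` that is cut out by `u` is contained in the zero set of `u'`, then the monomial
of `u'` divides a power of the monomial of `u`. -/
theorem exists_toricChar_mul_eq {σ ρ : PointedCone ℝ (Fin n → ℝ)} (hσ : IsRatCone σ)
    (u u' : dualMonoid σ) (hu : ∀ y, y ∈ ρ ↔ y ∈ σ ∧ pair (castVec (u : Fin n → ℤ)) y = 0)
    (hu' : ∀ y ∈ ρ, pair (castVec (u' : Fin n → ℤ)) y = 0) :
    ∃ (N : ℕ) (b : ToricMonoid σ), toricChar u' * b = toricChar u ^ N := by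
  have hm : -(u' : Fin n → ℤ) ∈ dualMonoid ρ := fun y hy => by
    rw [pair_castVec_neg, hu' y hy, neg_zero]
  obtain ⟨N, hN⟩ := exists_add_nsmul_mem hσ u.2 hu hm
  refine ⟨N, toricChar ⟨_, hN⟩, ?_⟩
  rw [← toricChar_nsmul, ← toricChar_add]
  refine congrArg _ (Subtype.ext ?_)
  change (u' : Fin n → ℤ) + (-(u' : Fin n → ℤ) + N • (u : Fin n → ℤ)) = N • (u : Fin n → ℤ)
  rw [add_neg_cancel_left]

end Faces

/-! ### The gluing data of the bend of the blue model of a toric subscheme -/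

section Blue

variable {k : Type u} [Field k] {n : ℕ} {Δ : Fan n} {Y : Scheme.{u}} (ι : Y ⟶ toricVariety k Δ)

/-- The part of `Y_σ` where a monomial does not vanish lies in the piece of the corresponding
face. -/
theorem basicOpen_subΓ_le {ρ σ : Δ.cones} (h : ρ ≤ σ) (u : dualMonoid σ.1)
    (hu : ∀ y, y ∈ ρ.1 ↔ y ∈ σ.1 ∧ pair (castVec (u : Fin n → ℤ)) y = 0) :
    Y.basicOpen (subΓ ι σ (toricMonomial k σ.1 (toricChar u))) ≤ subOpen ι ρ := by
  intro x hx
  obtain ⟨y, hy⟩ := (mem_toricOpen k Δ σ (ι x)).1 (Y.basicOpen_le _ hx)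
  set g : Γ(toricVariety k Δ, toricOpen k Δ σ) := (toricΓ k Δ σ).hom
    (AddMonoidAlgebra.single u (1 : k)) with hg
  have h1 : ι x ∈ (toricVariety k Δ).basicOpen g := by
    have : x ∈ ι ⁻¹ᵁ (toricVariety k Δ).basicOpen g := by
      rw [Scheme.preimage_basicOpen]
      exact hx
    exact this
  have h2 : y ∈ (AlgebraicGeometry.Spec (.of (ToricRing k σ.1))).basicOpen
      ((Scheme.ΓSpecIso (.of (ToricRing k σ.1))).inv.hom (AddMonoidAlgebra.single u (1 : k))) := by
    have e : ((toricChart k Δ σ).appLE (toricOpen k Δ σ) ⊤ (toricOpen_top k Δ σ)).hom g =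
        (Scheme.ΓSpecIso (.of (ToricRing k σ.1))).inv.hom (AddMonoidAlgebra.single u (1 : k)) :=
      congrArg (fun f => f.hom (AddMonoidAlgebra.single u (1 : k)))
        (toricΓ_appLE k Δ σ (toricOpen_top k Δ σ))
    rw [← e]
    have h3 : y ∈ toricChart k Δ σ ⁻¹ᵁ (toricVariety k Δ).basicOpen g := by
      change toricChart k Δ σ y ∈ (toricVariety k Δ).basicOpen g
      rw [hy]
      exact h1
    rw [Scheme.preimage_basicOpen] at h3
    exact (mem_basicOpen_resHom (toricOpen_top k Δ σ) _ trivial).2 h3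
  rw [AlgebraicGeometry.basicOpen_eq_of_affine] at h2
  obtain ⟨z, hz⟩ := (Δ.mem_range_toricMap k σ.2 (show ρ.1 ≤ σ.1 from h) u hu y).2 h2
  refine (mem_toricOpen k Δ ρ (ι x)).2 ⟨z, ?_⟩
  rw [← toricMap_toricChart k Δ h, ← hy]
  exact congrArg _ hz

/-- The element of `B_τ` that is given by a monomial. -/
noncomputable def blueMonomial (τ : Δ.cones) : ToricMonoid τ.1 →*₀ ((blueDiag ι).obj τ).carrier where
  toFun a := ⟨blueHom ι τ (1, a), ⟨(1, a), rfl⟩⟩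
  map_zero' := Subtype.ext (show subΓ ι τ (toricStr k τ.1 1 * toricMonomial k τ.1 0) = 0 by simp)
  map_one' := Subtype.ext (map_one (blueHom ι τ))
  map_mul' a b := Subtype.ext (by
    refine Eq.trans (congrArg (blueHom ι τ) ?_) (map_mul (blueHom ι τ) (1, a) (1, b))
    rw [Prod.mk_mul_mk, one_mul])

theorem blueMonomial_coe (τ : Δ.cones) (a : ToricMonoid τ.1) :
    (blueMonomial ι τ a).1 = subΓ ι τ (toricMonomial k τ.1 a) := by
  change subΓ ι τ (toricStr k τ.1 1 * toricMonomial k τ.1 a) = _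
  rw [map_one, one_mul]

theorem map_blueMonomial {σ τ : Δ.cones} (h : σ ≤ τ) (a : ToricMonoid τ.1) :
    (blueDiag ι).map σ τ h (blueMonomial ι τ a) =
      blueMonomial ι σ (toricMonoidMap (show σ.1 ≤ τ.1 from h) a) :=
  Subtype.ext (resHom_blueHom ι h (1, a))

/-- The blueprint `B_τ` is generated by scalars and monomials. -/
theorem exists_eq_str_mul_blueMonomial (τ : Δ.cones) (b : (blueDiag ι).obj τ) :
    ∃ (c : (OBlp.ofSemiring k).carrier) (a : ToricMonoid τ.1),
      b = (blueDiag ι).str τ c * blueMonomial ι τ a := by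
  obtain ⟨⟨c, a⟩, hp⟩ := b.2
  refine ⟨c, a, Subtype.ext (hp.symm.trans ?_)⟩
  change subΓ ι τ (toricStr k τ.1 c * toricMonomial k τ.1 a) =
    kstr (ι ≫ toricToSpec k Δ) (subOpen ι τ) c * (blueMonomial ι τ a).1
  rw [blueMonomial_coe, map_mul, subΓ_str]

variable [IsClosedImmersion ι]

/-- The blue model of a closed subscheme of a toric variety. The elements of `loc σ τ` are the monomials
of those `u` that cut out a face of `σ` which is contained in `τ`. -/
noncomputable def toricModel : BlueModel (ι ≫ toricToSpec k Δ) (toricPresentation ι) (blueDiag ι) where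
  ev τ := blueIncl ι τ
  ev_injective τ _ _ h := Subtype.ext h
  rel_iff τ s t := ⟨fun h => h (), fun h _ => h⟩
  ev_map _ _ _ _ := rfl
  ev_str _ _ := rfl
  loc σ τ := {s | ∃ u : dualMonoid σ.1,
    (∀ y ∈ σ.1, pair (castVec (u : Fin n → ℤ)) y = 0 → y ∈ τ.1) ∧ s = blueMonomial ι σ (toricChar u)}
  basicOpen_le {σ τ s} hs := by
    obtain ⟨u, hu, rfl⟩ := hs
    obtain ⟨ρ, hρ⟩ := Δ.exists_face σ u
    have hle : ρ ≤ σ := fun y hy => ((hρ y).1 hy).1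
    have hle' : ρ ≤ τ := fun y hy => hu y ((hρ y).1 hy).1 ((hρ y).1 hy).2
    change Y.basicOpen (blueMonomial ι σ (toricChar u)).1 ≤ _
    rw [blueMonomial_coe]
    exact (basicOpen_subΓ_le ι hle u hρ).trans (subOpen_mono ι hle')
  exists_frac {σ τ s} hs b := by
    obtain ⟨u, hu, rfl⟩ := hs
    obtain ⟨ρ, hρ⟩ := Δ.exists_face σ u
    have hle : ρ ≤ σ := fun y hy => ((hρ y).1 hy).1
    have hle' : ρ ≤ τ := fun y hy => hu y ((hρ y).1 hy).1 ((hρ y).1 hy).2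
    have hD : Y.basicOpen (blueMonomial ι σ (toricChar u)).1 ≤ subOpen ι ρ := by
      rw [blueMonomial_coe]
      exact basicOpen_subΓ_le ι hle u hρ
    obtain ⟨c, a, rfl⟩ := exists_eq_str_mul_blueMonomial ι τ b
    obtain ⟨N, a', ha'⟩ := exists_toricMonoidMap_eq (Δ.isRatCone σ.1 σ.2) hle u hρ
      (toricMonoidMap (show ρ.1 ≤ τ.1 from hle') a)
    have e : (blueDiag ι).map ρ σ hle ((blueDiag ι).str σ c * blueMonomial ι σ a') =
        (blueDiag ι).map ρ σ hle (blueMonomial ι σ (toricChar u)) ^ N *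
          (blueDiag ι).map ρ τ hle' ((blueDiag ι).str τ c * blueMonomial ι τ a) := by
      rw [map_mul, map_mul, (blueDiag ι).map_str, (blueDiag ι).map_str, map_blueMonomial,
        map_blueMonomial, map_blueMonomial, ha', map_mul, map_pow]
      exact mul_left_comm _ _ _
    have e' := congrArg (fun z => resHom Y hD (blueIncl ι ρ z)) e
    refine ⟨N, (blueDiag ι).str σ c * blueMonomial ι σ a', ?_⟩
    have h1 : ∀ (κ : Δ.cones) (hκ : ρ ≤ κ) (z : (blueDiag ι).obj κ),
        resHom Y hD (blueIncl ι ρ ((blueDiag ι).map ρ κ hκ z)) =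
          resHom Y (hD.trans (subOpen_mono ι hκ)) (blueIncl ι κ z) := fun κ hκ z =>
      resHom_resHom _ _ _
    have h2 : ∀ z z' : (blueDiag ι).obj ρ, resHom Y hD (blueIncl ι ρ (z ^ N * z')) =
        resHom Y hD (blueIncl ι ρ z) ^ N * resHom Y hD (blueIncl ι ρ z') := fun z z' =>
      (congrArg _ (map_mul (blueIncl ι ρ) (z ^ N) z')).trans ((map_mul (resHom Y hD) _ _).trans
        (congrArg (· * _) ((congrArg _ (map_pow (blueIncl ι ρ) z N)).trans (map_pow _ _ _))))
    exact (h1 σ hle _).symm.trans (e'.trans ((h2 _ _).trans (congrArg₂ (fun x y => x ^ N * y)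
      (h1 σ hle _) (h1 τ hle' _))))
  one_mem τ := ⟨0, fun y hy _ => hy, (map_one (blueMonomial ι τ)).symm⟩
  map_mem {σ σ' τ} h s hs := by
    obtain ⟨u, hu, rfl⟩ := hs
    exact ⟨AddSubmonoid.inclusion (dualMonoid_anti (show σ.1 ≤ σ'.1 from h)) u,
      fun y hy => hu y (h hy), map_blueMonomial ι h _⟩

end Blue

/-- The bend of the blue model of a toric subscheme is glued from the bends of the charts. -/
noncomputable def toricGlued {k : Type u} [Field k] {n : ℕ} {Δ : Fan n} {Y : Scheme.{u}}
    (ι : Y ⟶ toricVariety k Δ) [IsClosedImmersion ι]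
    (v : (OBlp.ofSemiring k).carrier →*₀ tropical.carrier) :
    Glued.{u, 0} ((blueDiag ι).bend v) :=
  BlueModel.glued.{u, 0} (toricModel ι) v
    (fun σ σ' τ h q hq => by
      obtain ⟨_, ⟨u, hu, rfl⟩, htq⟩ := ((toricModel ι).mem_bendNhd v).1 hq
      obtain ⟨ρ, hρ⟩ := Δ.exists_face σ u
      have hle : ρ ≤ σ := fun y hy => ((hρ y).1 hy).1
      have hle' : ρ ≤ τ := fun y hy => hu y ((hρ y).1 hy).1 ((hρ y).1 hy).2
      -- The face `ρ` of `σ` is also a face of `σ'`, cut out by some `u'`. The monomial of `u'` divides a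
      -- power of the monomial of `u`, so that it does not lie in the prime either.
      obtain ⟨u', hu'⟩ := Δ.exists_form ρ.2 σ'.2 (hle.trans h)
      refine ((toricModel ι).mem_bendNhd v).2 ⟨blueMonomial ι σ' (toricChar u'),
        ⟨u', fun y hy hy' => hle' ((hu' y).2 ⟨hy, hy'⟩), rfl⟩, ?_⟩
      change (blueDiag ι).map σ σ' h (blueMonomial ι σ' (toricChar u')) ∈ bendCompl q
      rw [map_blueMonomial, toricMonoidMap_char]
      obtain ⟨N, b, e⟩ := exists_toricChar_mul_eq (Δ.isRatCone σ.1 σ.2) u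
        (AddSubmonoid.inclusion (dualMonoid_anti (show σ.1 ≤ σ'.1 from h)) u') hρ
        fun y hy => ((hu' y).1 hy).2
      have h1 : blueMonomial ι σ (toricChar u) ^ N ∈ bendCompl q := (bendCompl q).pow_mem htq N
      rw [← map_pow, ← e, map_mul, mul_comm] at h1
      intro hmem
      refine h1 ((congrArg (· ∈ q.carrier) ?_).mp (q.mul_mem (bendMk v _ _ (blueMonomial ι σ b) 1)
        hmem))
      refine (bendMk_mul _ _ _ _).symm.trans ?_
      rw [mul_one])
    (fun σ τ q hq => by
      obtain ⟨_, ⟨u, hu, rfl⟩, htq⟩ := ((toricModel ι).mem_bendNhd v).1 hq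
      obtain ⟨ρ, hρ⟩ := Δ.exists_face σ u
      have hle : ρ ≤ σ := fun y hy => ((hρ y).1 hy).1
      have hle' : ρ ≤ τ := fun y hy => hu y ((hρ y).1 hy).1 ((hρ y).1 hy).2
      obtain ⟨p, rfl⟩ := (toricModel ι).exists_comap_eq v hle (q := q)
        (((toricModel ι).mem_bendNhd v).2
          ⟨_, ⟨u, fun y hy hy' => (hρ y).2 ⟨hy, hy'⟩, rfl⟩, htq⟩)
      refine ⟨p.comap (((blueDiag ι).bend v).map ρ τ hle'), ?_⟩
      have hpt : ∀ (κ : Δ.cones) (hκ : ρ ≤ κ), (((blueDiag ι).bend v).incl κ).toFun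
          (p.comap (((blueDiag ι).bend v).map ρ κ hκ)) =
            (((blueDiag ι).bend v).incl ρ).toFun p := fun κ hκ =>
        OBSpace.colimPt_map (fun j => OBlp.Spec (((blueDiag ι).bend v).obj j))
          (fun i j h => OBlp.specMap (((blueDiag ι).bend v).map i j h)) hκ p
      exact (hpt τ hle').trans (hpt σ hle).symm)

/-! ### Extension of multiplicative maps to valuations -/

section Extension

variable {R : Type u} [CommRing R] {B : Submonoid R} {w : B →* ℝ≥0}

/-- A nonarchimedean submultiplicative function on the ring `R` that extends the multiplicative map
`w` on the multiplicative submonoid `B`. -/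
structure ExtSeminorm (w : B →* ℝ≥0) (F : R → ℝ≥0) : Prop where
  map_coe : ∀ b : B, F b = w b
  map_add : ∀ x y, F (x + y) ≤ max (F x) (F y)
  map_mul : ∀ x y, F (x * y) ≤ F x * F y

namespace ExtSeminorm

variable {F : R → ℝ≥0} (hF : ExtSeminorm w F) {e : B} (he : (e : R) = -1) {z : B} (hz : (z : R) = 0)
  (hz0 : w z = 0)

include hF

theorem map_one : F 1 = 1 := (hF.map_coe 1).trans w.map_one

include hz hz0 in
theorem map_zero : F 0 = 0 := by rw [← hz, hF.map_coe, hz0]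

include he in
theorem map_neg (x : R) : F (-x) = F x := by
  have he1 : w e = 1 := by
    have : w e ^ 2 = 1 := by
      rw [← w.map_pow, ← w.map_one]
      refine congrArg w (Subtype.ext ?_)
      rw [SubmonoidClass.coe_pow, he, neg_one_sq, Submonoid.coe_one]
    exact (pow_eq_one_iff_of_nonneg zero_le two_ne_zero).1 this
  have key : ∀ x, F (-x) ≤ F x := fun x => by
    have := hF.map_mul e x
    rwa [hF.map_coe, he1, one_mul, he, neg_one_mul] at this
  exact (key x).antisymm (by simpa using key (-x))

/-- The function as a seminorm. -/
def toRingSeminorm : RingSeminorm R where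
  toFun x := F x
  map_zero' := by rw [hF.map_zero hz hz0, NNReal.coe_zero]
  add_le' x y := by
    rw [← NNReal.coe_add, NNReal.coe_le_coe]
    exact (hF.map_add x y).trans (max_le le_self_add le_add_self)
  neg' x := by rw [hF.map_neg he]
  mul_le' x y := by
    rw [← NNReal.coe_mul, NNReal.coe_le_coe]
    exact hF.map_mul x y

omit hF in
theorem of_ringSeminorm {P : RingSeminorm R} (hP : IsNonarchimedean P) (h : ∀ b : B, P b = w b) :
    ExtSeminorm w fun x => (P x).toNNReal where
  map_coe b := by rw [h, Real.toNNReal_coe]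
  map_add x y := by
    rw [← Real.toNNReal_monotone.map_max]
    exact Real.toNNReal_le_toNNReal (hP x y)
  map_mul x y := by
    rw [← Real.toNNReal_mul (apply_nonneg P x)]
    exact Real.toNNReal_le_toNNReal (P.mul_le' x y)

variable (hmin : ∀ G : R → ℝ≥0, ExtSeminorm w G → G ≤ F → G = F)

include hmin

omit hF in
/-- A minimal extension does not exceed other seminorms that lie below it. -/
theorem eq_of_ringSeminorm {P : RingSeminorm R} (hP : IsNonarchimedean P) (h : ∀ b : B, P b = w b)
    (hle : ∀ x, P x ≤ F x) (x : R) : P x = F x := by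
  have e := hmin _ (of_ringSeminorm hP h) fun x => Real.toNNReal_le_iff_le_coe.2 (hle x)
  rw [← congrFun e x, Real.coe_toNNReal _ (apply_nonneg P x)]

include he hz hz0

/-- A minimal extension is multiplicative: it is equal to its smoothing, hence compatible with powers,
and then it is equal to the limit of the functions `x ↦ F(x c^n) / F(c)^n`, first for all `c` in `B`
and then for all `c` in `R`. -/
theorem map_mul_eq (x y : R) : F (x * y) = F x * F y := by
  set P := hF.toRingSeminorm he hz hz0 with hPdef
  have hPF : ∀ x, P x = F x := fun _ => rfl
  have hna : IsNonarchimedean P := fun x y => by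
    rw [hPF, hPF, hPF, ← NNReal.coe_max, NNReal.coe_le_coe]
    exact hF.map_add x y
  have hP1 : P 1 ≤ 1 := by rw [hPF, hF.map_one, NNReal.coe_one]
  have hPB : ∀ b : B, P b = w b := fun b => by rw [hPF, hF.map_coe]
  have hpm : IsPowMul P := by
    have hs : ∀ x, smoothingSeminorm P hP1 hna x = F x :=
      eq_of_ringSeminorm hmin (isNonarchimedean_smoothingFun P hP1 hna)
        (fun b => (smoothingFun_of_powMul P hP1 fun n _ => by
          rw [← SubmonoidClass.coe_pow, hPB, hPB, w.map_pow, NNReal.coe_pow]).trans (hPB b))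
        (smoothingFun_le_self P)
    intro x n hn
    have := isPowMul_smoothingFun P hP1 x hn
    have hs' : ∀ x, smoothingFun P x = P x := hs
    rwa [hs', hs'] at this
  have key : ∀ c : R, (∀ (b : B) (n : ℕ), P (b * c ^ n) = P b * P c ^ n) →
      ∀ x, P (c * x) = P c * P x := by
    intro c hc x
    by_cases hc0 : P c = 0
    · refine le_antisymm (P.mul_le' c x) ?_
      rw [hc0, zero_mul]
      exact apply_nonneg P _
    · have hQ : ∀ x, seminormFromConst hP1 hc0 hpm x = F x :=
        eq_of_ringSeminorm hmin (seminormFromConst_isNonarchimedean hP1 hc0 hpm hna) (fun b => by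
          refine tendsto_nhds_unique (tendsto_seminormFromConst_seq_atTop hP1 hc0 hpm (b : R)) ?_
          have : seminormFromConst_seq c P (b : R) = fun _ => (w b : ℝ) := by
            funext n
            change P (b * c ^ n) / P c ^ n = _
            rw [hc, hPB, mul_div_cancel_right₀ _ (pow_ne_zero n hc0)]
          rw [this]
          exact tendsto_const_nhds) (seminormFromConst_le_seminorm hP1 hc0 hpm)
      have hQ' : ∀ x, seminormFromConst' c P x = P x := hQ
      have := seminormFromConst_const_mul hP1 hc0 hpm x
      rwa [hQ', hQ', hQ'] at this
  have hB : ∀ (b : B) (x : R), P (b * x) = P b * P x := fun b => key b fun b' n => by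
    rw [← SubmonoidClass.coe_pow, ← Submonoid.coe_mul, hPB, hPB, hPB, w.map_mul, w.map_pow,
      NNReal.coe_mul, NNReal.coe_pow]
  -- Multiplicativity with respect to `B` makes the condition of `key` available for all elements.
  have hall := key x (fun b n => by
    rw [hB]
    rcases Nat.eq_zero_or_pos n with rfl | hn
    · rw [pow_zero, pow_zero, hPF 1, hF.map_one, NNReal.coe_one]
    · rw [hpm x hn]) y
  rw [hPF, hPF, hPF, ← NNReal.coe_mul, NNReal.coe_inj] at hall
  exact hall

end ExtSeminorm

variable (hw : ∀ (b : B) (s : Multiset B), (b : R) = (s.map fun c : B => (c : R)).sum →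
    w b ≤ (s.map w).sup)
  (hspan : AddSubmonoid.closure (B : Set R) = ⊤)

include hw hspan

/-- The infimum of `max w(b_j)` over all representations `x = ∑ b_j` is nonarchimedean and
submultiplicative, and it extends `w`. -/
theorem exists_extSeminorm : ∃ F : R → ℝ≥0, ExtSeminorm w F := by
  -- The elements with a representation `x = ∑ b_j` for which `w(b_j) ≤ c` for all `j`.
  let S : ℝ≥0 → AddSubmonoid R := fun c => AddSubmonoid.closure {x | ∃ b : B, x = b ∧ w b ≤ c}
  have hmono : ∀ {c d}, c ≤ d → S c ≤ S d := fun h =>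
    AddSubmonoid.closure_mono fun x ⟨b, hb, hbc⟩ => ⟨b, hb, hbc.trans h⟩
  have hne : ∀ x, ∃ c, x ∈ S c := by
    intro x
    have hx : x ∈ AddSubmonoid.closure (B : Set R) := hspan ▸ AddSubmonoid.mem_top x
    induction hx using AddSubmonoid.closure_induction with
    | mem x hx => exact ⟨w ⟨x, hx⟩, AddSubmonoid.subset_closure ⟨⟨x, hx⟩, rfl, le_rfl⟩⟩
    | zero => exact ⟨0, AddSubmonoid.zero_mem _⟩
    | add x y _ _ hx hy =>
      obtain ⟨c, hc⟩ := hx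
      obtain ⟨d, hd⟩ := hy
      exact ⟨max c d, AddSubmonoid.add_mem _ (hmono (le_max_left c d) hc)
        (hmono (le_max_right c d) hd)⟩
  have hmul : ∀ {c d x y}, x ∈ S c → y ∈ S d → x * y ∈ S (c * d) := by
    intro c d x y hx hy
    have h1 := AddSubmonoid.mul_mem_mul hx hy
    rw [AddSubmonoid.closure_mul_closure] at h1
    refine AddSubmonoid.closure_mono ?_ h1
    rintro _ ⟨_, ⟨a, rfl, ha⟩, _, ⟨b, rfl, hb⟩, rfl⟩
    exact ⟨a * b, rfl, (w.map_mul a b).trans_le (mul_le_mul' ha hb)⟩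
  have hS : ∀ {c} {b : B}, (b : R) ∈ S c → w b ≤ c := by
    intro c b hb
    obtain ⟨t, ht, e⟩ := AddSubmonoid.exists_multiset_of_mem_closure hb
    have : ∃ s : Multiset B, (s.map fun c : B => (c : R)) = t ∧ ∀ b ∈ s, w b ≤ c := by
      clear e
      induction t using Multiset.induction_on with
      | empty => exact ⟨0, rfl, by simp⟩
      | cons x t ih =>
        obtain ⟨s, rfl, hs⟩ := ih fun y hy => ht y (Multiset.mem_cons_of_mem hy)
        obtain ⟨b, rfl, hb⟩ := ht x (Multiset.mem_cons_self _ _)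
        refine ⟨b ::ₘ s, Multiset.map_cons _ _ _, fun b' hb' => ?_⟩
        rcases Multiset.mem_cons.1 hb' with rfl | h
        · exact hb
        · exact hs b' h
    obtain ⟨s, rfl, hs⟩ := this
    refine (hw b s e.symm).trans (Multiset.sup_le.2 fun d hd => ?_)
    obtain ⟨b', hb', rfl⟩ := Multiset.mem_map.1 hd
    exact hs b' hb'
  have hle : ∀ {x c}, x ∈ S c → sInf {c | x ∈ S c} ≤ c := fun h => csInf_le' h
  refine ⟨fun x => sInf {c | x ∈ S c}, fun b => ?_, fun x y => ?_, fun x y => ?_⟩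
  · refine le_antisymm (hle (AddSubmonoid.subset_closure ⟨b, rfl, le_rfl⟩)) ?_
    exact le_csInf (hne b) fun c hc => hS hc
  · by_contra! h
    obtain ⟨c, hc, hc'⟩ := exists_lt_of_csInf_lt (hne x) ((le_max_left _ _).trans_lt h)
    obtain ⟨d, hd, hd'⟩ := exists_lt_of_csInf_lt (hne y) ((le_max_right _ _).trans_lt h)
    refine (max_lt hc' hd').not_ge (hle (AddSubmonoid.add_mem _ (hmono (le_max_left c d) hc)
      (hmono (le_max_right c d) hd)))
  · rw [sInf_eq_iInf' {c | x ∈ S c}, sInf_eq_iInf' {c | y ∈ S c}]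
    have : Nonempty {c | x ∈ S c} := Set.Nonempty.to_subtype (hne x)
    have : Nonempty {d | y ∈ S d} := Set.Nonempty.to_subtype (hne y)
    exact NNReal.le_iInf_mul fun c => NNReal.le_mul_iInf fun d => hle (hmul c.2 d.2)

/-- If a multiplicative submonoid `B` of a ring `R` generates `R` additively, then a multiplicative
map on `B` that satisfies the ultrametric inequality for all relations `b = ∑ b_j` that hold in `R`
extends to a valuation on `R`. The valuation is a minimal nonarchimedean submultiplicative function
that extends `w`, which exists by Zorn's lemma. -/
theorem exists_valuation_extension {e : B} (he : (e : R) = -1) {z : B} (hz : (z : R) = 0) :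
    ∃ W : Valuation R ℝ≥0, ∀ b : B, W b = w b := by
  have hz0 : w z = 0 := le_antisymm (by simpa [hz] using hw z 0) zero_le
  obtain ⟨F₀, hF₀⟩ := exists_extSeminorm hw hspan
  obtain ⟨F, -, hF, hmin⟩ := zorn_le_nonempty₀ (α := (R → ℝ≥0)ᵒᵈ)
    {F | ExtSeminorm w (OrderDual.ofDual F)} (by
    intro c hc hchain F₁ hF₁
    have : Nonempty c := ⟨⟨F₁, hF₁⟩⟩
    have hle : ∀ (F : c) x, ⨅ F : c, OrderDual.ofDual F.1 x ≤ OrderDual.ofDual F.1 x :=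
      fun F x => ciInf_le' _ F
    refine ⟨OrderDual.toDual fun x => ⨅ F : c, OrderDual.ofDual F.1 x, ⟨fun b => ?_, fun x y => ?_,
      fun x y => ?_⟩, fun F hF x => hle ⟨F, hF⟩ x⟩
    · change ⨅ F : c, OrderDual.ofDual F.1 (b : R) = w b
      have : ∀ F : c, OrderDual.ofDual F.1 (b : R) = w b := fun F => (hc F.2).map_coe b
      simp only [this, ciInf_const]
    · change ⨅ F : c, OrderDual.ofDual F.1 (x + y) ≤
        max (⨅ F : c, OrderDual.ofDual F.1 x) (⨅ F : c, OrderDual.ofDual F.1 y)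
      by_contra! h
      obtain ⟨F, hF⟩ := exists_lt_of_ciInf_lt ((le_max_left _ _).trans_lt h)
      obtain ⟨G, hG⟩ := exists_lt_of_ciInf_lt ((le_max_right _ _).trans_lt h)
      rcases hchain.total F.2 G.2 with hFG | hFG
      · refine (max_lt ((show OrderDual.ofDual G.1 x ≤ _ from hFG x).trans_lt hF) hG).not_ge ?_
        exact (hle G _).trans ((hc G.2).map_add x y)
      · refine (max_lt hF ((show OrderDual.ofDual F.1 y ≤ _ from hFG y).trans_lt hG)).not_ge ?_
        exact (hle F _).trans ((hc F.2).map_add x y)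
    · change ⨅ F : c, OrderDual.ofDual F.1 (x * y) ≤
        (⨅ F : c, OrderDual.ofDual F.1 x) * ⨅ F : c, OrderDual.ofDual F.1 y
      refine NNReal.le_iInf_mul_iInf fun F G => ?_
      rcases hchain.total F.2 G.2 with hFG | hFG
      · exact (hle G _).trans (((hc G.2).map_mul x y).trans (mul_le_mul' (hFG x) le_rfl))
      · exact (hle F _).trans (((hc F.2).map_mul x y).trans (mul_le_mul' le_rfl (hFG y))))
    (OrderDual.toDual F₀) hF₀
  have hF' : ExtSeminorm w (OrderDual.ofDual F) := hF
  refine ⟨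
    { toFun := OrderDual.ofDual F
      map_zero' := hF'.map_zero hz hz0
      map_one' := hF'.map_one
      map_mul' := hF'.map_mul_eq he hz hz0 (fun G hG hle => ?_)
      map_add_le_max' := hF'.map_add }, hF'.map_coe⟩
  exact le_antisymm hle (hmin (y := OrderDual.toDual G) hG hle)

end Extension

/-! ### The charts of the tropicalization of a toric variety -/

section Trop

variable {n : ℕ} {σ τ : PointedCone ℝ (Fin n → ℝ)}

theorem toricMonoidMap_injective (h : σ ≤ τ) : Function.Injective (toricMonoidMap h) := by
  intro a b e
  rcases eq_zero_or_exists_toricChar a with rfl | ⟨u, rfl⟩ <;>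
  rcases eq_zero_or_exists_toricChar b with rfl | ⟨u', rfl⟩
  · rfl
  · rw [map_zero, toricMonoidMap_char] at e
    exact absurd e.symm WithZero.coe_ne_zero
  · rw [map_zero, toricMonoidMap_char] at e
    exact absurd e WithZero.coe_ne_zero
  · rw [toricMonoidMap_char, toricMonoidMap_char] at e
    exact congrArg _ (AddSubmonoid.inclusion_injective _ (Multiplicative.ofAdd.injective
      (WithZero.coe_injective e)))

namespace AffTrop

instance : FunLike (AffTrop τ) (ToricMonoid τ) ℝ≥0 :=
  inferInstanceAs (FunLike (ToricMonoid τ →*₀ ℝ≥0) _ _)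

instance : MonoidWithZeroHomClass (AffTrop τ) (ToricMonoid τ) ℝ≥0 :=
  inferInstanceAs (MonoidWithZeroHomClass (ToricMonoid τ →*₀ ℝ≥0) _ _)

theorem map_apply (h : σ ≤ τ) (p : AffTrop σ) (a : ToricMonoid τ) :
    p.map h a = p (toricMonoidMap h a) := rfl

theorem continuous_apply (a : ToricMonoid τ) : Continuous fun p : AffTrop τ => p a :=
  (_root_.continuous_apply (A := fun _ : ToricMonoid τ => ℝ≥0) a).comp continuous_induced_dom

theorem continuous_of_apply {E : Type v} [TopologicalSpace E] {F : E → AffTrop τ}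
    (h : ∀ a, Continuous fun x => F x a) : Continuous F :=
  continuous_induced_rng.2 (continuous_pi h)

theorem apply_toricChar_ne_zero (p : AffTrop σ) {u : dualMonoid σ}
    (hu : ∀ y ∈ σ, pair (castVec (u : Fin n → ℤ)) y = 0) : p (toricChar u) ≠ 0 := by
  have hneg : -(u : Fin n → ℤ) ∈ dualMonoid σ := fun y hy => by
    rw [pair_castVec_neg, hu y hy, neg_zero]
  have e : toricChar u * toricChar ⟨_, hneg⟩ = (1 : ToricMonoid σ) := by
    rw [← toricChar_add]
    exact congrArg toricChar (Subtype.ext (add_neg_cancel _))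
  intro h
  have := congrArg p e
  rw [map_mul, h, zero_mul, map_one] at this
  exact zero_ne_one this

theorem map_map {ρ : PointedCone ℝ (Fin n → ℝ)} (h : ρ ≤ σ) (h' : σ ≤ τ) (p : AffTrop ρ) :
    (p.map h).map h' = p.map (h.trans h') := by
  refine MonoidWithZeroHom.ext fun a => congrArg (p : ToricMonoid ρ → ℝ≥0) ?_
  rcases eq_zero_or_exists_toricChar a with rfl | ⟨u, rfl⟩
  · simp
  · rfl

variable (hτ : IsRatCone τ) (h : σ ≤ τ) {u : dualMonoid τ}
  (hu : ∀ y, y ∈ σ ↔ y ∈ τ ∧ pair (castVec (u : Fin n → ℤ)) y = 0)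

include hu in
theorem map_apply_toricChar_ne_zero (p : AffTrop σ) : p.map h (toricChar u) ≠ 0 := by
  rw [map_apply, toricMonoidMap_char]
  exact p.apply_toricChar_ne_zero fun y hy => ((hu y).1 hy).2

include hτ hu

/-- The values on `A_σ` of a point of the chart of a face `σ` of `τ` are quotients of values on `A_τ`. -/
theorem exists_apply_eq_div (a : ToricMonoid σ) : ∃ (N : ℕ) (b : ToricMonoid τ),
    ∀ p : AffTrop σ, p a = p.map h b / p.map h (toricChar u) ^ N := by
  obtain ⟨N, b, e⟩ := exists_toricMonoidMap_eq hτ h u hu a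
  refine ⟨N, b, fun p => ?_⟩
  rw [eq_div_iff (pow_ne_zero N (p.map_apply_toricChar_ne_zero h hu)), map_apply, map_apply, e,
    map_mul, map_pow, mul_comm]

theorem map_injective : Function.Injective (AffTrop.map h) := by
  intro p p' e
  refine DFunLike.ext _ _ fun a => ?_
  obtain ⟨N, b, hb⟩ := exists_apply_eq_div hτ h hu a
  rw [hb, hb, e]

/-- A point of the chart of `τ` extends to the face that is cut out by `u` if the monomial of `u` does
not vanish. -/
theorem exists_map_eq (p : AffTrop τ) (hp : p (toricChar u) ≠ 0) : ∃ z : AffTrop σ, z.map h = p := by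
  choose N b e using exists_toricMonoidMap_eq hτ h u hu
  have key : ∀ (a : ToricMonoid σ) (M : ℕ) (c : ToricMonoid τ),
      toricMonoidMap h c = toricMonoidMap h (toricChar u) ^ M * a →
      p (b a) / p (toricChar u) ^ N a = p c / p (toricChar u) ^ M := by
    intro a M c hc
    rw [div_eq_div_iff (pow_ne_zero _ hp) (pow_ne_zero _ hp), ← map_pow, ← map_pow, ← map_mul,
      ← map_mul]
    refine congrArg _ (toricMonoidMap_injective h ?_)
    rw [map_mul, map_mul, e, hc, map_pow, map_pow, mul_right_comm, mul_comm (_ ^ N a), mul_right_comm]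
  let z : ToricMonoid σ →*₀ ℝ≥0 :=
    { toFun := fun a => p (b a) / p (toricChar u) ^ N a
      map_zero' := by
        rw [key 0 0 0 (by simp), map_zero, zero_div]
      map_one' := by
        rw [key 1 0 1 (by simp), map_one, pow_zero, div_one]
      map_mul' := fun a a' => by
        rw [key (a * a') (N a + N a') (b a * b a') (by
          rw [map_mul, e, e, pow_add]
          exact mul_mul_mul_comm _ _ _ _), map_mul, pow_add, div_mul_div_comm] }
  refine ⟨z, DFunLike.ext _ _ fun a => ?_⟩
  change p (b (toricMonoidMap h a)) / p (toricChar u) ^ N (toricMonoidMap h a) = p a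
  rw [key (toricMonoidMap h a) 0 a (by rw [pow_zero, one_mul]), pow_zero, div_one]

/-- Charts of faces are open: they are given by the nonvanishing of a monomial. -/
theorem isOpenMap_map : IsOpenMap (AffTrop.map h) := by
  have hc : Continuous (AffTrop.map h) := continuous_of_apply fun a => continuous_apply _
  have hi : Topology.IsInducing (AffTrop.map h) := by
    refine ⟨le_antisymm hc.le_induced (continuous_id_iff_le.1 ?_)⟩
    have key : ∀ (E : Type) [TopologicalSpace E] (F : E → AffTrop σ),
        Continuous (fun x => (F x).map h) → Continuous F := by
      intro E _ F hF
      refine continuous_of_apply fun a => ?_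
      obtain ⟨N, b, hb⟩ := exists_apply_eq_div hτ h hu a
      simp only [hb]
      exact ((continuous_apply b).comp hF).div₀ (((continuous_apply _).comp hF).pow N)
        fun x => pow_ne_zero N ((F x).map_apply_toricChar_ne_zero h hu)
    exact @key _ (TopologicalSpace.induced (AffTrop.map h) inferInstance) id continuous_induced_dom
  refine hi.isOpenMap ?_
  have e : Set.range (AffTrop.map h) = {p : AffTrop τ | p (toricChar u) ≠ 0} := by
    ext p
    exact ⟨by rintro ⟨z, rfl⟩; exact z.map_apply_toricChar_ne_zero h hu, exists_map_eq hτ h hu p⟩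
  rw [e]
  exact isOpen_ne_fun (continuous_apply _) continuous_const

end AffTrop

/-! ### Gluing of the charts -/

namespace TropToric

variable {Δ : Fan n}

/-- The point of the tropicalization that is given by a point of a chart. -/
def mk (τ : Δ.cones) (p : AffTrop τ.1) : TropToric Δ := Quot.mk _ ⟨τ, p⟩

theorem mk_map {ρ σ : Δ.cones} (h : ρ ≤ σ) (z : AffTrop ρ.1) : mk σ (z.map h) = mk ρ z :=
  (Quot.sound ⟨h, rfl⟩).symm

theorem map_injective {ρ σ : Δ.cones} (h : ρ ≤ σ) :
    Function.Injective (AffTrop.map (show ρ.1 ≤ σ.1 from h)) := by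
  obtain ⟨u, hu⟩ := Δ.exists_form ρ.2 σ.2 h
  exact AffTrop.map_injective (Δ.isRatCone σ.1 σ.2) h hu

/-- Two points of charts that define the same point of the tropicalization come from a common
smaller chart. -/
theorem exists_of_mk_eq {σ τ : Δ.cones} {p : AffTrop σ.1} {p' : AffTrop τ.1}
    (e : mk σ p = mk τ p') : ∃ (ρ : Δ.cones) (h : ρ ≤ σ) (h' : ρ ≤ τ) (z : AffTrop ρ.1),
      z.map (show ρ.1 ≤ σ.1 from h) = p ∧ z.map (show ρ.1 ≤ τ.1 from h') = p' := by
  suffices key : ∀ P Q : Σ τ : Δ.cones, AffTrop τ.1, Relation.EqvGen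
      (fun p q : Σ τ : Δ.cones, AffTrop τ.1 =>
        ∃ h : p.1 ≤ q.1, AffTrop.map (show p.1.1 ≤ q.1.1 from h) p.2 = q.2) P Q →
      ∃ (ρ : Δ.cones) (h : ρ ≤ P.1) (h' : ρ ≤ Q.1) (z : AffTrop ρ.1),
        z.map (show ρ.1 ≤ P.1.1 from h) = P.2 ∧ z.map (show ρ.1 ≤ Q.1.1 from h') = Q.2 from
    key ⟨σ, p⟩ ⟨τ, p'⟩ (Quot.eqvGen_exact e)
  have hid : ∀ {σ : Δ.cones} (p : AffTrop σ.1), p.map (le_refl σ.1) = p := fun {σ} p => by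
    refine DFunLike.ext _ _ fun a => congrArg p ?_
    rcases eq_zero_or_exists_toricChar a with rfl | ⟨u, rfl⟩
    · rw [map_zero]
    · rfl
  intro P Q hPQ
  induction hPQ with
  | rel P Q h =>
    obtain ⟨h, e⟩ := h
    exact ⟨P.1, le_rfl, h, P.2, hid _, e⟩
  | refl P => exact ⟨P.1, le_rfl, le_rfl, P.2, hid _, hid _⟩
  | symm P Q _ ih =>
    obtain ⟨ρ, h, h', z, e, e'⟩ := ih
    exact ⟨ρ, h', h, z, e', e⟩
  | trans P Q R _ _ ih ih' =>
    obtain ⟨ρ, h₁, h₂, z, e₁, e₂⟩ := ih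
    obtain ⟨ρ', h₂', h₃, z', e₂', e₃⟩ := ih'
    -- Both `z` and `z'` define the same point of the chart `Q`, which lies in the intersection.
    obtain ⟨u, hu⟩ := Δ.exists_form ρ'.2 Q.1.2 h₂'
    have hκ : ρ.1 ⊓ ρ'.1 ∈ Δ.cones := Δ.face_mem _ ρ.2 _ (Δ.isFace_inf _ ρ.2 _ ρ'.2).1
    let κ : Δ.cones := ⟨ρ.1 ⊓ ρ'.1, hκ⟩
    have hκρ : κ ≤ ρ := show ρ.1 ⊓ ρ'.1 ≤ ρ.1 from inf_le_left
    have hκρ' : κ ≤ ρ' := show ρ.1 ⊓ ρ'.1 ≤ ρ'.1 from inf_le_right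
    obtain ⟨y, hy⟩ := AffTrop.exists_map_eq (Δ.isRatCone ρ.1 ρ.2) (show κ.1 ≤ ρ.1 from hκρ)
      (u := AddSubmonoid.inclusion (dualMonoid_anti (show ρ.1 ≤ Q.1.1 from h₂)) u)
      (fun y => ⟨fun hy => ⟨hy.1, ((hu y).1 hy.2).2⟩, fun hy => ⟨hy.1, (hu y).2 ⟨h₂ hy.1, hy.2⟩⟩⟩)
      z (by
        have := z'.map_apply_toricChar_ne_zero h₂' hu
        rw [e₂', ← e₂] at this
        exact this)
    refine ⟨κ, hκρ.trans h₁, hκρ'.trans h₃, y, ?_, ?_⟩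
    · rw [← e₁, ← hy, AffTrop.map_map]
    · have : y.map (show κ.1 ≤ ρ'.1 from hκρ') = z' := by
        refine map_injective h₂' ?_
        rw [e₂', ← e₂, ← hy, AffTrop.map_map, AffTrop.map_map]
      rw [← e₃, ← this, AffTrop.map_map]

/-- The charts of the tropicalization of a toric variety are open. -/
theorem isOpenMap_mk (τ : Δ.cones) : IsOpenMap (mk τ) := by
  intro O hO
  refine isOpen_coinduced.2 (isOpen_sigma_iff.2 fun σ => ?_)
  have e : {p : AffTrop σ.1 | mk σ p ∈ mk τ '' O} =
      ⋃ (ρ : Δ.cones) (h : ρ ≤ σ) (h' : ρ ≤ τ), AffTrop.map (show ρ.1 ≤ σ.1 from h) ''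
        (AffTrop.map (show ρ.1 ≤ τ.1 from h') ⁻¹' O) := by
    ext p
    simp only [Set.mem_iUnion]
    constructor
    · rintro ⟨p', hp', e⟩
      obtain ⟨ρ, h, h', z, rfl, rfl⟩ := exists_of_mk_eq (show mk σ p = mk τ p' from e.symm)
      exact ⟨ρ, h, h', z, hp', rfl⟩
    · rintro ⟨ρ, h, h', z, hz, rfl⟩
      exact ⟨_, hz, (mk_map h' z).trans (mk_map h z).symm⟩
  change IsOpen {p : AffTrop σ.1 | mk σ p ∈ mk τ '' O}
  rw [e]
  refine isOpen_iUnion fun ρ => isOpen_iUnion fun h => isOpen_iUnion fun h' => ?_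
  obtain ⟨u, hu⟩ := Δ.exists_form ρ.2 σ.2 h
  refine AffTrop.isOpenMap_map (Δ.isRatCone σ.1 σ.2) h hu _ (hO.preimage ?_)
  exact AffTrop.continuous_of_apply fun a => AffTrop.continuous_apply _

theorem continuous_mk (τ : Δ.cones) : Continuous (mk τ) :=
  continuous_coinduced_rng.comp continuous_sigmaMk

end TropToric

end Trop

/-! ### Rational points of bends -/

section BendPoints

variable {k : Type u} [Field k] {v : (OBlp.ofSemiring k).carrier →*₀ tropical.carrier} {J : Type w}
  [Preorder J] {D E : AlgDiag.{u} (OBlp.ofSemiring k) J}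

namespace AlgDiag.TPts

/-- The multiplicative map `b ↦ g(b ⊗ 1)` for a `𝕋`-rational point `g` of the bend of `B`. -/
def bendVal {j : J} (g : (D.bend v).TPts j) : (D.obj j).carrier →*₀ ℝ≥0 where
  toFun b := nn (g.1 (bendMk v (D.obj j) (D.str j) b 1))
  map_zero' := (congrArg g.1 (bendMk_zero_left 1)).trans (map_zero g.1)
  map_one' := map_one g.1
  map_mul' b b' := by
    refine Eq.trans (congrArg g.1 ?_) (map_mul g.1 _ _)
    refine Eq.trans ?_ (bendMk_mul _ _ _ _)
    rw [mul_one]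

variable {j : J} (g : (D.bend v).TPts j)

theorem apply_bendMk (b : D.obj j) (t : tropical.carrier) :
    nn (g.1 (bendMk v (D.obj j) (D.str j) b t)) = g.bendVal b * nn t :=
  (congrArg g.1 (bendMk_eq b t)).trans ((map_mul g.1 _ _).trans
    (congrArg (fun x : ℝ≥0 => g.bendVal b * x) (g.2 t)))

theorem bendVal_str (c : (OBlp.ofSemiring k).carrier) : g.bendVal (D.str j c) = nn (v c) := by
  have h := bendMk_scalar (v := v) (B := D.obj j) (e := D.str j) c 1 1
  rw [mul_one, mul_one] at h
  exact (congrArg g.1 h).trans (g.2 (v c))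

/-- A relation `a ≤ ∑ b_j` yields the ultrametric inequality `g(a) ≤ max g(b_j)`. -/
theorem bendVal_le {a : D.obj j} {s : Multiset (D.obj j).carrier} (h : (D.obj j).rel {a} s) :
    g.bendVal a ≤ (s.map g.bendVal).sup := by
  have h1 : ∀ s : Multiset (D.obj j).carrier, (s.map (bendIn v (D.obj j) (D.str j))).map g.1 =
      s.map g.bendVal := fun s => Multiset.map_map _ _ _
  have h2 : Multiset.sup (α := ℝ≥0) (((a ::ₘ s).map (bendIn v (D.obj j) (D.str j))).map g.1) =
      Multiset.sup (α := ℝ≥0) ((s.map (bendIn v (D.obj j) (D.str j))).map g.1) :=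
    g.1.rel (bendIn_rel h).1
  have h3 : ((a ::ₘ s).map g.bendVal).sup = (s.map g.bendVal).sup :=
    (congrArg (Multiset.sup (α := ℝ≥0)) (h1 _)).symm.trans
      (h2.trans (congrArg (Multiset.sup (α := ℝ≥0)) (h1 _)))
  rw [Multiset.map_cons, Multiset.sup_cons] at h3
  exact h3 ▸ le_sup_left

theorem bendVal_le_max {a b c : D.obj j} (h : (D.obj j).rel {c} {a, b}) :
    g.bendVal c ≤ max (g.bendVal a) (g.bendVal b) := by
  refine (g.bendVal_le h).trans_eq ?_
  rw [Multiset.insert_eq_cons, Multiset.map_cons, Multiset.map_singleton, Multiset.sup_cons,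
    Multiset.sup_singleton]

theorem ext_bendVal {g g' : (D.bend v).TPts j} (h : ∀ b, g.bendVal b = g'.bendVal b) : g = g' := by
  refine Subtype.ext (OBlp.Hom.ext fun a => ?_)
  obtain ⟨b, t, rfl⟩ := bendMk_surjective a
  exact (g.apply_bendMk b t).trans ((congrArg (· * nn t) (h b)).trans (g'.apply_bendMk b t).symm)

theorem continuous_bendVal (b : D.obj j) :
    Continuous fun g : (D.bend v).TPts j => g.bendVal b :=
  (D.bend v).continuous_tPts_apply j (bendMk v (D.obj j) (D.str j) b 1)

theorem continuous_of_bendVal {X : Type*} [TopologicalSpace X] {F : X → (D.bend v).TPts j}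
    (h : ∀ b, Continuous fun x => (F x).bendVal b) : Continuous F := by
  refine continuous_tPts_of_apply fun a => ?_
  obtain ⟨b, t, rfl⟩ := bendMk_surjective a
  exact ((h b).mul continuous_const).congr fun x => ((F x).apply_bendMk b t).symm

/-- Rational points of bends are functorial. -/
def bendComp (β : AlgDiag.Hom D E) (g : (E.bend v).TPts j) : (D.bend v).TPts j :=
  ⟨g.1.comp ((β.bend v).app j), fun t => (congrArg g.1 ((β.bend v).app_str j t)).trans (g.2 t)⟩

/-- The map between rational points of colimits is given on the charts by composition. -/
theorem ratMap_point (β : AlgDiag.Hom D E) (g : (E.bend v).TPts j) :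
    (β.bend v).ratMap g.point = (g.bendComp β).point := by
  refine Subtype.ext ?_
  change (β.bend v).spaceMap.comp (((E.bend v).incl j).comp (specMap g.1)) =
    ((D.bend v).incl j).comp (specMap (g.1.comp ((β.bend v).app j)))
  rw [specMap_comp, ← OBSpace.Hom.comp_assoc, ← OBSpace.Hom.comp_assoc, AlgDiag.Hom.spaceMap_incl]

end AlgDiag.TPts

end BendPoints

/-! ### Berkovich spaces as spaces of rational points -/

section Berkovich

variable {k : Type u} [Field k] {Y : Scheme.{u}} (f : Y ⟶ AlgebraicGeometry.Spec (.of k))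
  (v : Valuation k ℝ≥0) {J : Type w} [Preorder J] (P : AffinePresentation Y J)

/-- The `𝕋`-rational point of the bend of `ΓU_j` that is given by a valuation. -/
noncomputable def AffAn.toTPts {j : J} (w : AffAn f v (P.U j)) :
    ((schemeDiag f P).bend (valHom v)).TPts j :=
  ⟨OBlp.bendEval (valHom w.1) w.2 fun a s h => by
      exact (congrArg w.1 (show a = Multiset.sum (M := Γ(Y, P.U j)) s from
        (Multiset.sum_singleton (M := Γ(Y, P.U j)) a).symm.trans h)).trans_le
          (valuation_le_sup w.1 s),
    fun t => (congrArg (· * (show ℝ≥0 from t)) w.1.map_one).trans (one_mul (show ℝ≥0 from t))⟩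

variable {f v P}

theorem AffAn.bendVal_toTPts {j : J} (w : AffAn f v (P.U j)) (a : Γ(Y, P.U j)) :
    (w.toTPts f v P).bendVal a = w.1 a := mul_one (w.1 a)

/-- The valuation that is given by a `𝕋`-rational point of the bend of `ΓU_j`. -/
noncomputable def AffAn.ofTPts {j : J} (g : ((schemeDiag f P).bend (valHom v)).TPts j) :
    AffAn f v (P.U j) :=
  ⟨{ toFun := fun a => g.bendVal a
     map_zero' := map_zero g.bendVal
     map_one' := map_one g.bendVal
     map_mul' := map_mul g.bendVal
     map_add_le_max' := fun a b => by
      have h : ((schemeDiag f P).obj j).rel {(show Γ(Y, P.U j) from a) + (show Γ(Y, P.U j) from b)}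
          {a, b} := by
        change Multiset.sum (M := Γ(Y, P.U j)) {a + b} = Multiset.sum (M := Γ(Y, P.U j)) {a, b}
        simp
      exact g.bendVal_le_max h },
   fun c => g.bendVal_str c⟩

variable (f v P)

/-- Valuations on `ΓU_j` are the `𝕋`-rational points of the bend of `ΓU_j`. -/
noncomputable def affAnHomeomorph (j : J) :
    AffAn f v (P.U j) ≃ₜ ((schemeDiag f P).bend (valHom v)).TPts j where
  toFun w := w.toTPts f v P
  invFun g := AffAn.ofTPts g
  left_inv w := Subtype.ext (Valuation.ext fun a => w.bendVal_toTPts a)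
  right_inv g := TPts.ext_bendVal fun a => (AffAn.ofTPts g).bendVal_toTPts a
  continuous_toFun := by
    refine TPts.continuous_of_bendVal fun a => ?_
    have : Continuous fun w : AffAn f v (P.U j) => w.1 a :=
      (continuous_apply (A := fun _ : Γ(Y, P.U j) => ℝ≥0) a).comp continuous_induced_dom
    exact this.congr fun w => (w.bendVal_toTPts a).symm
  continuous_invFun := continuous_induced_rng.2 (continuous_pi fun a =>
    TPts.continuous_bendVal (v := valHom v) (D := schemeDiag f P) (j := j) a)

end Berkovich

/-- The Berkovich space of a scheme is homeomorphic to the space of `𝕋`-rational points of the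
bend. -/
theorem exists_berk_homeomorph {k : Type (max w u)} [Field k] {Y : Scheme.{max w u}}
    (f : Y ⟶ AlgebraicGeometry.Spec (.of k)) (v : Valuation k ℝ≥0) {J : Type w} [Preorder J]
    (P : AffinePresentation Y J) :
    ∃ Φ : Berk f v P ≃ₜ BendPts v (schemeDiag f P),
      ∀ (j : J) (w : AffAn f v (P.U j)), Φ (Berk.mk f v P j w) = valPoint f v P j w :=
  (schemeGlued.{u, w} f P (valHom v)).exists_homeomorph (fun j => AffAn f v (P.U j))
    (fun _ _ h => AffAn.map f v (P.mono h)) (affAnHomeomorph f v P) fun i j h w =>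
      TPts.ext_bendVal fun a => by
        change (AffAn.toTPts f v P (AffAn.map f v (P.mono h) w)).bendVal a =
          (AffAn.toTPts f v P w).bendVal (resHom Y (P.mono h) a)
        exact (AffAn.bendVal_toTPts (AffAn.map f v (P.mono h) w) a).trans
          (w.bendVal_toTPts (resHom Y (P.mono h) a)).symm

/-! ### Rational points of the bend of the blue model -/

section BlueTropicalization

variable {k : Type u} [Field k] {n : ℕ} {Δ : Fan n} {Y : Scheme.{u}} (ι : Y ⟶ toricVariety k Δ)
  (v : Valuation k ℝ≥0)

/-- The restriction of a `𝕋`-rational point of the bend of `B_τ` to the monoid `A_τ`. -/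
noncomputable def tropPart {τ : Δ.cones} (g : ((blueDiag ι).bend (valHom v)).TPts τ) :
    AffTrop τ.1 :=
  MonoidWithZeroHom.comp g.bendVal (blueMonomial ι τ)

variable {ι v}

theorem tropPart_apply {τ : Δ.cones} (g : ((blueDiag ι).bend (valHom v)).TPts τ)
    (a : ToricMonoid τ.1) : tropPart ι v g a = g.bendVal (blueMonomial ι τ a) := rfl

theorem bendVal_str_mul_blueMonomial {τ : Δ.cones} (g : ((blueDiag ι).bend (valHom v)).TPts τ)
    (c : (OBlp.ofSemiring k).carrier) (a : ToricMonoid τ.1) :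
    g.bendVal ((blueDiag ι).str τ c * blueMonomial ι τ a) =
      nn (valHom v c) * tropPart ι v g a := by
  rw [map_mul, g.bendVal_str, tropPart_apply]

theorem tropPart_map {σ τ : Δ.cones} (h : σ ≤ τ)
    (g : ((blueDiag ι).bend (valHom v)).TPts σ) :
    tropPart ι v (g.map h) = (tropPart ι v g).map (show σ.1 ≤ τ.1 from h) :=
  DFunLike.ext _ _ fun a => congrArg g.bendVal (map_blueMonomial ι h a)

/-- A rational point of the bend of `B_τ` is determined by the values of monomials, because the values
of scalars are prescribed. -/
theorem tropPart_injective (τ : Δ.cones) : Function.Injective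
    (tropPart ι v : ((blueDiag ι).bend (valHom v)).TPts τ → AffTrop τ.1) := by
  intro g g' e
  refine TPts.ext_bendVal fun b => ?_
  obtain ⟨c, a, rfl⟩ := exists_eq_str_mul_blueMonomial ι τ b
  rw [bendVal_str_mul_blueMonomial, bendVal_str_mul_blueMonomial, e]

theorem continuous_tropPart (τ : Δ.cones) : Continuous
    (tropPart ι v : ((blueDiag ι).bend (valHom v)).TPts τ → AffTrop τ.1) :=
  AffTrop.continuous_of_apply fun a => TPts.continuous_bendVal (blueMonomial ι τ a)

theorem isInducing_tropPart (τ : Δ.cones) : Topology.IsInducing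
    (tropPart ι v : ((blueDiag ι).bend (valHom v)).TPts τ → AffTrop τ.1) := by
  refine ⟨le_antisymm (continuous_tropPart τ).le_induced (continuous_id_iff_le.1 ?_)⟩
  have key : ∀ (E : Type u) [TopologicalSpace E]
      (F : E → ((blueDiag ι).bend (valHom v)).TPts τ),
      Continuous (fun x => tropPart ι v (F x)) → Continuous F := by
    intro E _ F hF
    refine TPts.continuous_of_bendVal fun b => ?_
    obtain ⟨c, a, rfl⟩ := exists_eq_str_mul_blueMonomial ι τ b
    simp only [bendVal_str_mul_blueMonomial]
    exact continuous_const.mul ((AffTrop.continuous_apply a).comp hF)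
  exact @key _ (TopologicalSpace.induced (tropPart ι v) inferInstance) id continuous_induced_dom

variable [IsClosedImmersion ι]

/-- If the restriction to `A_σ` of a rational point of the bend of `B_σ` extends to the monoid of a
face, then the rational point itself comes from this face. -/
theorem exists_tropPart_eq {ρ σ : Δ.cones} (h : ρ ≤ σ)
    (g : ((blueDiag ι).bend (valHom v)).TPts σ) (z : AffTrop ρ.1)
    (hz : z.map (show ρ.1 ≤ σ.1 from h) = tropPart ι v g) :
    ∃ g' : ((blueDiag ι).bend (valHom v)).TPts ρ, g'.map h = g ∧ tropPart ι v g' = z := by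
  let G := toricGlued ι (valHom v)
  obtain ⟨u, hu⟩ := Δ.exists_form ρ.2 σ.2 h
  have hne : g.bendVal (blueMonomial ι σ (toricChar u)) ≠ 0 := by
    rw [← tropPart_apply, ← hz]
    exact z.map_apply_toricChar_ne_zero _ hu
  have hmem : g.point.1.toFun tropPt ∈ G.chart ρ :=
    ((toricModel ι).mem_bendNhd (valHom v)).2
      ⟨blueMonomial ι σ (toricChar u), ⟨u, fun y hy hy' => (hu y).2 ⟨hy, hy'⟩, rfl⟩, hne⟩
  have e : (G.ofPoint ρ g.point hmem).map h = g :=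
    G.point_injective σ ((TPts.point_map h _).trans (G.point_ofPoint ρ g.point hmem))
  refine ⟨G.ofPoint ρ g.point hmem, e, TropToric.map_injective h ?_⟩
  rw [← tropPart_map h, e, hz]

/-- The colimit of the spaces of `𝕋`-rational points of the bends of the blueprints `B_τ`. -/
abbrev BlueColim (ι : Y ⟶ toricVariety k Δ) (v : Valuation k ℝ≥0) : Type u :=
  Quot fun p q : Σ τ : Δ.cones, ((blueDiag ι).bend (valHom v)).TPts τ =>
    ∃ h : p.1 ≤ q.1, p.2.map h = q.2

/-- The map to the tropicalization of the toric variety that restricts rational points to the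
monoids `A_τ`. -/
noncomputable def colimTrop (ι : Y ⟶ toricVariety k Δ) (v : Valuation k ℝ≥0) :
    BlueColim ι v → TropToric Δ :=
  Quot.map (fun p => ⟨p.1, tropPart ι v p.2⟩) (by
    rintro ⟨σ, g⟩ ⟨τ, g'⟩ ⟨h, e⟩
    exact ⟨h, (tropPart_map h g).symm.trans (congrArg (tropPart ι v) e)⟩)

omit [IsClosedImmersion ι] in
theorem colimTrop_mk (τ : Δ.cones) (g : ((blueDiag ι).bend (valHom v)).TPts τ) :
    colimTrop ι v (Quot.mk _ ⟨τ, g⟩) = TropToric.mk τ (tropPart ι v g) := rfl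

/-- If the image of a rational point lies in the chart of `τ`, then the rational point comes from the
bend of `B_τ`. -/
theorem exists_of_colimTrop_eq {σ : Δ.cones} (g : ((blueDiag ι).bend (valHom v)).TPts σ)
    {τ : Δ.cones} {p : AffTrop τ.1} (e : colimTrop ι v (Quot.mk _ ⟨σ, g⟩) = TropToric.mk τ p) :
    ∃ g' : ((blueDiag ι).bend (valHom v)).TPts τ, tropPart ι v g' = p ∧
      (Quot.mk _ ⟨τ, g'⟩ : BlueColim ι v) = Quot.mk _ ⟨σ, g⟩ := by
  obtain ⟨ρ, h, h', z, hz, rfl⟩ := TropToric.exists_of_mk_eq e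
  obtain ⟨g', hg, hg'⟩ := exists_tropPart_eq (σ := σ) h g z hz
  exact ⟨g'.map h', (tropPart_map h' g').trans (congrArg _ hg'),
    (Quot.sound ⟨h', rfl⟩ : (Quot.mk _ ⟨ρ, g'⟩ : BlueColim ι v) = _).symm.trans (Quot.sound ⟨h, hg⟩)⟩

/-- The rational points of the bend of the blue model are embedded in the tropicalization of the toric
variety. -/
theorem isEmbedding_colimTrop : Topology.IsEmbedding (colimTrop ι v) := by
  have hc : Continuous (colimTrop ι v) :=
    continuous_coinduced_dom.2 (continuous_sigma fun τ =>
      (TropToric.continuous_mk τ).comp (continuous_tropPart τ))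
  refine ⟨⟨le_antisymm hc.le_induced fun O hO => ?_⟩, fun x y e => ?_⟩
  · -- The open set `O` is the preimage of the union of all open sets with preimage in `O`.
    refine ⟨⋃₀ {V | IsOpen V ∧ colimTrop ι v ⁻¹' V ⊆ O}, isOpen_sUnion fun V hV => hV.1,
      Set.Subset.antisymm (fun x ⟨V, hV, hx⟩ => hV.2 hx) fun x hx => ?_⟩
    obtain ⟨⟨τ, g⟩, rfl⟩ := Quot.exists_rep x
    have hOτ : IsOpen {g : ((blueDiag ι).bend (valHom v)).TPts τ |
        (Quot.mk _ ⟨τ, g⟩ : BlueColim ι v) ∈ O} :=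
      hO.preimage (continuous_coinduced_rng.comp continuous_sigmaMk)
    obtain ⟨O', hO', e⟩ := (isInducing_tropPart τ).isOpen_iff.1 hOτ
    refine ⟨TropToric.mk τ '' O', ⟨TropToric.isOpenMap_mk τ O' hO', ?_⟩,
      ⟨_, (Set.ext_iff.1 e g).2 hx, rfl⟩⟩
    rintro y ⟨p, hp, hy⟩
    obtain ⟨⟨σ, g₁⟩, rfl⟩ := Quot.exists_rep y
    obtain ⟨g', hg', e'⟩ := exists_of_colimTrop_eq g₁ hy.symm
    exact (congrArg (· ∈ O) e').mp ((Set.ext_iff.1 e g').1 ((congrArg (· ∈ O') hg').mpr hp))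
  · obtain ⟨⟨σ, g⟩, rfl⟩ := Quot.exists_rep x
    obtain ⟨⟨τ, g₁⟩, rfl⟩ := Quot.exists_rep y
    obtain ⟨g', hg', e'⟩ := exists_of_colimTrop_eq g e
    have hg₁ := tropPart_injective τ hg'
    exact e'.symm.trans (congrArg (fun g : ((blueDiag ι).bend (valHom v)).TPts τ =>
      (Quot.mk _ ⟨τ, g⟩ : BlueColim ι v)) hg₁)

/-! ### The image of the tropicalization map -/

theorem continuous_trop : Continuous (trop ι v) := by
  have h : ∀ τ : Δ.cones, Continuous (affTrop ι v τ) := fun τ =>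
    AffTrop.continuous_of_apply fun a =>
      (continuous_apply (A := fun _ : Γ(Y, subOpen ι τ) => ℝ≥0)
        (subΓ ι τ (toricMonomial k τ.1 a))).comp continuous_induced_dom
  exact continuous_coinduced_dom.2
    (continuous_sigma fun τ => (TropToric.continuous_mk τ).comp (h τ))

/-- The rational point of the bend of the blue model that is given by a valuation. -/
noncomputable def blueTPts {τ : Δ.cones}
    (w : AffAn (ι ≫ toricToSpec k Δ) v ((toricPresentation ι).U τ)) :
    ((blueDiag ι).bend (valHom v)).TPts τ :=
  (w.toTPts (ι ≫ toricToSpec k Δ) v (toricPresentation ι)).bendComp (blueβ ι)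

theorem bendVal_blueTPts {τ : Δ.cones}
    (w : AffAn (ι ≫ toricToSpec k Δ) v ((toricPresentation ι).U τ)) (b : blueMonoid ι τ) :
    (blueTPts w).bendVal b = w.1 b.1 := w.bendVal_toTPts b.1

theorem tropPart_blueTPts {τ : Δ.cones}
    (w : AffAn (ι ≫ toricToSpec k Δ) v ((toricPresentation ι).U τ)) :
    tropPart ι v (blueTPts w) = affTrop ι v τ w :=
  DFunLike.ext _ _ fun a => (bendVal_blueTPts w _).trans (congrArg w.1 (blueMonomial_coe ι τ a))

theorem subΓ_surjective (τ : Δ.cones) : Function.Surjective (subΓ ι τ) := by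
  have hU : IsAffineOpen (toricOpen k Δ τ) := by
    change IsAffineOpen (toricChart k Δ τ ''ᵁ ⊤)
    rw [Scheme.Hom.image_top_eq_opensRange]
    exact isAffineOpen_opensRange _
  have h1 : Function.Surjective (ι.app (toricOpen k Δ τ)) := ι.app_surjective _ hU
  have h2 : Function.Surjective (toricΓ k Δ τ) :=
    (ConcreteCategory.bijective_of_isIso ((Scheme.ΓSpecIso (.of (ToricRing k τ.1))).inv ≫
      ((toricChart k Δ τ).appIso ⊤).inv)).2
  exact h1.comp h2

/-- The blueprint `B_τ` spans the ring `ΓY_τ`, because `Y` is closed in the toric variety. -/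
theorem closure_blueMonoid (τ : Δ.cones) :
    AddSubmonoid.closure (blueMonoid ι τ : Set Γ(Y, subOpen ι τ)) = ⊤ := by
  refine eq_top_iff.2 fun r _ => ?_
  obtain ⟨a, rfl⟩ := subΓ_surjective (ι := ι) τ r
  induction a using AddMonoidAlgebra.induction_linear with
  | zero =>
    rw [map_zero]
    exact AddSubmonoid.zero_mem _
  | add a b ha hb =>
    rw [map_add]
    exact AddSubmonoid.add_mem _ (ha trivial) (hb trivial)
  | single u c =>
    refine AddSubmonoid.subset_closure ⟨(c, toricChar u), ?_⟩
    refine congrArg (subΓ ι τ) ?_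
    refine (AddMonoidAlgebra.single_mul_single _ _ _ _).trans ?_
    rw [zero_add, mul_one]
    rfl

/-- All rational points of the bend of the blue model come from valuations. -/
theorem blueTPts_surjective (τ : Δ.cones) : Function.Surjective
    (blueTPts : AffAn (ι ≫ toricToSpec k Δ) v ((toricPresentation ι).U τ) →
      ((blueDiag ι).bend (valHom v)).TPts τ) := by
  intro g
  let w : blueMonoid ι τ →* ℝ≥0 :=
    { toFun := fun b => g.bendVal b
      map_one' := map_one g.bendVal
      map_mul' := map_mul g.bendVal }
  have hstr : ∀ c : k, kstr (ι ≫ toricToSpec k Δ) (subOpen ι τ) c ∈ blueMonoid ι τ :=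
    kstr_mem_blueMonoid ι τ
  obtain ⟨W, hW⟩ := exists_valuation_extension (w := w) (fun b s h => g.bendVal_le fun _ =>
      (Multiset.sum_singleton (M := Γ(Y, subOpen ι τ)) b.1).trans h) (closure_blueMonoid τ)
    (e := ⟨_, hstr (-1)⟩) (by simp) (z := ⟨_, hstr 0⟩) (by simp)
  refine ⟨⟨W, fun c => (hW ⟨_, hstr c⟩).trans (g.bendVal_str c)⟩, ?_⟩
  exact TPts.ext_bendVal fun b => (bendVal_blueTPts _ b).trans (hW b)

theorem range_colimTrop : Set.range (colimTrop ι v) = Set.range (trop ι v) := by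
  refine Set.Subset.antisymm ?_ ?_
  · rintro _ ⟨x, rfl⟩
    obtain ⟨⟨τ, g⟩, rfl⟩ := Quot.exists_rep x
    obtain ⟨w, rfl⟩ := blueTPts_surjective τ g
    refine ⟨Quot.mk _ ⟨τ, w⟩, ?_⟩
    rw [colimTrop_mk, tropPart_blueTPts]
    rfl
  · rintro _ ⟨x, rfl⟩
    obtain ⟨⟨τ, w⟩, rfl⟩ := Quot.exists_rep x
    refine ⟨Quot.mk _ ⟨τ, blueTPts w⟩, ?_⟩
    rw [colimTrop_mk, tropPart_blueTPts]
    rfl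

/-- The Kajiwara–Payne tropicalization is homeomorphic to the space of rational points of the bend of
the blue model, compatibly with a given map `Φ` that sends valuations to rational points. -/
theorem exists_tropKP_homeomorph (Φ : Berk (ι ≫ toricToSpec k Δ) v (toricPresentation ι) →
      BendPts v (schemeDiag (ι ≫ toricToSpec k Δ) (toricPresentation ι)))
    (hΦ : ∀ (τ : Δ.cones) (w : AffAn (ι ≫ toricToSpec k Δ) v ((toricPresentation ι).U τ)),
      Φ (Berk.mk (ι ≫ toricToSpec k Δ) v (toricPresentation ι) τ w) =
        valPoint (ι ≫ toricToSpec k Δ) v (toricPresentation ι) τ w) :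
    ∃ Ψ : TropKP ι v ≃ₜ BendPts v (blueDiag ι), ∀ p,
      Ψ ⟨trop ι v p, Set.mem_range_self p⟩ = bendPtsMap v (blueβ ι) (Φ p) := by
  obtain ⟨Φ', hΦ'⟩ := (toricGlued ι (valHom v)).exists_homeomorph
    (fun τ => ((blueDiag ι).bend (valHom v)).TPts τ) (fun _ _ h g => g.map h)
    (fun _ => Homeomorph.refl _) fun _ _ _ _ => rfl
  let Θ : BlueColim ι v ≃ₜ TropKP ι v :=
    (isEmbedding_colimTrop (ι := ι) (v := v)).toHomeomorph.trans
      (Homeomorph.setCongr range_colimTrop)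
  refine ⟨Θ.symm.trans Φ', fun p => ?_⟩
  obtain ⟨⟨τ, w⟩, rfl⟩ := Quot.exists_rep p
  have e : Θ.symm ⟨trop ι v (Quot.mk _ ⟨τ, w⟩), Set.mem_range_self _⟩ =
      Quot.mk _ ⟨τ, blueTPts w⟩ := by
    refine Θ.symm_apply_eq.2 (Subtype.ext ?_)
    change _ = TropToric.mk τ (tropPart ι v (blueTPts w))
    rw [tropPart_blueTPts]
    rfl
  refine (congrArg Φ' e).trans ((hΦ' τ _).trans ?_)
  refine Eq.trans ?_ (congrArg (bendPtsMap v (blueβ ι)) (hΦ τ w)).symm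
  exact (TPts.ratMap_point (blueβ ι) (w.toTPts (ι ≫ toricToSpec k Δ) v (toricPresentation ι))).symm

end BlueTropicalization

end BlueTrop

theorem theoremC {k : Type u} [Field k] (v : Valuation k ℝ≥0) :
    (∀ (J : Type u) [Preorder J] (Y : Scheme.{u}) (f : Y ⟶ Spec (.of k))
        (P : BlueTrop.AffinePresentation Y J),
      ∃ Φ : BlueTrop.Berk f v P ≃ₜ BlueTrop.BendPts v (BlueTrop.schemeDiag f P),
        ∀ (j : J) (w : BlueTrop.AffAn f v (P.U j)),
          Φ (BlueTrop.Berk.mk f v P j w) = BlueTrop.valPoint f v P j w) ∧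
    (∀ (n : ℕ) (Δ : BlueTrop.Fan n) (Y : Scheme.{u}) (ι : Y ⟶ BlueTrop.toricVariety k Δ)
        [IsClosedImmersion ι],
      Continuous (BlueTrop.trop ι v) ∧
      Continuous (BlueTrop.bendPtsMap v (BlueTrop.blueβ ι)) ∧
      ∃ (Φ : BlueTrop.Berk (ι ≫ BlueTrop.toricToSpec k Δ) v (BlueTrop.toricPresentation ι) ≃ₜ
            BlueTrop.BendPts v (BlueTrop.schemeDiag (ι ≫ BlueTrop.toricToSpec k Δ)
              (BlueTrop.toricPresentation ι)))
        (Ψ : BlueTrop.TropKP ι v ≃ₜ BlueTrop.BendPts v (BlueTrop.blueDiag ι)),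
        (∀ (τ : Δ.cones) (w : BlueTrop.AffAn (ι ≫ BlueTrop.toricToSpec k Δ) v
            ((BlueTrop.toricPresentation ι).U τ)),
          Φ (BlueTrop.Berk.mk (ι ≫ BlueTrop.toricToSpec k Δ) v (BlueTrop.toricPresentation ι) τ w) =
            BlueTrop.valPoint (ι ≫ BlueTrop.toricToSpec k Δ) v
              (BlueTrop.toricPresentation ι) τ w) ∧
        ∀ p : BlueTrop.Berk (ι ≫ BlueTrop.toricToSpec k Δ) v (BlueTrop.toricPresentation ι),
          Ψ ⟨BlueTrop.trop ι v p, Set.mem_range_self p⟩ =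
            BlueTrop.bendPtsMap v (BlueTrop.blueβ ι) (Φ p)) := by
  refine ⟨fun J _ Y f P => BlueTrop.exists_berk_homeomorph.{u, u} f v P, fun n Δ Y ι _ => ?_⟩
  obtain ⟨Φ, hΦ⟩ := BlueTrop.exists_berk_homeomorph.{u, 0} (ι ≫ BlueTrop.toricToSpec k Δ) v
    (BlueTrop.toricPresentation ι)
  obtain ⟨Ψ, hΨ⟩ := BlueTrop.exists_tropKP_homeomorph Φ hΦ
  exact ⟨BlueTrop.continuous_trop, BlueTrop.OBSpace.continuous_ratPtsMap _
    (BlueTrop.AlgDiag.Hom.toSpec_spaceMap _), Φ, Ψ, hΦ, hΨ⟩
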